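/- Let $V$ be a complex vector space of dimension $7$. Call a three-form $\omega\in\wedge^3V^*$ generic if its $GL(V)$-orbit is Zariski open in $\wedge^3V^*$, and let $X_\omega=\{L\in Gr(3,V) : \omega|_L=0\}$ be the hyperplane section of $Gr(3,V)\subset\mathbb P(\wedge^3V)$ defined by $\omega$. Let $G_2=\mathrm{Aut}(\mathbb O)$ be the automorphism group of the complexified octonions, and let $O_3=\{A\in M_3(\mathbb C) : AA^{t}=I\}$ be the complex orthogonal group, both regarded as linear algebraic groups. Generic three-forms exist. If $\omega$ is generic, then $X_\omega$ is a compactification of $G_2/O_3$. Precisely: $X_\omega$ is a closed irreducible subvariety of $\mathbb P(\wedge^3V)$; there is an isomorphism of algebraic groups from $G_2$ onto the stabilizer of $\omega$ in $SL(V)$, through which $G_2$ acts on $X_\omega$; and there is a point $L\in X_\omega$ whose stabilizer $H\subset G_2$ is isomorphic to $O_3$ as an algebraic group, such that the orbit map $gH\mapsto g\cdot L$ is an open immersion of algebraic varieties $G_2/H\to X_\omega$ with Zariski dense image. -/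

import Mathlib

open scoped LinearAlgebra.Projectivization Pointwise Quaternion Topology

noncomputable section

/-! ### Spaces with functions (varieties in the classical language) -/

/-- The data of a classical complex algebraic variety on a set of closed points `M`: its Zariski
topology, and the predicate `RegAt f x`, "the function `f` is regular near the point `x`".
A function is regular on an open set iff it is regular near each of its points. Only the concrete
instances built below are used. -/
structure SpaceWithFunctions (M : Type*) where
  top : TopologicalSpace M
  RegAt : (M → ℂ) → M → Prop

namespace SpaceWithFunctions

/-- The structure induced on `M` by a map to `N`: the induced topology, and functions that are
locally restrictions of regular functions. Used for injective maps, i.e. for subvarieties. -/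
def induced {M N : Type*} (φ : M → N) (T : SpaceWithFunctions N) : SpaceWithFunctions M where
  top := T.top.induced φ
  RegAt f x := ∃ F : N → ℂ, T.RegAt F (φ x) ∧
    ∃ U : Set N, IsOpen[T.top] U ∧ φ x ∈ U ∧ ∀ y : M, φ y ∈ U → f y = F (φ y)

/-- The quotient `G / H` of an algebraic group by a subgroup: the quotient topology, and a function
is regular iff its pull-back to `G` is. -/
def quotient {G : Type*} [Group G] (S : SpaceWithFunctions G) (H : Subgroup G) :
    SpaceWithFunctions (G ⧸ H) where
  top := S.top.coinduced (fun g : G => (g : G ⧸ H))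
  RegAt f y := ∀ g : G, (g : G ⧸ H) = y → S.RegAt (fun g' : G => f (g' : G ⧸ H)) g

/-- Morphisms: continuous maps that pull regular functions back to regular functions. -/
def IsMorphism {M N : Type*} (S : SpaceWithFunctions M) (T : SpaceWithFunctions N)
    (φ : M → N) : Prop :=
  Continuous[S.top, T.top] φ ∧ ∀ (f : N → ℂ) (x : M), T.RegAt f (φ x) → S.RegAt (f ∘ φ) x

/-- Isomorphisms: bijections that are morphisms in both directions. -/
def IsIsomorphism {M N : Type*} (S : SpaceWithFunctions M) (T : SpaceWithFunctions N)
    (e : M ≃ N) : Prop :=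
  S.IsMorphism T e ∧ T.IsMorphism S e.symm

/-- Open immersions: isomorphisms onto an open subset (with its induced structure). -/
def IsOpenImmersion {M N : Type*} (S : SpaceWithFunctions M) (T : SpaceWithFunctions N)
    (φ : M → N) : Prop :=
  @Topology.IsOpenEmbedding M N S.top T.top φ ∧
    ∀ (f : N → ℂ) (x : M), T.RegAt f (φ x) ↔ S.RegAt (f ∘ φ) x

end SpaceWithFunctions

/-- The polynomial functions on a complex vector space. -/
def polyFun (E : Type*) [AddCommGroup E] [Module ℂ E] : Subalgebra ℂ (E → ℂ) :=
  Algebra.adjoin ℂ {f | ∃ ℓ : Module.Dual ℂ E, f = fun x => ℓ x}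

/-- A complex vector space as an affine space: the Zariski topology, with the sets `{q ≠ 0}` as a
basis, and functions that are locally quotients `p / q` of polynomial functions. -/
def affineVar (E : Type*) [AddCommGroup E] [Module ℂ E] : SpaceWithFunctions E where
  top := TopologicalSpace.generateFrom {U | ∃ q ∈ polyFun E, U = {x | q x ≠ 0}}
  RegAt f x := ∃ p ∈ polyFun E, ∃ q ∈ polyFun E, q x ≠ 0 ∧ ∀ y, q y ≠ 0 → f y = p y / q y

/-- The value of a polynomial in the linear forms on `E` at a vector of `E`. -/
def evalAt {E : Type*} [AddCommGroup E] [Module ℂ E]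
    (P : MvPolynomial (Module.Dual ℂ E) ℂ) (x : E) : ℂ :=
  MvPolynomial.eval (fun ℓ : Module.Dual ℂ E => ℓ x) P

/-- The projective space `ℙ(E)` of lines in `E`: the Zariski topology, and functions that are
locally quotients of homogeneous polynomials of the same degree. (Neither depends on the choice of
the representative `x.rep` of the line `x`.) -/
def projVar (E : Type*) [AddCommGroup E] [Module ℂ E] : SpaceWithFunctions (ℙ ℂ E) where
  top := TopologicalSpace.generateFrom
    {U | ∃ (d : ℕ) (Q : MvPolynomial (Module.Dual ℂ E) ℂ), Q.IsHomogeneous d ∧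
      U = {x | evalAt Q x.rep ≠ 0}}
  RegAt f x := ∃ (d : ℕ) (P Q : MvPolynomial (Module.Dual ℂ E) ℂ),
    P.IsHomogeneous d ∧ Q.IsHomogeneous d ∧ evalAt Q x.rep ≠ 0 ∧
      ∀ y : ℙ ℂ E, evalAt Q y.rep ≠ 0 → f y = evalAt P y.rep / evalAt Q y.rep

/-- A closed subgroup `G` of `GL(W)` as a variety, through `g ↦ (g, g⁻¹)` in
`End(W) × End(W)`. -/
def linGroupVar {W : Type*} [AddCommGroup W] [Module ℂ W] (G : Subgroup (W ≃ₗ[ℂ] W)) :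
    SpaceWithFunctions G :=
  (affineVar ((W →ₗ[ℂ] W) × (W →ₗ[ℂ] W))).induced
    fun g => ((g : W ≃ₗ[ℂ] W).toLinearMap, (g : W ≃ₗ[ℂ] W).symm.toLinearMap)

/-! ### The groups `O₃` and `G₂` -/

/-- The complex orthogonal group `O₃ = {A : A Aᵀ = 1}` as a closed subvariety of the
`3 × 3` matrices. -/
def orthogonalVar : SpaceWithFunctions (Matrix.orthogonalGroup (Fin 3) ℂ) :=
  (affineVar (Matrix (Fin 3) (Fin 3) ℂ)).induced Subtype.val

/-- The (complexified) octonions, as pairs of (complexified) quaternions. -/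
abbrev ComplexOctonion : Type := ℍ[ℂ] × ℍ[ℂ]

/-- The Cayley-Dickson product of octonions. Here `star` is the `ℂ`-linear conjugation of
quaternions. -/
def octMul (x y : ComplexOctonion) : ComplexOctonion :=
  (x.1 * y.1 - star y.2 * x.2, y.2 * x.1 + x.2 * star y.1)

/-- `G₂ = Aut(𝕆)`, the group of all algebra automorphisms of the complex octonions. -/
def G2 : Subgroup (ComplexOctonion ≃ₗ[ℂ] ComplexOctonion) where
  carrier := {g | ∀ x y, g (octMul x y) = octMul (g x) (g y)}
  mul_mem' := by
    intro a b ha hb x y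
    simp only [Set.mem_ofPred_eq] at ha hb
    rw [LinearEquiv.mul_apply, hb, ha]
    rfl
  one_mem' := by intro x y; rfl
  inv_mem' := by
    intro a ha x y
    simp only [Set.mem_ofPred_eq] at ha
    apply a.injective
    have h : ∀ z, a (a⁻¹ z) = z := a.apply_symm_apply
    rw [ha, h, h, h]

/-! ### Three-forms and hyperplane sections of the Grassmannian -/

section

variable {V : Type*} [AddCommGroup V] [Module ℂ V]

/-- A three-form is generic if its `GL(V)`-orbit is (Zariski) open in `⋀³V*`. -/
def IsGenericForm (ω : V [⋀^Fin 3]→ₗ[ℂ] ℂ) : Prop :=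
  IsOpen[(affineVar (V [⋀^Fin 3]→ₗ[ℂ] ℂ)).top]
    {η | ∃ g : V ≃ₗ[ℂ] V, η = ω.compLinearMap g.toLinearMap}

/-- The stabilizer of a three-form in `SL(V)`. -/
def slStabilizer (ω : V [⋀^Fin 3]→ₗ[ℂ] ℂ) : Subgroup (V ≃ₗ[ℂ] V) where
  carrier := {g | LinearEquiv.det g = 1 ∧ ω.compLinearMap g.toLinearMap = ω}
  mul_mem' := by
    rintro a b ⟨ha, ha'⟩ ⟨hb, hb'⟩
    refine ⟨by rw [map_mul, ha, hb, one_mul], ?_⟩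
    ext v
    have h1 := congrArg (fun η => η (fun i => b (v i))) ha'
    have h2 := congrArg (fun η => η v) hb'
    exact h1.trans h2
  one_mem' := ⟨map_one _, by ext v; rfl⟩
  inv_mem' := by
    rintro a ⟨ha, ha'⟩
    refine ⟨by rw [map_inv, ha, inv_one], ?_⟩
    ext v
    have h := congrArg (fun η => η (fun i => a⁻¹ (v i))) ha'
    refine h.symm.trans ?_
    change ω (fun i => a (a⁻¹ (v i))) = ω v
    congr 1
    funext i
    exact a.apply_symm_apply (v i)

variable (V) in
/-- The Grassmannian `Gr(3, V)` of three-planes in `V`. -/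
def Gr3 : Type _ := {L : Submodule ℂ V // Module.finrank ℂ L = 3}

/-- A basis of a three-plane, as a family of vectors of `V`. -/
def Gr3.frame (L : Gr3 V) : Fin 3 → V :=
  haveI : Module.Finite ℂ L.1 := Module.finite_of_finrank_pos (by rw [L.2]; norm_num)
  fun i => (Module.finBasisOfFinrankEq ℂ L.1 L.2 i : V)

theorem Gr3.linearIndependent_frame (L : Gr3 V) : LinearIndependent ℂ L.frame := by
  have : Module.Finite ℂ L.1 := Module.finite_of_finrank_pos (by rw [L.2]; norm_num)
  exact (Module.finBasisOfFinrankEq ℂ L.1 L.2).linearIndependent.map' L.1.subtype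
    (Submodule.ker_subtype _)

theorem iotaMulti_ne_zero {v : Fin 3 → V} (hv : LinearIndependent ℂ v) :
    exteriorPower.ιMulti ℂ 3 v ≠ 0 := by
  have h := (exteriorPower.ιMulti_family_linearIndependent_field (n := 3) hv).ne_zero
    ⟨Finset.univ, by simp [Set.powersetCard]⟩
  intro h0
  apply h
  rw [exteriorPower.ιMulti_family]
  set e := Set.powersetCard.ofFinEmbEquiv.symm
    (⟨Finset.univ, by simp [Set.powersetCard]⟩ : Set.powersetCard (Fin 3) 3)
  have h1 := (exteriorPower.ιMulti ℂ 3 (M := V)).map_perm v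
    (Equiv.ofBijective e (Finite.injective_iff_bijective.1 e.injective))
  rw [h0, smul_zero] at h1
  exact h1

/-- The Plücker embedding `L = ⟨x, y, z⟩ ↦ [x ∧ y ∧ z]`. -/
def plucker (L : Gr3 V) : ℙ ℂ (⋀[ℂ]^3 V) :=
  Projectivization.mk ℂ (exteriorPower.ιMulti ℂ 3 L.frame)
    (iotaMulti_ne_zero L.linearIndependent_frame)

/-- The hyperplane section `X_ω` of `Gr(3, V)`: the three-planes `⟨x, y, z⟩` with
`ω(x, y, z) = 0`, i.e. those on which `ω` vanishes. -/
def hyperplaneSection (ω : V [⋀^Fin 3]→ₗ[ℂ] ℂ) : Set (Gr3 V) :=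
  {L | ∀ v : Fin 3 → V, (∀ i, v i ∈ L.1) → ω v = 0}

/-- `X_ω` as a subvariety of `ℙ(⋀³V)`. -/
def sectionVar (ω : V [⋀^Fin 3]→ₗ[ℂ] ℂ) : SpaceWithFunctions (hyperplaneSection ω) :=
  (projVar (⋀[ℂ]^3 V)).induced fun L => plucker L.1

end

end

noncomputable section

/-! ### Polynomial functions and polynomial maps -/

section PolyFun

variable {E F G H : Type*} [AddCommGroup E] [Module ℂ E] [AddCommGroup F] [Module ℂ F]
  [AddCommGroup G] [Module ℂ G] [AddCommGroup H] [Module ℂ H]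

/-! The model is the form `octForm`, (x, y, z) ↦ B(xy, z) on the imaginary octonions. Its tangent
map X ↦ `formDeriv` is onto (`formDerivₗ_range`), so g ↦ ω ∘ g is a dominant polynomial map, and by
Chevalley's theorem its orbit contains a nonempty open set; translating by GL(V) makes the orbit
open. Nonempty open sets of an affine space meet, so every generic form is `octForm` in suitable
coordinates (`exists_eq_octForm`).

G₂ preserves B and the product, hence ω; it has determinant 1 on V because it preserves the volume
form `octVol`. Conversely, the isotropic vectors x of B are those for which ω(x, ·, ·) has a kernel
larger than the line of x. An element of the stabilizer therefore preserves the null cone and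
multiplies B by a scalar c; the norm of a cross product gives c³ = 1, determinant 1 gives c⁷ = 1, so
c = 1 and the element extends to an automorphism.

An automorphism is the same as a basic triple, the image of (e₁, e₂, e₄), and depends polynomially
on it (`tripleMap`; that each basic triple occurs is the Cayley–Dickson construction). If ω vanishes
on a plane, any B-orthonormal basis of the plane is a basic triple. So the orbit of L = ⟨e₁, e₂, e₄⟩
consists of the planes of X_ω with an orthonormal basis, and the stabilizer of L is the group of
changes of orthonormal basis, O₃.

To see that the orbit map is an open immersion, regular functions must descend from G₂ to X_ω
(`exists_local_quotient`). Gram–Schmidt without normalization gives a regular orthogonal frame near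
a point of the orbit; normalizing it requires square roots of three regular functions. A function on
X_ω that is a quotient of polynomials in the normalized frame is invariant under the sign changes of
these roots, which can thus be eliminated one by one. Applied to an indicator function, the same
statement shows that the orbit map is open.

X_ω is closed by a cubic criterion for decomposability (`map_contraction`), and irreducible because
an affine space parametrizes a dense set of its frames (`exists_isotropicTriple_ne_zero`). Density
of the orbit then follows from openness. -/

theorem polyFun_dual (ℓ : Module.Dual ℂ E) : (fun x => ℓ x) ∈ polyFun E :=
  Algebra.subset_adjoin ⟨ℓ, rfl⟩

theorem polyFun_const (c : ℂ) : (fun _ => c) ∈ polyFun E := (polyFun E).algebraMap_mem c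

@[elab_as_elim]
theorem polyFun_induction {P : (p : E → ℂ) → p ∈ polyFun E → Prop}
    (dual : ∀ ℓ : Module.Dual ℂ E, P (fun x => ℓ x) (polyFun_dual ℓ))
    (const : ∀ c : ℂ, P (fun _ => c) (polyFun_const c))
    (add : ∀ f g hf hg, P f hf → P g hg → P (f + g) ((polyFun E).add_mem hf hg))
    (mul : ∀ f g hf hg, P f hf → P g hg → P (f * g) ((polyFun E).mul_mem hf hg))
    {p : E → ℂ} (hp : p ∈ polyFun E) : P p hp := by
  induction hp using Algebra.adjoin_induction with
  | mem f hf => obtain ⟨ℓ, rfl⟩ := hf; exact dual ℓ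
  | algebraMap c => exact const c
  | add f g hf' hg' hf hg => exact add f g hf' hg' hf hg
  | mul f g hf' hg' hf hg => exact mul f g hf' hg' hf hg

theorem polyFun_sum {ι : Type*} (s : Finset ι) {f : ι → E → ℂ} (hf : ∀ i ∈ s, f i ∈ polyFun E) :
    (fun x => ∑ i ∈ s, f i x) ∈ polyFun E := by
  have := (polyFun E).sum_mem hf
  convert this using 1
  ext x; simp

/-- A map is polynomial if it pulls polynomial functions back to polynomial functions. -/
def IsPolyMap (Φ : E → F) : Prop := ∀ p ∈ polyFun F, (fun x => p (Φ x)) ∈ polyFun E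

theorem isPolyMap_of_dual {Φ : E → F}
    (h : ∀ ℓ : Module.Dual ℂ F, (fun x => ℓ (Φ x)) ∈ polyFun E) : IsPolyMap Φ := by
  intro p hp
  induction hp using polyFun_induction with
  | dual ℓ => exact h ℓ
  | const c => exact polyFun_const c
  | add f g _ _ hf hg => exact (polyFun E).add_mem hf hg
  | mul f g _ _ hf hg => exact (polyFun E).mul_mem hf hg

theorem IsPolyMap.dual {Φ : E → F} (h : IsPolyMap Φ) (ℓ : Module.Dual ℂ F) :
    (fun x => ℓ (Φ x)) ∈ polyFun E := h _ (polyFun_dual ℓ)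

theorem isPolyMap_linear (Φ : E →ₗ[ℂ] F) : IsPolyMap Φ :=
  isPolyMap_of_dual fun ℓ => polyFun_dual (ℓ ∘ₗ Φ)

theorem isPolyMap_apply {ι : Type*} (i : ι) : IsPolyMap (fun w : ι → F => w i) :=
  isPolyMap_linear (LinearMap.proj (R := ℂ) (φ := fun _ : ι => F) i)

theorem isPolyMap_const (c : F) : IsPolyMap (fun _ : E => c) := fun p _ => polyFun_const (p c)

theorem IsPolyMap.comp {Ψ : F → G} {Φ : E → F} (hΨ : IsPolyMap Ψ) (hΦ : IsPolyMap Φ) :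
    IsPolyMap (fun x => Ψ (Φ x)) := fun p hp => hΦ _ (hΨ p hp)

theorem IsPolyMap.linear {Φ : E → F} (hΦ : IsPolyMap Φ) (A : F →ₗ[ℂ] G) :
    IsPolyMap (fun x => A (Φ x)) := (isPolyMap_linear A).comp hΦ

theorem IsPolyMap.add {Φ Ψ : E → F} (hΦ : IsPolyMap Φ) (hΨ : IsPolyMap Ψ) :
    IsPolyMap (fun x => Φ x + Ψ x) := isPolyMap_of_dual fun ℓ => by
  simp only [map_add]
  exact (polyFun E).add_mem (hΦ.dual ℓ) (hΨ.dual ℓ)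

theorem IsPolyMap.sum {ι : Type*} (s : Finset ι) {Φ : ι → E → F}
    (hΦ : ∀ i ∈ s, IsPolyMap (Φ i)) : IsPolyMap (fun x => ∑ i ∈ s, Φ i x) :=
  isPolyMap_of_dual fun ℓ => by
    simpa only [map_sum] using polyFun_sum s fun i hi => (hΦ i hi).dual ℓ

theorem IsPolyMap.smul {f : E → ℂ} {Φ : E → F} (hf : f ∈ polyFun E) (hΦ : IsPolyMap Φ) :
    IsPolyMap (fun x => f x • Φ x) := isPolyMap_of_dual fun ℓ => by
  simp only [map_smul, smul_eq_mul]
  exact (polyFun E).mul_mem hf (hΦ.dual ℓ)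

theorem IsPolyMap.sub {Φ Ψ : E → F} (hΦ : IsPolyMap Φ) (hΨ : IsPolyMap Ψ) :
    IsPolyMap (fun x => Φ x - Ψ x) := isPolyMap_of_dual fun ℓ => by
  simp only [map_sub]
  exact (polyFun E).sub_mem (hΦ.dual ℓ) (hΨ.dual ℓ)

theorem IsPolyMap.mem_polyFun {Φ : E → ℂ} (h : IsPolyMap Φ) : Φ ∈ polyFun E :=
  h.dual LinearMap.id

theorem IsPolyMap.prodMk {Φ : E → F} {Ψ : E → G} (hΦ : IsPolyMap Φ) (hΨ : IsPolyMap Ψ) :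
    IsPolyMap (fun x => (Φ x, Ψ x)) := by
  simpa using (hΦ.linear (LinearMap.inl ℂ F G)).add (hΨ.linear (LinearMap.inr ℂ F G))

theorem IsPolyMap.pi {ι : Type*} [Fintype ι] [DecidableEq ι] {Φ : E → ι → F}
    (hΦ : ∀ i, IsPolyMap fun x => Φ x i) : IsPolyMap Φ := by
  have h := IsPolyMap.sum Finset.univ
    fun i _ => (hΦ i).linear (LinearMap.single ℂ (fun _ : ι => F) i)
  have he : Φ = fun x => ∑ i, LinearMap.single ℂ (fun _ : ι => F) i (Φ x i) := by
    funext x j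
    simp [Finset.sum_apply, Pi.single_apply]
  rwa [he]

theorem IsPolyMap.bilin [FiniteDimensional ℂ F] (β : F →ₗ[ℂ] G →ₗ[ℂ] H) {Φ : E → F} {Ψ : E → G}
    (hΦ : IsPolyMap Φ) (hΨ : IsPolyMap Ψ) : IsPolyMap (fun x => β (Φ x) (Ψ x)) := by
  let b := Module.finBasis ℂ F
  have h : (fun x => β (Φ x) (Ψ x)) = fun x => ∑ i, (b.coord i (Φ x)) • β (b i) (Ψ x) := by
    funext x
    have := congrArg (fun z => β z (Ψ x)) (b.sum_repr (Φ x)).symm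
    simpa [-Module.Basis.sum_repr] using this
  rw [h]
  exact IsPolyMap.sum _ fun i _ => IsPolyMap.smul (hΦ.dual _) (hΨ.linear _)

/-- Reduces questions of vanishing to one variable, without coordinates or finiteness assumptions on
`E`. -/
theorem polyFun_line {p : E → ℂ} (hp : p ∈ polyFun E) (x v : E) :
    ∃ P : Polynomial ℂ, ∀ t : ℂ, p (x + t • v) = P.eval t := by
  induction hp using polyFun_induction with
  | dual ℓ => exact ⟨Polynomial.C (ℓ x) + Polynomial.C (ℓ v) * Polynomial.X, fun t => by
      simp; ring⟩
  | const c => exact ⟨Polynomial.C c, fun t => by simp⟩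
  | add f g _ _ hf hg =>
    obtain ⟨P, hP⟩ := hf
    obtain ⟨Q, hQ⟩ := hg
    exact ⟨P + Q, fun t => by simp [hP, hQ]⟩
  | mul f g _ _ hf hg =>
    obtain ⟨P, hP⟩ := hf
    obtain ⟨Q, hQ⟩ := hg
    exact ⟨P * Q, fun t => by simp [hP, hQ]⟩

/-- A polynomial function vanishes on a line as soon as it vanishes at infinitely many points. -/
theorem polyFun_eq_zero_of_line {p : E → ℂ} (hp : p ∈ polyFun E) (x v : E)
    (h : {t : ℂ | p (x + t • v) = 0}.Infinite) (t : ℂ) : p (x + t • v) = 0 := by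
  obtain ⟨P, hP⟩ := polyFun_line hp x v
  have hP0 : P = 0 := Polynomial.eq_zero_of_infinite_isRoot P (h.mono fun t ht => by
    simpa [Polynomial.IsRoot, ← hP] using ht)
  rw [hP, hP0, Polynomial.eval_zero]

theorem finite_line_zeros {p : E → ℂ} (hp : p ∈ polyFun E) (x v : E)
    (h : ∃ t : ℂ, p (x + t • v) ≠ 0) : {t : ℂ | p (x + t • v) = 0}.Finite := by
  by_contra hinf
  obtain ⟨t, ht⟩ := h
  exact ht (polyFun_eq_zero_of_line hp x v hinf t)

/-- On the line that joins a non-zero of `p` to a non-zero of `q`, both functions have finitely many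
zeros, and ℂ is infinite. This is the irreducibility of affine space. -/
theorem exists_ne_zero_of_polyFun {p q : E → ℂ} (hp : p ∈ polyFun E) (hq : q ∈ polyFun E)
    (h1 : ∃ x, p x ≠ 0) (h2 : ∃ x, q x ≠ 0) : ∃ x, p x ≠ 0 ∧ q x ≠ 0 := by
  obtain ⟨x, hx⟩ := h1
  obtain ⟨y, hy⟩ := h2
  have f1 := finite_line_zeros hp x (y - x) ⟨0, by simpa using hx⟩
  have f2 := finite_line_zeros hq x (y - x) ⟨1, by simpa using hy⟩
  obtain ⟨t, ht⟩ := (f1.union f2).infinite_compl.nonempty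
  simp only [Set.mem_compl_iff, Set.mem_union, Set.mem_ofPred_eq, not_or] at ht
  exact ⟨_, ht⟩

/-! ### The Zariski topology of an affine space -/

theorem isOpen_affineVar_iff {U : Set E} : IsOpen[(affineVar E).top] U ↔
    ∀ x ∈ U, ∃ q ∈ polyFun E, q x ≠ 0 ∧ ∀ y, q y ≠ 0 → y ∈ U := by
  constructor
  · intro hU
    change TopologicalSpace.GenerateOpen _ U at hU
    induction hU with
    | basic s hs =>
      obtain ⟨q, hq, rfl⟩ := hs
      exact fun x hx => ⟨q, hq, hx, fun y hy => hy⟩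
    | univ => exact fun x _ => ⟨fun _ => 1, polyFun_const 1, one_ne_zero, fun y _ => trivial⟩
    | inter s t _ _ hs ht =>
      intro x hx
      obtain ⟨q, hq, hqx, hqs⟩ := hs x hx.1
      obtain ⟨r, hr, hrx, hrt⟩ := ht x hx.2
      exact ⟨q * r, (polyFun E).mul_mem hq hr, mul_ne_zero hqx hrx, fun y hy =>
        ⟨hqs y (left_ne_zero_of_mul hy), hrt y (right_ne_zero_of_mul hy)⟩⟩
    | sUnion S _ ih =>
      rintro x ⟨s, hs, hx⟩
      obtain ⟨q, hq, hqx, hqs⟩ := ih s hs x hx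
      exact ⟨q, hq, hqx, fun y hy => ⟨s, hs, hqs y hy⟩⟩
  · intro h
    let := (affineVar E).top
    rw [isOpen_iff_forall_mem_open]
    intro x hx
    obtain ⟨q, hq, hqx, hqU⟩ := h x hx
    exact ⟨{y | q y ≠ 0}, hqU, TopologicalSpace.isOpen_generateFrom_of_mem ⟨q, hq, rfl⟩, hqx⟩

theorem isOpen_ne_zero {q : E → ℂ} (hq : q ∈ polyFun E) :
    IsOpen[(affineVar E).top] {x | q x ≠ 0} :=
  TopologicalSpace.isOpen_generateFrom_of_mem ⟨q, hq, rfl⟩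

theorem IsPolyMap.isMorphism {Φ : E → F} (hΦ : IsPolyMap Φ) :
    (affineVar E).IsMorphism (affineVar F) Φ := by
  constructor
  · let := (affineVar E).top
    refine continuous_generateFrom_iff.2 ?_
    rintro _ ⟨q, hq, rfl⟩
    exact isOpen_ne_zero (hΦ q hq)
  · rintro f x ⟨p, hp, q, hq, hx, h⟩
    exact ⟨_, hΦ p hp, _, hΦ q hq, hx, fun y hy => h _ hy⟩

/-- Nonempty Zariski open subsets of an affine space meet. -/
theorem affineVar_inter_nonempty {U U' : Set E} (hU : IsOpen[(affineVar E).top] U)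
    (hU' : IsOpen[(affineVar E).top] U') (h : U.Nonempty) (h' : U'.Nonempty) :
    (U ∩ U').Nonempty := by
  obtain ⟨x, hx⟩ := h
  obtain ⟨y, hy⟩ := h'
  obtain ⟨q, hq, hqx, hqU⟩ := isOpen_affineVar_iff.1 hU x hx
  obtain ⟨r, hr, hry, hrU⟩ := isOpen_affineVar_iff.1 hU' y hy
  obtain ⟨z, hz1, hz2⟩ := exists_ne_zero_of_polyFun hq hr ⟨x, hqx⟩ ⟨y, hry⟩
  exact ⟨z, hqU z hz1, hrU z hz2⟩

end PolyFun

/-! ### Generalities on spaces with functions -/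

namespace SpaceWithFunctions

variable {M M' N N' : Type*}

theorem IsMorphism.induced {S : SpaceWithFunctions M'} {T : SpaceWithFunctions N'}
    {Φ : M' → N'} (h : S.IsMorphism T Φ) {i : M → M'} {j : N → N'} {φ : M → N}
    (hφ : ∀ x, j (φ x) = Φ (i x)) : (S.induced i).IsMorphism (T.induced j) φ := by
  have hj : j ∘ φ = Φ ∘ i := funext hφ
  constructor
  · let := S.top
    let := T.top
    let : TopologicalSpace M := S.top.induced i
    change @Continuous _ _ _ (T.top.induced j) φ
    rw [continuous_induced_rng, hj]
    exact h.1.comp continuous_induced_dom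
  · rintro f x ⟨F, hF, U, hU, hxU, hfF⟩
    refine ⟨F ∘ Φ, h.2 F (i x) (by rwa [← hφ]), Φ ⁻¹' U, ?_, ?_, fun y hy => ?_⟩
    · exact @IsOpen.preimage _ _ S.top T.top _ h.1 _ hU
    · simpa [← hφ] using hxU
    · simp only [Function.comp_apply, ← hφ]
      exact hfF _ (by simpa [← hφ] using hy)

theorem induced_isMorphism (S : SpaceWithFunctions N) (i : M → N) :
    (S.induced i).IsMorphism S i := by
  constructor
  · exact @continuous_induced_dom _ _ i S.top
  · exact fun f x hf => ⟨f, hf, Set.univ, @isOpen_univ _ S.top, trivial, fun y _ => rfl⟩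

theorem IsMorphism.comp {S : SpaceWithFunctions M} {T : SpaceWithFunctions N}
    {R : SpaceWithFunctions N'} {ψ : N → N'} {φ : M → N} (hψ : T.IsMorphism R ψ)
    (hφ : S.IsMorphism T φ) : S.IsMorphism R (ψ ∘ φ) :=
  ⟨@Continuous.comp _ _ _ S.top T.top R.top _ _ hψ.1 hφ.1,
    fun f x hf => hφ.2 _ x (hψ.2 f (φ x) hf)⟩

/-- A morphism to the ambient space with values in a subvariety is a morphism to the
subvariety. -/
theorem IsMorphism.codRestrict {S : SpaceWithFunctions M} {T : SpaceWithFunctions N'}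
    (hS : ∀ (f g : M → ℂ) (x : M) (U : Set M), S.RegAt f x → IsOpen[S.top] U → x ∈ U →
      (∀ y ∈ U, g y = f y) → S.RegAt g x)
    {j : N → N'} {φ : M → N} (h : S.IsMorphism T (fun x => j (φ x))) :
    S.IsMorphism (T.induced j) φ := by
  constructor
  · let := S.top
    let := T.top
    change @Continuous _ _ _ (T.top.induced j) φ
    rw [continuous_induced_rng]
    exact h.1
  · rintro f x ⟨F, hF, U, hU, hxU, hfF⟩
    exact hS _ _ x _ (h.2 F x hF) (@IsOpen.preimage _ _ S.top T.top _ h.1 _ hU) hxU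
      fun y hy => hfF _ hy

/-- The local rings of a space with functions: regular functions form a ring, can be inverted where
they do not vanish, and have open non-vanishing loci. -/
structure IsLocallyRinged (S : SpaceWithFunctions M) : Prop where
  const : ∀ (c : ℂ) (x : M), S.RegAt (fun _ => c) x
  add : ∀ (f g : M → ℂ) (x : M), S.RegAt f x → S.RegAt g x → S.RegAt (f + g) x
  mul : ∀ (f g : M → ℂ) (x : M), S.RegAt f x → S.RegAt g x → S.RegAt (f * g) x
  inv : ∀ (f : M → ℂ) (x : M), S.RegAt f x → f x ≠ 0 → S.RegAt f⁻¹ x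
  isOpen : ∀ (f : M → ℂ) (x : M), S.RegAt f x → f x ≠ 0 →
    ∃ U : Set M, IsOpen[S.top] U ∧ x ∈ U ∧ ∀ y ∈ U, f y ≠ 0

theorem isLocallyRinged_induced {T : SpaceWithFunctions N} (hT : T.IsLocallyRinged) (i : M → N) :
    (T.induced i).IsLocallyRinged where
  const c x := ⟨fun _ => c, hT.const c _, Set.univ, @isOpen_univ _ T.top, trivial, fun _ _ => rfl⟩
  add := by
    rintro f g x ⟨F, hF, U, hU, hxU, hfF⟩ ⟨F', hF', U', hU', hxU', hfF'⟩
    exact ⟨F + F', hT.add _ _ _ hF hF', U ∩ U', @IsOpen.inter _ T.top _ _ hU hU', ⟨hxU, hxU'⟩,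
      fun y hy => by simp [hfF y hy.1, hfF' y hy.2]⟩
  mul := by
    rintro f g x ⟨F, hF, U, hU, hxU, hfF⟩ ⟨F', hF', U', hU', hxU', hfF'⟩
    exact ⟨F * F', hT.mul _ _ _ hF hF', U ∩ U', @IsOpen.inter _ T.top _ _ hU hU', ⟨hxU, hxU'⟩,
      fun y hy => by simp [hfF y hy.1, hfF' y hy.2]⟩
  inv := by
    rintro f x ⟨F, hF, U, hU, hxU, hfF⟩ hfx
    exact ⟨F⁻¹, hT.inv _ _ hF (by rwa [← hfF x hxU]), U, hU, hxU,
      fun y hy => by simp [hfF y hy]⟩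
  isOpen := by
    rintro f x ⟨F, hF, U, hU, hxU, hfF⟩ hfx
    obtain ⟨U', hU', hxU', hF'⟩ := hT.isOpen F (i x) hF (by rwa [← hfF x hxU])
    refine ⟨i ⁻¹' (U ∩ U'), ⟨_, @IsOpen.inter _ T.top _ _ hU hU', rfl⟩, ⟨hxU, hxU'⟩,
      fun y hy => ?_⟩
    rw [hfF y hy.1]
    exact hF' _ hy.2

theorem regAt_induced_congr {T : SpaceWithFunctions N} {i : M → N} (f g : M → ℂ) (x : M)
    (U : Set M) (hf : (T.induced i).RegAt f x) (hU : IsOpen[(T.induced i).top] U) (hx : x ∈ U)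
    (h : ∀ y ∈ U, g y = f y) : (T.induced i).RegAt g x := by
  obtain ⟨F, hF, V, hV, hxV, hfF⟩ := hf
  obtain ⟨W, hW, rfl⟩ := hU
  exact ⟨F, hF, V ∩ W, @IsOpen.inter _ T.top _ _ hV hW, ⟨hxV, hx⟩, fun y hy =>
    (h y hy.2).trans (hfF y hy.1)⟩

/-- The functions that are regular at all points of a set. -/
def IsLocallyRinged.subalgebra {S : SpaceWithFunctions M} (hS : S.IsLocallyRinged) (W : Set M) :
    Subalgebra ℂ (M → ℂ) where
  carrier := {f | ∀ x ∈ W, S.RegAt f x}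
  mul_mem' hf hg x hx := hS.mul _ _ x (hf x hx) (hg x hx)
  add_mem' hf hg x hx := hS.add _ _ x (hf x hx) (hg x hx)
  algebraMap_mem' c x _ := hS.const c x

theorem IsLocallyRinged.isOpen_setOf {S : SpaceWithFunctions M} (hS : S.IsLocallyRinged)
    {W : Set M} (hW : IsOpen[S.top] W) {f : M → ℂ} (hf : ∀ x ∈ W, S.RegAt f x) :
    IsOpen[S.top] {x | x ∈ W ∧ f x ≠ 0} := by
  let := S.top
  rw [isOpen_iff_forall_mem_open]
  rintro x ⟨hxW, hx⟩
  obtain ⟨U, hU, hxU, hfU⟩ := hS.isOpen f x (hf x hxW) hx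
  exact ⟨W ∩ U, fun y hy => ⟨hy.1, hfU y hy.2⟩, hW.inter hU, hxW, hxU⟩

end SpaceWithFunctions

end

noncomputable section

/-! ### Homogeneous functions and projective spaces -/

section Projective

variable {E F : Type*} [AddCommGroup E] [Module ℂ E] [AddCommGroup F] [Module ℂ F]

theorem evalAt_mem_polyFun (Q : MvPolynomial (Module.Dual ℂ E) ℂ) :
    (fun x => evalAt Q x) ∈ polyFun E := by
  induction Q using MvPolynomial.induction_on with
  | C a => simpa [evalAt] using polyFun_const (E := E) a
  | add p q hp hq => simp only [evalAt, map_add] at *; exact (polyFun E).add_mem hp hq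
  | mul_X p ℓ hp => 
    simp only [evalAt, map_mul, MvPolynomial.eval_X] at *
    exact (polyFun E).mul_mem hp (polyFun_dual ℓ)

/-- Functions given by a homogeneous polynomial of degree `d`. -/
def IsHomFun (d : ℕ) (f : E → ℂ) : Prop :=
  ∃ Q : MvPolynomial (Module.Dual ℂ E) ℂ, Q.IsHomogeneous d ∧ ∀ x, f x = evalAt Q x

theorem isHomFun_evalAt {d : ℕ} {Q : MvPolynomial (Module.Dual ℂ E) ℂ} (hQ : Q.IsHomogeneous d) :
    IsHomFun d (fun x : E => evalAt Q x) := ⟨Q, hQ, fun _ => rfl⟩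

theorem isHomFun_dual (ℓ : Module.Dual ℂ E) : IsHomFun 1 (fun x => ℓ x) :=
  ⟨MvPolynomial.X ℓ, MvPolynomial.isHomogeneous_X _ _, fun x => by simp [evalAt]⟩

theorem isHomFun_const (c : ℂ) : IsHomFun 0 (fun _ : E => c) :=
  ⟨MvPolynomial.C c, MvPolynomial.isHomogeneous_C _ _, fun x => by simp [evalAt]⟩

theorem IsHomFun.add {d : ℕ} {f g : E → ℂ} (hf : IsHomFun d f) (hg : IsHomFun d g) :
    IsHomFun d (fun x => f x + g x) := by
  obtain ⟨P, hP, hfP⟩ := hf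
  obtain ⟨Q, hQ, hgQ⟩ := hg
  exact ⟨P + Q, hP.add hQ, fun x => by simp [hfP, hgQ, evalAt]⟩

theorem IsHomFun.mul {d e : ℕ} {f g : E → ℂ} (hf : IsHomFun d f) (hg : IsHomFun e g) :
    IsHomFun (d + e) (fun x => f x * g x) := by
  obtain ⟨P, hP, hfP⟩ := hf
  obtain ⟨Q, hQ, hgQ⟩ := hg
  exact ⟨P * Q, hP.mul hQ, fun x => by simp [hfP, hgQ, evalAt]⟩

theorem IsHomFun.sub {d : ℕ} {f g : E → ℂ} (hf : IsHomFun d f) (hg : IsHomFun d g) :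
    IsHomFun d (fun x => f x - g x) := by
  have h := (isHomFun_const (E := E) (-1)).mul hg
  rw [zero_add] at h
  simpa [sub_eq_add_neg] using hf.add h

theorem isHomFun_sum {ι : Type*} (s : Finset ι) {d : ℕ} {f : ι → E → ℂ}
    (hf : ∀ i ∈ s, IsHomFun d (f i)) : IsHomFun d (fun x => ∑ i ∈ s, f i x) := by
  classical
  induction s using Finset.induction_on with
  | empty => exact ⟨0, MvPolynomial.isHomogeneous_zero _ _ _, fun x => by simp [evalAt]⟩
  | insert a s ha ih =>
    simp only [Finset.sum_insert ha]
    exact (hf a (Finset.mem_insert_self a s)).add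
      (ih fun i hi => hf i (Finset.mem_insert_of_mem hi))

theorem IsHomFun.mem_polyFun {d : ℕ} {f : E → ℂ} (hf : IsHomFun d f) : f ∈ polyFun E := by
  obtain ⟨P, -, hP⟩ := hf
  rw [show f = fun x => evalAt P x from funext hP]
  exact evalAt_mem_polyFun P

/-- This is what makes non-vanishing, and quotients of equal degree, independent of the
representative chosen by `rep`. -/
theorem IsHomFun.smul {d : ℕ} {f : E → ℂ} (hf : IsHomFun d f) (c : ℂ) (x : E) :
    f (c • x) = c ^ d * f x := by
  obtain ⟨P, hP, hfP⟩ := hf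
  rw [hfP, hfP, evalAt, evalAt]
  rw [MvPolynomial.eval_eq, MvPolynomial.eval_eq, Finset.mul_sum]
  refine Finset.sum_congr rfl fun m hm => ?_
  have hd : ∑ i ∈ m.support, m i = d := by
    have := hP (MvPolynomial.mem_support_iff.1 hm)
    simpa [Finsupp.weight_apply, Finsupp.sum] using this
  simp only [map_smul, smul_eq_mul, mul_pow, Finset.prod_mul_distrib,
    Finset.prod_pow_eq_pow_sum, hd]
  ring

theorem exists_rep_mk {ξ : E} (hξ : ξ ≠ 0) :
    ∃ a : ℂ, a ≠ 0 ∧ (Projectivization.mk ℂ ξ hξ).rep = a • ξ := by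
  obtain ⟨a, ha⟩ := Projectivization.exists_smul_eq_mk_rep ℂ ξ hξ
  exact ⟨a, a.ne_zero, ha.symm⟩

theorem IsHomFun.rep_ne_zero_iff {d : ℕ} {f : E → ℂ} (hf : IsHomFun d f) {ξ : E} (hξ : ξ ≠ 0) :
    f (Projectivization.mk ℂ ξ hξ).rep ≠ 0 ↔ f ξ ≠ 0 := by
  obtain ⟨a, ha, h⟩ := exists_rep_mk hξ
  simp [h, hf.smul, ha]

theorem IsHomFun.div_rep {d : ℕ} {f g : E → ℂ} (hf : IsHomFun d f) (hg : IsHomFun d g) {ξ : E}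
    (hξ : ξ ≠ 0) : f (Projectivization.mk ℂ ξ hξ).rep / g (Projectivization.mk ℂ ξ hξ).rep =
      f ξ / g ξ := by
  obtain ⟨a, ha, h⟩ := exists_rep_mk hξ
  rw [h, hf.smul, hg.smul, mul_div_mul_left _ _ (pow_ne_zero d ha)]

theorem IsHomFun.isOpen {d : ℕ} {f : E → ℂ} (hf : IsHomFun d f) :
    IsOpen[(projVar E).top] {x | f x.rep ≠ 0} := by
  obtain ⟨Q, hQ, h⟩ := hf
  exact TopologicalSpace.isOpen_generateFrom_of_mem ⟨d, Q, hQ, by simp only [h]⟩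

theorem IsHomFun.regAt_div {d : ℕ} {f g : E → ℂ} (hf : IsHomFun d f) (hg : IsHomFun d g)
    {x : ℙ ℂ E} (hx : g x.rep ≠ 0) : (projVar E).RegAt (fun y => f y.rep / g y.rep) x := by
  obtain ⟨P, hP, h⟩ := hf
  obtain ⟨Q, hQ, h'⟩ := hg
  exact ⟨d, P, Q, hP, hQ, by rwa [← h'], fun y _ => by simp only [h, h']⟩

theorem projVar_isLocallyRinged : (projVar E).IsLocallyRinged where
  const c x := ⟨0, MvPolynomial.C c, MvPolynomial.C 1, MvPolynomial.isHomogeneous_C _ _,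
    MvPolynomial.isHomogeneous_C _ _, by simp [evalAt], fun y _ => by simp [evalAt]⟩
  add := by
    rintro f g x ⟨d, P, Q, hP, hQ, hx, hf⟩ ⟨e, P', Q', hP', hQ', hx', hg⟩
    refine ⟨d + e, P * Q' + Q * P', Q * Q', (hP.mul hQ').add (hQ.mul hP'), hQ.mul hQ', ?_, ?_⟩
    · simp only [evalAt, map_mul] at *
      exact mul_ne_zero hx hx'
    · intro y hy
      simp only [evalAt, map_mul, map_add, Pi.add_apply] at *
      have h1 := left_ne_zero_of_mul hy
      have h2 := right_ne_zero_of_mul hy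
      rw [hf y h1, hg y h2, div_add_div _ _ h1 h2]
  mul := by
    rintro f g x ⟨d, P, Q, hP, hQ, hx, hf⟩ ⟨e, P', Q', hP', hQ', hx', hg⟩
    refine ⟨d + e, P * P', Q * Q', hP.mul hP', hQ.mul hQ', ?_, ?_⟩
    · simp only [evalAt, map_mul] at *
      exact mul_ne_zero hx hx'
    · intro y hy
      simp only [evalAt, map_mul, Pi.mul_apply] at *
      rw [hf y (left_ne_zero_of_mul hy), hg y (right_ne_zero_of_mul hy), div_mul_div_comm]
  inv := by
    rintro f x ⟨d, P, Q, hP, hQ, hx, hf⟩ hfx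
    have hPx : evalAt P x.rep ≠ 0 := fun h => hfx (by rw [hf x hx, h, zero_div])
    -- The fraction Q / P is expanded by `Q`: the formula must hold wherever the new denominator is
    -- nonzero, and `f` is only known where `Q` is.
    refine ⟨d + d, Q * Q, P * Q, hQ.mul hQ, hP.mul hQ, ?_, ?_⟩
    · simp only [evalAt, map_mul] at *
      exact mul_ne_zero hPx hx
    · intro y hy
      simp only [evalAt, map_mul, Pi.inv_apply] at *
      have h1 := left_ne_zero_of_mul hy
      have h2 := right_ne_zero_of_mul hy
      rw [hf y h2, inv_div, mul_div_mul_right _ _ h2]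
  isOpen := by
    rintro f x ⟨d, P, Q, hP, hQ, hx, hf⟩ hfx
    have hPx : evalAt P x.rep ≠ 0 := fun h => hfx (by rw [hf x hx, h, zero_div])
    refine ⟨{y | evalAt (P * Q) y.rep ≠ 0}, (isHomFun_evalAt (hP.mul hQ)).isOpen, ?_, ?_⟩
    · simp only [evalAt, map_mul, Set.mem_ofPred_eq] at *
      exact mul_ne_zero hPx hx
    · intro y hy
      simp only [evalAt, map_mul, Set.mem_ofPred_eq] at *
      rw [hf y (right_ne_zero_of_mul hy)]
      exact div_ne_zero (left_ne_zero_of_mul hy) (right_ne_zero_of_mul hy)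

/-- A polynomial map without zeros defines a morphism to projective space. -/
theorem IsPolyMap.isMorphism_mk {M : Type*} {i : M → E} {Φ : E → F} (hΦ : IsPolyMap Φ) {ξ : M → F}
    (hξ : ∀ x, ξ x ≠ 0) (h : ∀ x, ξ x = Φ (i x)) :
    ((affineVar E).induced i).IsMorphism (projVar F)
      (fun x => Projectivization.mk ℂ (ξ x) (hξ x)) := by
  have hpre : ∀ {d : ℕ} {Q : MvPolynomial (Module.Dual ℂ F) ℂ}, Q.IsHomogeneous d →
      ∀ x, evalAt Q (Projectivization.mk ℂ (ξ x) (hξ x)).rep ≠ 0 ↔ evalAt Q (Φ (i x)) ≠ 0 := by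
    intro d Q hQ x
    rw [← h x]
    exact (isHomFun_evalAt hQ).rep_ne_zero_iff (hξ x)
  constructor
  · let := (affineVar E).top
    let : TopologicalSpace M := (affineVar E).top.induced i
    refine continuous_generateFrom_iff.2 ?_
    rintro _ ⟨d, Q, hQ, rfl⟩
    refine ⟨{y | evalAt Q (Φ y) ≠ 0}, isOpen_ne_zero (hΦ _ (evalAt_mem_polyFun Q)), ?_⟩
    ext x
    exact (hpre hQ x).symm
  · rintro f x ⟨d, P, Q, hP, hQ, hx, hf⟩
    have hQ' := hΦ _ (evalAt_mem_polyFun Q)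
    refine ⟨fun y => evalAt P (Φ y) / evalAt Q (Φ y), ⟨_, hΦ _ (evalAt_mem_polyFun P), _, hQ',
      (hpre hQ x).1 hx, fun y _ => rfl⟩, _, isOpen_ne_zero hQ', (hpre hQ x).1 hx, fun y hy => ?_⟩
    rw [Function.comp_apply, hf _ ((hpre hQ y).2 hy),
      (isHomFun_evalAt hP).div_rep (isHomFun_evalAt hQ) (hξ y), h]

/-- Maps all of whose coordinates are homogeneous functions of degree `d`. -/
def IsHomMap (d : ℕ) (Φ : E → F) : Prop :=
  ∀ ℓ : Module.Dual ℂ F, IsHomFun d fun x => ℓ (Φ x)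

theorem isHomMap_linear (A : E →ₗ[ℂ] F) : IsHomMap 1 A := fun ℓ => isHomFun_dual (ℓ ∘ₗ A)

theorem IsHomFun.smul_map {d e : ℕ} {f : E → ℂ} {Φ : E → F} (hf : IsHomFun d f)
    (hΦ : IsHomMap e Φ) : IsHomMap (d + e) fun x => f x • Φ x := fun ℓ => by
  simpa using hf.mul (hΦ ℓ)

theorem IsHomMap.sub {d : ℕ} {Φ Ψ : E → F} (hΦ : IsHomMap d Φ) (hΨ : IsHomMap d Ψ) :
    IsHomMap d fun x => Φ x - Ψ x := fun ℓ => by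
  simpa using (hΦ ℓ).sub (hΨ ℓ)

theorem isHomMap_sum {ι : Type*} (s : Finset ι) {d : ℕ} {Φ : ι → E → F}
    (hΦ : ∀ i ∈ s, IsHomMap d (Φ i)) : IsHomMap d (fun x => ∑ i ∈ s, Φ i x) := fun ℓ => by
  simpa using isHomFun_sum s fun i hi => hΦ i hi ℓ

end Projective

end

noncomputable section

/-! ### Trivectors and the Plücker embedding -/

section Exterior

variable {V W E : Type*} [AddCommGroup V] [Module ℂ V] [AddCommGroup W] [Module ℂ W]
  [AddCommGroup E] [Module ℂ E]

/-- The decomposable three-form `α₀ ∧ α₁ ∧ α₂`. -/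
def detForm (α : Fin 3 → Module.Dual ℂ V) : V [⋀^Fin 3]→ₗ[ℂ] ℂ :=
  (Matrix.detRowAlternating (n := Fin 3) (R := ℂ)).compLinearMap (LinearMap.pi α)

theorem detForm_apply (α : Fin 3 → Module.Dual ℂ V) (v : Fin 3 → V) :
    detForm α v = (Matrix.of fun i j => α j (v i)).det := rfl

theorem detForm_apply_three (α : Fin 3 → Module.Dual ℂ V) (v : Fin 3 → V) :
    detForm α v = α 0 (v 0) * α 1 (v 1) * α 2 (v 2) - α 0 (v 0) * α 2 (v 1) * α 1 (v 2)
      - α 1 (v 0) * α 0 (v 1) * α 2 (v 2) + α 1 (v 0) * α 2 (v 1) * α 0 (v 2)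
      + α 2 (v 0) * α 0 (v 1) * α 1 (v 2) - α 2 (v 0) * α 1 (v 1) * α 0 (v 2) := by
  rw [detForm_apply, Matrix.det_fin_three]
  rfl

/-- Both sides are alternating in the rows of `M`, so it suffices to compare them on permutations of
the standard basis. -/
theorem AlternatingMap.map_sum_matrix (f : V [⋀^Fin 3]→ₗ[ℂ] W) (M : Matrix (Fin 3) (Fin 3) ℂ)
    (v : Fin 3 → V) : f (fun i => ∑ j, M i j • v j) = M.det • f v := by
  have h : f.compLinearMap (Fintype.linearCombination ℂ v) =
      (LinearMap.toSpanSingleton ℂ W (f v)).compAlternatingMap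
        (Matrix.detRowAlternating (n := Fin 3) (R := ℂ)) := by
    refine Module.Basis.ext_alternating (Pi.basisFun ℂ (Fin 3)) fun σ hσ => ?_
    have hb : Function.Bijective σ := Finite.injective_iff_bijective.1 hσ
    have h1 : (fun i => Fintype.linearCombination ℂ v (Pi.basisFun ℂ (Fin 3) (σ i))) =
        v ∘ Equiv.ofBijective σ hb := by
      funext i
      simp [Fintype.linearCombination_apply, Pi.single_apply]
    have h2 : Matrix.detRowAlternating (fun i => Pi.basisFun ℂ (Fin 3) (σ i)) =
        ((Equiv.Perm.sign (Equiv.ofBijective σ hb) : ℤ) : ℂ) := by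
      have := (Matrix.detRowAlternating (n := Fin 3) (R := ℂ)).map_perm
        (Pi.basisFun ℂ (Fin 3)) (Equiv.ofBijective σ hb)
      refine this.trans ?_
      have h3 : Matrix.detRowAlternating (n := Fin 3) (R := ℂ) (Pi.basisFun ℂ (Fin 3)) = 1 := by
        change Matrix.det _ = 1
        rw [← Matrix.det_one (n := Fin 3)]
        congr 1
        ext i j
        simp [Matrix.one_apply, Pi.single_apply, eq_comm]
      rw [h3, Units.smul_def, zsmul_eq_mul, mul_one]
    simp only [AlternatingMap.compLinearMap_apply, LinearMap.compAlternatingMap_apply,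
      LinearMap.toSpanSingleton_apply]
    rw [h1, f.map_perm, h2, Units.smul_def, Int.cast_smul_eq_zsmul]
  have := congrArg (fun g : (Fin 3 → ℂ) [⋀^Fin 3]→ₗ[ℂ] W => g M) h
  exact this

theorem AlternatingMap.map_basis_sum {ι : Type*} [Fintype ι] (b : Module.Basis ι ℂ V)
    (f : V [⋀^Fin 3]→ₗ[ℂ] W) (v : Fin 3 → V) :
    f v = ∑ s : Fin 3 → ι, (∏ i, b.coord (s i) (v i)) • f (fun i => b (s i)) := by
  classical
  have h : v = fun i => ∑ j, b.coord j (v i) • b j := by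
    funext i
    exact (b.sum_repr (v i)).symm
  conv_lhs => rw [h]
  change f.toMultilinearMap _ = _
  rw [MultilinearMap.map_sum]
  refine Finset.sum_congr rfl fun s _ => ?_
  rw [MultilinearMap.map_smul_univ]
  rfl

theorem IsPolyMap.alternating [FiniteDimensional ℂ V] (f : V [⋀^Fin 3]→ₗ[ℂ] W)
    {Φ : Fin 3 → E → V} (hΦ : ∀ i, IsPolyMap (Φ i)) :
    IsPolyMap (fun x => f fun i => Φ i x) := by
  rw [show (fun x => f fun i => Φ i x) = _ from funext fun x =>
    AlternatingMap.map_basis_sum (Module.finBasis ℂ V) f fun i => Φ i x]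
  simp only [Fin.prod_univ_three]
  exact IsPolyMap.sum _ fun s _ => IsPolyMap.smul ((polyFun E).mul_mem
    ((polyFun E).mul_mem ((hΦ 0).dual _) ((hΦ 1).dual _)) ((hΦ 2).dual _)) (isPolyMap_const _)

theorem isHomMap_const (c : W) : IsHomMap 0 fun _ : E => c := fun ℓ => isHomFun_const (ℓ c)

theorem IsHomMap.alternating [FiniteDimensional ℂ V] (f : V [⋀^Fin 3]→ₗ[ℂ] W)
    {Φ : Fin 3 → E → V} (hΦ : ∀ i, IsHomMap 1 (Φ i)) :
    IsHomMap 3 (fun x => f fun i => Φ i x) := by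
  rw [show (fun x => f fun i => Φ i x) = _ from funext fun x =>
    AlternatingMap.map_basis_sum (Module.finBasis ℂ V) f fun i => Φ i x]
  simp only [Fin.prod_univ_three]
  refine isHomMap_sum _ fun s _ => ?_
  have h (i : Fin 3) : IsHomFun 1 fun x => (Module.finBasis ℂ V).coord (s i) (Φ i x) := hΦ i _
  exact ((h 0).mul (h 1)).mul (h 2) |>.smul_map (isHomMap_const _)

/-- The contraction of a trivector with `α ∧ β`. -/
def contraction (α β : Module.Dual ℂ V) : V [⋀^Fin 3]→ₗ[ℂ] V where
  toFun v := (α (v 1) * β (v 2) - α (v 2) * β (v 1)) • v 0 +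
    (α (v 2) * β (v 0) - α (v 0) * β (v 2)) • v 1 + (α (v 0) * β (v 1) - α (v 1) * β (v 0)) • v 2
  map_update_add' := by
    intro inst v i x y
    obtain rfl : inst = instDecidableEqFin 3 := Subsingleton.elim _ _
    fin_cases i <;> simp [Function.update] <;> module
  map_update_smul' := by
    intro inst v i c x
    obtain rfl : inst = instDecidableEqFin 3 := Subsingleton.elim _ _
    fin_cases i <;> simp [Function.update] <;> module
  map_eq_zero_of_eq' := by
    intro v i j h hij
    fin_cases i <;> fin_cases j <;> simp at h hij ⊢ <;> simp [h] <;> module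

theorem contraction_apply (α β : Module.Dual ℂ V) (v : Fin 3 → V) : contraction α β v =
    (α (v 1) * β (v 2) - α (v 2) * β (v 1)) • v 0 +
    (α (v 2) * β (v 0) - α (v 0) * β (v 2)) • v 1 +
    (α (v 0) * β (v 1) - α (v 1) * β (v 0)) • v 2 := rfl

/-- The linear form on trivectors defined by a three-form. -/
abbrev trivectorMap (f : V [⋀^Fin 3]→ₗ[ℂ] W) : ⋀[ℂ]^3 V →ₗ[ℂ] W :=
  exteriorPower.alternatingMapLinearEquiv f

/-- The contractions of a trivector with `α₁ ∧ α₂`, `α₂ ∧ α₀`, `α₀ ∧ α₁`. -/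
def contractions (α : Fin 3 → Module.Dual ℂ V) (i : Fin 3) : ⋀[ℂ]^3 V →ₗ[ℂ] V :=
  trivectorMap (contraction (α (i + 1)) (α (i + 2)))

theorem contractions_iotaMulti (α : Fin 3 → Module.Dual ℂ V) (v : Fin 3 → V) (i : Fin 3) :
    contractions α i (exteriorPower.ιMulti ℂ 3 v) =
      contraction (α (i + 1)) (α (i + 2)) v := by
  simp [contractions]

/-- The contractions of v₀ ∧ v₁ ∧ v₂ are the combinations of the vᵢ given by the adjugate of the
matrix A = (αⱼ(vᵢ)), and det(adj A) = (det A)² for 3 × 3 matrices. With f = `ιMulti` it is an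
equation satisfied by decomposable trivectors. -/
theorem map_contraction (f : V [⋀^Fin 3]→ₗ[ℂ] W) (α : Fin 3 → Module.Dual ℂ V)
    (v : Fin 3 → V) : f (fun i => contraction (α (i + 1)) (α (i + 2)) v) =
      detForm α v ^ 2 • f v := by
  let A : Matrix (Fin 3) (Fin 3) ℂ := Matrix.of fun i j => α j (v i)
  have h : (fun i => contraction (α (i + 1)) (α (i + 2)) v) =
      fun i => ∑ j, A.adjugate i j • v j := by
    funext i
    rw [contraction_apply, Fin.sum_univ_three]
    fin_cases i <;> simp [A, Matrix.adjugate_fin_three] <;> module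
  rw [h, AlternatingMap.map_sum_matrix, Matrix.det_adjugate, detForm_apply]
  simp [A]

/-- The coordinates of a trivector in the basis induced by a basis of `V` are values of forms
`detForm` of coordinate functions. -/
theorem exists_detForm_ne_zero [FiniteDimensional ℂ V] {ξ : ⋀[ℂ]^3 V} (hξ : ξ ≠ 0) :
    ∃ α : Fin 3 → Module.Dual ℂ V, trivectorMap (detForm α) ξ ≠ 0 := by
  let b := (Module.finBasis ℂ V)
  by_contra! h
  apply hξ
  apply (b.exteriorPower 3).repr.injective
  ext s
  rw [exteriorPower.basis_repr_apply, map_zero, Finsupp.zero_apply,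
    ← h (b.coord ∘ Set.powersetCard.ofFinEmbEquiv.symm s)]
  congr 1
  apply exteriorPower.linearMap_ext
  ext v
  simp [detForm_apply]

theorem linearIndependent_of_map_ne_zero (f : V [⋀^Fin 3]→ₗ[ℂ] W) {v : Fin 3 → V}
    (h : f v ≠ 0) : LinearIndependent ℂ v := by
  by_contra hv
  exact h (f.map_linearDependent v hv)

/-- The three-plane spanned by three independent vectors. -/
def Gr3.ofFrame (v : Fin 3 → V) (hv : LinearIndependent ℂ v) : Gr3 V :=
  ⟨Submodule.span ℂ (Set.range v), by simpa using finrank_span_eq_card hv⟩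

theorem Gr3.span_frame (L : Gr3 V) : Submodule.span ℂ (Set.range L.frame) = L.1 := by
  have : Module.Finite ℂ L.1 := Module.finite_of_finrank_pos (by rw [L.2]; norm_num)
  have h := (Module.finBasisOfFinrankEq ℂ L.1 L.2).span_eq
  have h2 := congrArg (Submodule.map L.1.subtype) h
  rw [Submodule.map_span, Submodule.map_top, Submodule.range_subtype, ← Set.range_comp] at h2
  exact h2

theorem exists_matrix_of_mem_span {v w : Fin 3 → V}
    (h : ∀ i, w i ∈ Submodule.span ℂ (Set.range v)) :
    ∃ M : Matrix (Fin 3) (Fin 3) ℂ, w = fun i => ∑ j, M i j • v j := by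
  have h' : ∀ i, ∃ c : Fin 3 → ℂ, ∑ j, c j • v j = w i := fun i =>
    (Submodule.mem_span_range_iff_exists_fun ℂ).1 (h i)
  choose M hM using h'
  exact ⟨M, funext fun i => (hM i).symm⟩

theorem iotaMulti_of_mem_span {v w : Fin 3 → V}
    (h : ∀ i, w i ∈ Submodule.span ℂ (Set.range v)) : ∃ c : ℂ,
    ∀ (f : V [⋀^Fin 3]→ₗ[ℂ] ℂ), f w = c • f v := by
  obtain ⟨M, rfl⟩ := exists_matrix_of_mem_span h
  exact ⟨M.det, fun f => f.map_sum_matrix M v⟩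

theorem plucker_eq_mk {L : Gr3 V} {v : Fin 3 → V} (hv : LinearIndependent ℂ v)
    (h : Submodule.span ℂ (Set.range v) = L.1) :
    plucker L = Projectivization.mk ℂ (exteriorPower.ιMulti ℂ 3 v) (iotaMulti_ne_zero hv) := by
  obtain ⟨M, hM⟩ := exists_matrix_of_mem_span (v := v) (w := L.frame) fun i => by
    rw [h, ← L.span_frame]
    exact Submodule.subset_span ⟨i, rfl⟩
  rw [plucker, Projectivization.mk_eq_mk_iff']
  exact ⟨M.det, by rw [hM]; exact ((exteriorPower.ιMulti ℂ 3).map_sum_matrix M v).symm⟩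

theorem mem_hyperplaneSection_iff {ω : V [⋀^Fin 3]→ₗ[ℂ] ℂ} {L : Gr3 V} {v : Fin 3 → V}
    (h : Submodule.span ℂ (Set.range v) = L.1) : L ∈ hyperplaneSection ω ↔ ω v = 0 := by
  constructor
  · intro hL
    exact hL v fun i => h ▸ Submodule.subset_span ⟨i, rfl⟩
  · intro h0 w hw
    obtain ⟨c, hc⟩ := iotaMulti_of_mem_span (v := v) (w := w) fun i => h ▸ hw i
    rw [hc, h0, smul_zero]

/-- The Plücker image of a hyperplane section is Zariski closed. -/
theorem isClosed_plucker_image [FiniteDimensional ℂ V] (ω : V [⋀^Fin 3]→ₗ[ℂ] ℂ) :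
    IsClosed[(projVar (⋀[ℂ]^3 V)).top] (plucker '' hyperplaneSection ω) := by
  let := (projVar (⋀[ℂ]^3 V)).top
  rw [← isOpen_compl_iff, isOpen_iff_forall_mem_open]
  intro x hx
  have hω : IsHomFun 1 fun ξ => trivectorMap ω ξ := isHomFun_dual _
  by_cases h0 : trivectorMap ω x.rep = 0
  swap
  · refine ⟨_, ?_, hω.isOpen, h0⟩
    rintro _ hy ⟨L, hL, rfl⟩
    refine (hω.rep_ne_zero_iff (iotaMulti_ne_zero L.linearIndependent_frame)).1 hy ?_
    simpa using (mem_hyperplaneSection_iff L.span_frame).1 hL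
  obtain ⟨α, hα⟩ := exists_detForm_ne_zero x.rep_nonzero
  -- With D = `trivectorMap (detForm α)` and Nᵢ the contractions, Φ(ξ) = D(ξ)² ξ − N₀ ∧ N₁ ∧ N₂ is
  -- cubic. It vanishes on decomposable ξ by `map_contraction`; where D(ξ) ≠ 0, its vanishing
  -- exhibits ξ as decomposable. So near `x` it is a closed condition for decomposability.
  let Φ : ⋀[ℂ]^3 V → ⋀[ℂ]^3 V := fun ξ =>
    (trivectorMap (detForm α) ξ * trivectorMap (detForm α) ξ) • ξ -
      exteriorPower.ιMulti ℂ 3 fun i => contractions α i ξ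
  have hΦ : IsHomMap 3 Φ := IsHomMap.sub
    (((isHomFun_dual (trivectorMap (detForm α))).mul
      (isHomFun_dual (trivectorMap (detForm α)))).smul_map (isHomMap_linear LinearMap.id))
    (IsHomMap.alternating _ fun i => isHomMap_linear (contractions α i))
  by_cases hx0 : Φ x.rep = 0
  · exfalso
    apply hx
    have hN := sub_eq_zero.1 hx0
    set N := fun i => contractions α i x.rep with hNdef
    have hN0 : exteriorPower.ιMulti ℂ 3 N ≠ 0 := by
      rw [← hN]
      exact smul_ne_zero (mul_ne_zero hα hα) x.rep_nonzero
    have hlin := linearIndependent_of_map_ne_zero _ hN0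
    refine ⟨Gr3.ofFrame N hlin, (mem_hyperplaneSection_iff rfl).2 ?_, ?_⟩
    · have := congrArg (trivectorMap ω) hN
      rw [map_smul, h0, smul_zero] at this
      simpa using this.symm
    · rw [plucker_eq_mk hlin rfl]
      conv_rhs => rw [← x.mk_rep]
      rw [Projectivization.mk_eq_mk_iff']
      exact ⟨_, hN⟩
  · obtain ⟨ℓ, hℓ⟩ : ∃ ℓ : Module.Dual ℂ (⋀[ℂ]^3 V), ℓ (Φ x.rep) ≠ 0 := by
      by_contra! h
      exact hx0 ((Module.forall_dual_apply_eq_zero_iff ℂ _).1 h)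
    refine ⟨_, ?_, (hΦ ℓ).isOpen, hℓ⟩
    rintro _ hy ⟨L, hL, rfl⟩
    refine ((hΦ ℓ).rep_ne_zero_iff (iotaMulti_ne_zero L.linearIndependent_frame)).1 hy ?_
    simp only [Φ, contractions_iotaMulti]
    rw [map_contraction]
    simp [pow_two]

end Exterior

end

noncomputable section

/-! ### Irreducibility of hyperplane sections -/

section Irreducible

variable {V : Type*} [AddCommGroup V] [Module ℂ V]

theorem exists_isHomFun_of_isOpen {U : Set (ℙ ℂ V)} (hU : IsOpen[(projVar V).top] U) :
    ∀ x ∈ U, ∃ (d : ℕ) (q : V → ℂ), IsHomFun d q ∧ q x.rep ≠ 0 ∧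
      ∀ y : ℙ ℂ V, q y.rep ≠ 0 → y ∈ U := by
  change TopologicalSpace.GenerateOpen _ U at hU
  induction hU with
  | basic s hs =>
    obtain ⟨d, Q, hQ, rfl⟩ := hs
    exact fun x hx => ⟨d, _, isHomFun_evalAt hQ, hx, fun y hy => hy⟩
  | univ => exact fun x _ => ⟨0, _, isHomFun_const 1, one_ne_zero, fun y _ => trivial⟩
  | inter s t _ _ hs ht =>
    intro x hx
    obtain ⟨d, q, hq, hqx, hqs⟩ := hs x hx.1
    obtain ⟨e, r, hr, hrx, hrt⟩ := ht x hx.2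
    exact ⟨d + e, _, hq.mul hr, mul_ne_zero hqx hrx, fun y hy =>
      ⟨hqs y (left_ne_zero_of_mul hy), hrt y (right_ne_zero_of_mul hy)⟩⟩
  | sUnion S _ ih =>
    rintro x ⟨s, hs, hx⟩
    obtain ⟨d, q, hq, hqx, hqs⟩ := ih s hs x hx
    exact ⟨d, q, hq, hqx, fun y hy => ⟨s, hs, hqs y hy⟩⟩

/-- A three-form as a trilinear map. -/
def AlternatingMap.tri (ω : V [⋀^Fin 3]→ₗ[ℂ] ℂ) : V →ₗ[ℂ] V →ₗ[ℂ] V →ₗ[ℂ] ℂ :=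
  LinearMap.mk₂ ℂ
    (fun x y =>
      { toFun := fun z => ω ![x, y, z]
        map_add' := fun z z' => congrArg (fun f : V [⋀^Fin 0]→ₗ[ℂ] ℂ => f ![])
          (((ω.curryLeft x).curryLeft y).curryLeft.map_add z z')
        map_smul' := fun c z => congrArg (fun f : V [⋀^Fin 0]→ₗ[ℂ] ℂ => f ![])
          (((ω.curryLeft x).curryLeft y).curryLeft.map_smul c z) })
    (fun x x' y => LinearMap.ext fun z =>
      congrArg (fun f : V [⋀^Fin 2]→ₗ[ℂ] ℂ => f ![y, z]) (ω.curryLeft.map_add x x'))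
    (fun c x y => LinearMap.ext fun z =>
      congrArg (fun f : V [⋀^Fin 2]→ₗ[ℂ] ℂ => f ![y, z]) (ω.curryLeft.map_smul c x))
    (fun x y y' => LinearMap.ext fun z =>
      congrArg (fun f : V [⋀^Fin 1]→ₗ[ℂ] ℂ => f ![z]) ((ω.curryLeft x).curryLeft.map_add y y'))
    (fun c x y => LinearMap.ext fun z =>
      congrArg (fun f : V [⋀^Fin 1]→ₗ[ℂ] ℂ => f ![z]) ((ω.curryLeft x).curryLeft.map_smul c y))

theorem AlternatingMap.tri_apply (ω : V [⋀^Fin 3]→ₗ[ℂ] ℂ) (x y z : V) :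
    ω.tri x y z = ω ![x, y, z] := rfl

theorem AlternatingMap.tri_eq (ω : V [⋀^Fin 3]→ₗ[ℂ] ℂ) (v : Fin 3 → V) :
    ω v = ω.tri (v 0) (v 1) (v 2) := by
  rw [ω.tri_apply]
  congr 1
  funext i
  fin_cases i <;> rfl

theorem AlternatingMap.tri_self (ω : V [⋀^Fin 3]→ₗ[ℂ] ℂ) (x y : V) : ω.tri x y y = 0 :=
  ω.map_eq_zero_of_eq ![x, y, y] (i := 1) (j := 2) rfl (by decide)

theorem AlternatingMap.tri_swap (ω : V [⋀^Fin 3]→ₗ[ℂ] ℂ) (x y z : V) :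
    ω.tri x y z = - ω.tri x z y := by
  have h := ω.tri_self x (y + z)
  simp only [map_add, LinearMap.add_apply, ω.tri_self] at h
  linear_combination h

/-- Open subsets of a hyperplane section contain basic open subsets, in terms of frames. -/
theorem exists_polyFun_of_isOpen_section [FiniteDimensional ℂ V] {ω : V [⋀^Fin 3]→ₗ[ℂ] ℂ} {U : Set (hyperplaneSection ω)}
    (hU : IsOpen[(sectionVar ω).top] U) {L : hyperplaneSection ω} (hL : L ∈ U) :
    ∃ q ∈ polyFun (Fin 3 → V), q L.1.frame ≠ 0 ∧
      ∀ w : Fin 3 → V, ω w = 0 → q w ≠ 0 → ∃ hw : LinearIndependent ℂ w,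
        ∃ hX : Gr3.ofFrame w hw ∈ hyperplaneSection ω, ⟨Gr3.ofFrame w hw, hX⟩ ∈ U := by
  obtain ⟨U', hU', rfl⟩ := hU
  obtain ⟨d, q, hq, hqL, hqU⟩ := exists_isHomFun_of_isOpen hU' _ hL
  obtain ⟨α, hα⟩ := exists_detForm_ne_zero (iotaMulti_ne_zero L.1.linearIndependent_frame)
  have h1 : IsPolyMap fun w : Fin 3 → V => exteriorPower.ιMulti ℂ 3 w :=
    IsPolyMap.alternating (Φ := fun i (w : Fin 3 → V) => w i) _
      isPolyMap_apply
  have h2 : IsPolyMap fun w : Fin 3 → V => detForm α w :=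
    IsPolyMap.alternating (Φ := fun i (w : Fin 3 → V) => w i) _
      isPolyMap_apply
  refine ⟨_, (polyFun _).mul_mem (h1 q hq.mem_polyFun) h2.mem_polyFun,
    mul_ne_zero ((hq.rep_ne_zero_iff _).1 hqL) (by simpa using hα), fun w hw hqw => ?_⟩
  have hlin := linearIndependent_of_map_ne_zero _ (right_ne_zero_of_mul hqw)
  refine ⟨hlin, (mem_hyperplaneSection_iff rfl).2 hw, hqU _ ?_⟩
  change q (plucker (Gr3.ofFrame w hlin)).rep ≠ 0
  rw [plucker_eq_mk (L := Gr3.ofFrame w hlin) hlin rfl, hq.rep_ne_zero_iff]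
  exact left_ne_zero_of_mul hqw

/-- The triples `(x, y, z)` with `ω(x, y, z) = 0` and `ω(x, y, ·) ≠ 0`, parametrized by an affine
space. -/
def isotropicTriple (ω : V [⋀^Fin 3]→ₗ[ℂ] ℂ) (a : Fin 4 → V) : Fin 3 → V :=
  ![a 0, a 1, ω.tri (a 0) (a 1) (a 2) • a 3 - ω.tri (a 0) (a 1) (a 3) • a 2]

theorem isPolyMap_isotropicTriple [FiniteDimensional ℂ V] (ω : V [⋀^Fin 3]→ₗ[ℂ] ℂ) : IsPolyMap (isotropicTriple ω) := by
  have hp (i : Fin 4) : IsPolyMap fun a : Fin 4 → V => a i := isPolyMap_apply i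
  have ht (i : Fin 4) : (fun a : Fin 4 → V => ω.tri (a 0) (a 1) (a i)) ∈ polyFun (Fin 4 → V) := by
    refine IsPolyMap.mem_polyFun (IsPolyMap.alternating
      (Φ := fun j (a : Fin 4 → V) => (![a 0, a 1, a i] : Fin 3 → V) j) ω fun j => ?_)
    fin_cases j
    exacts [hp 0, hp 1, hp i]
  refine IsPolyMap.pi fun i => ?_
  fin_cases i
  exacts [hp 0, hp 1, (IsPolyMap.smul (ht 2) (hp 3)).sub (IsPolyMap.smul (ht 3) (hp 2))]

theorem map_isotropicTriple (ω : V [⋀^Fin 3]→ₗ[ℂ] ℂ) (a : Fin 4 → V) :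
    ω (isotropicTriple ω a) = 0 := by
  rw [ω.tri_eq]
  simp [isotropicTriple]
  ring

theorem exists_isotropicTriple_eq {ω : V [⋀^Fin 3]→ₗ[ℂ] ℂ} {w : Fin 3 → V} (hw : ω w = 0)
    (h : ω.tri (w 0) (w 1) ≠ 0) : ∃ a, isotropicTriple ω a = w := by
  obtain ⟨u, hu⟩ : ∃ u, ω.tri (w 0) (w 1) u ≠ 0 := by
    by_contra! h'
    exact h (LinearMap.ext h')
  rw [ω.tri_eq] at hw
  -- The third entry is scaled so that ω(w₀, w₁, ·) equals 1 on it; since ω(w₀, w₁, w₂) = 0, the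
  -- parametrization returns w₂ unchanged.
  refine ⟨![w 0, w 1, (ω.tri (w 0) (w 1) u)⁻¹ • u, w 2], ?_⟩
  funext i
  fin_cases i <;> simp [isotropicTriple, hw, hu]

/-- A direction in which the second vector of an isotropic triple (x, y, z) can be moved out of the
locus ω(x, y, ·) = 0. If there were none, all the ω(x, b, ·) would be multiples of a single ω(x, a,
·); but a skew form of rank at most one is zero. -/
theorem exists_deformation {ω : V [⋀^Fin 3]→ₗ[ℂ] ℂ} {x : V} (hx : ω.tri x ≠ 0) (z : V) :
    ∃ u, ω.tri x u z = 0 ∧ ω.tri x u ≠ 0 := by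
  by_contra! h
  by_cases hz : ∀ u, ω.tri x u z = 0
  · exact hx (LinearMap.ext fun u => h u (hz u))
  · push Not at hz
    obtain ⟨a, ha⟩ := hz
    have key : ∀ b, ω.tri x a z • ω.tri x b = ω.tri x b z • ω.tri x a := by
      intro b
      have := h (ω.tri x a z • b - ω.tri x b z • a) (by simp; ring)
      rw [map_sub, map_smul, map_smul] at this
      exact sub_eq_zero.1 this
    have hb : ∀ b, ω.tri x b a = 0 := by
      intro b
      have h1 := LinearMap.congr_fun (key b) a
      simp only [LinearMap.smul_apply, ω.tri_self, smul_zero] at h1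
      exact (smul_eq_zero.1 h1).resolve_left ha
    exact ha (by rw [ω.tri_swap, hb, neg_zero])

/-- Density of the parametrized frames. If ω(w₀, w₁, ·) = 0, the line w + t(0, u, 0) with `u` from
`exists_deformation` stays isotropic and is parametrized for t ≠ 0, while `q` has finitely many
zeros on it. -/
theorem exists_isotropicTriple_ne_zero [FiniteDimensional ℂ V] {ω : V [⋀^Fin 3]→ₗ[ℂ] ℂ} (hω : ∀ x, ω.tri x = 0 → x = 0)
    {q : (Fin 3 → V) → ℂ} (hq : q ∈ polyFun (Fin 3 → V)) {w : Fin 3 → V}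
    (hlin : LinearIndependent ℂ w) (hw : ω w = 0) (hqw : q w ≠ 0) :
    ∃ a, q (isotropicTriple ω a) ≠ 0 := by
  by_cases h : ω.tri (w 0) (w 1) = 0
  swap
  · obtain ⟨a, rfl⟩ := exists_isotropicTriple_eq hw h
    exact ⟨a, hqw⟩
  obtain ⟨u, hu, hu'⟩ := exists_deformation (fun h0 => hlin.ne_zero 0 (hω _ h0)) (w 2)
  have hfin := finite_line_zeros hq w ![0, u, 0] ⟨0, by simpa using hqw⟩
  obtain ⟨t, ht⟩ := (hfin.union (Set.finite_singleton 0)).infinite_compl.nonempty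
  simp only [Set.mem_compl_iff, Set.mem_union, Set.mem_ofPred_eq, Set.mem_singleton_iff,
    not_or] at ht
  have h0 : (w + t • ![0, u, 0]) 0 = w 0 := by simp
  have h1 : (w + t • ![0, u, 0]) 1 = w 1 + t • u := by simp
  have h2 : (w + t • ![0, u, 0]) 2 = w 2 := by simp
  obtain ⟨a, ha⟩ : ∃ a, isotropicTriple ω a = w + t • ![0, u, 0] := by
    apply exists_isotropicTriple_eq
    · rw [ω.tri_eq] at hw ⊢
      rw [h0, h1, h2]
      simp [hw, hu]
    · rw [h0, h1, map_add, h, zero_add, map_smul]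
      exact smul_ne_zero ht.2 hu'
  exact ⟨a, by rw [ha]; exact ht.1⟩

/-- Hyperplane sections of `Gr(3, V)` by non-degenerate three-forms are irreducible. -/
theorem irreducibleSpace_section [FiniteDimensional ℂ V] {ω : V [⋀^Fin 3]→ₗ[ℂ] ℂ} (hω : ∀ x, ω.tri x = 0 → x = 0)
    (hne : Nonempty (hyperplaneSection ω)) :
    @IrreducibleSpace (hyperplaneSection ω) (sectionVar ω).top := by
  let := (sectionVar ω).top
  refine @IrreducibleSpace.mk _ _ ⟨?_⟩ hne
  rintro U U' hU hU' ⟨L, -, hL⟩ ⟨L', -, hL'⟩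
  obtain ⟨q, hq, hqL, hqU⟩ := exists_polyFun_of_isOpen_section hU hL
  obtain ⟨r, hr, hrL, hrU⟩ := exists_polyFun_of_isOpen_section hU' hL'
  have h1 := exists_isotropicTriple_ne_zero hω hq L.1.linearIndependent_frame
    ((mem_hyperplaneSection_iff L.1.span_frame).1 L.2) hqL
  have h2 := exists_isotropicTriple_ne_zero hω hr L'.1.linearIndependent_frame
    ((mem_hyperplaneSection_iff L'.1.span_frame).1 L'.2) hrL
  obtain ⟨a, ha1, ha2⟩ := exists_ne_zero_of_polyFun (isPolyMap_isotropicTriple ω q hq)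
    (isPolyMap_isotropicTriple ω r hr) h1 h2
  obtain ⟨_, _, hmem⟩ := hqU _ (map_isotropicTriple ω a) ha1
  obtain ⟨_, _, hmem'⟩ := hrU _ (map_isotropicTriple ω a) ha2
  exact ⟨_, trivial, hmem, hmem'⟩

end Irreducible

end

noncomputable section

/-! ### Octonions -/

section Octonion

local infixl:70 " ⊛ " => octMul

theorem ComplexOctonion.ext8 {x y : ComplexOctonion} (h0 : x.1.re = y.1.re)
    (h1 : x.1.imI = y.1.imI) (h2 : x.1.imJ = y.1.imJ) (h3 : x.1.imK = y.1.imK)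
    (h4 : x.2.re = y.2.re) (h5 : x.2.imI = y.2.imI) (h6 : x.2.imJ = y.2.imJ)
    (h7 : x.2.imK = y.2.imK) : x = y :=
  Prod.ext (Quaternion.ext _ _ h0 h1 h2 h3) (Quaternion.ext _ _ h4 h5 h6 h7)

section

variable (x y : ComplexOctonion)

theorem octMul_fst_re : (x ⊛ y).1.re =
    x.1.re * y.1.re - x.1.imI * y.1.imI - x.1.imJ * y.1.imJ - x.1.imK * y.1.imK
      - y.2.re * x.2.re - y.2.imI * x.2.imI - y.2.imJ * x.2.imJ - y.2.imK * x.2.imK := by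
  simp only [octMul, Quaternion.re_sub, Quaternion.re_mul, Quaternion.re_star, Quaternion.imI_star,
    Quaternion.imJ_star, Quaternion.imK_star]
  ring

theorem octMul_fst_imI : (x ⊛ y).1.imI =
    x.1.re * y.1.imI + x.1.imI * y.1.re + x.1.imJ * y.1.imK - x.1.imK * y.1.imJ
      - y.2.re * x.2.imI + y.2.imI * x.2.re + y.2.imJ * x.2.imK - y.2.imK * x.2.imJ := by
  simp only [octMul, Quaternion.imI_sub, Quaternion.imI_mul, Quaternion.re_star, Quaternion.imI_star,
    Quaternion.imJ_star, Quaternion.imK_star]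
  ring

theorem octMul_fst_imJ : (x ⊛ y).1.imJ =
    x.1.re * y.1.imJ - x.1.imI * y.1.imK + x.1.imJ * y.1.re + x.1.imK * y.1.imI
      - y.2.re * x.2.imJ - y.2.imI * x.2.imK + y.2.imJ * x.2.re + y.2.imK * x.2.imI := by
  simp only [octMul, Quaternion.imJ_sub, Quaternion.imJ_mul, Quaternion.re_star, Quaternion.imI_star,
    Quaternion.imJ_star, Quaternion.imK_star]
  ring

theorem octMul_fst_imK : (x ⊛ y).1.imK =
    x.1.re * y.1.imK + x.1.imI * y.1.imJ - x.1.imJ * y.1.imI + x.1.imK * y.1.re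
      - y.2.re * x.2.imK + y.2.imI * x.2.imJ - y.2.imJ * x.2.imI + y.2.imK * x.2.re := by
  simp only [octMul, Quaternion.imK_sub, Quaternion.imK_mul, Quaternion.re_star, Quaternion.imI_star,
    Quaternion.imJ_star, Quaternion.imK_star]
  ring

theorem octMul_snd_re : (x ⊛ y).2.re =
    y.2.re * x.1.re - y.2.imI * x.1.imI - y.2.imJ * x.1.imJ - y.2.imK * x.1.imK
      + x.2.re * y.1.re + x.2.imI * y.1.imI + x.2.imJ * y.1.imJ + x.2.imK * y.1.imK := by
  simp only [octMul, Quaternion.re_add, Quaternion.re_mul, Quaternion.re_star, Quaternion.imI_star,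
    Quaternion.imJ_star, Quaternion.imK_star]
  ring

theorem octMul_snd_imI : (x ⊛ y).2.imI =
    y.2.re * x.1.imI + y.2.imI * x.1.re + y.2.imJ * x.1.imK - y.2.imK * x.1.imJ
      - x.2.re * y.1.imI + x.2.imI * y.1.re - x.2.imJ * y.1.imK + x.2.imK * y.1.imJ := by
  simp only [octMul, Quaternion.imI_add, Quaternion.imI_mul, Quaternion.re_star, Quaternion.imI_star,
    Quaternion.imJ_star, Quaternion.imK_star]
  ring

theorem octMul_snd_imJ : (x ⊛ y).2.imJ =
    y.2.re * x.1.imJ - y.2.imI * x.1.imK + y.2.imJ * x.1.re + y.2.imK * x.1.imI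
      - x.2.re * y.1.imJ + x.2.imI * y.1.imK + x.2.imJ * y.1.re - x.2.imK * y.1.imI := by
  simp only [octMul, Quaternion.imJ_add, Quaternion.imJ_mul, Quaternion.re_star, Quaternion.imI_star,
    Quaternion.imJ_star, Quaternion.imK_star]
  ring

theorem octMul_snd_imK : (x ⊛ y).2.imK =
    y.2.re * x.1.imK + y.2.imI * x.1.imJ - y.2.imJ * x.1.imI + y.2.imK * x.1.re
      - x.2.re * y.1.imK - x.2.imI * y.1.imJ + x.2.imJ * y.1.imI + x.2.imK * y.1.re := by
  simp only [octMul, Quaternion.imK_add, Quaternion.imK_mul, Quaternion.re_star, Quaternion.imI_star,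
    Quaternion.imJ_star, Quaternion.imK_star]
  ring

end

theorem octSMul_zero (x : ComplexOctonion) : (0 : ℂ) • x = 0 := zero_smul ℂ x

theorem octSMul_neg (c : ℂ) (x : ComplexOctonion) : (-c) • x = -(c • x) := neg_smul c x

theorem octSMul_sub (c d : ℂ) (x : ComplexOctonion) : (c - d) • x = c • x - d • x :=
  sub_smul c d x

/-- The octonion product as a bilinear map. -/
def octMulL : ComplexOctonion →ₗ[ℂ] ComplexOctonion →ₗ[ℂ] ComplexOctonion :=
  LinearMap.mk₂ ℂ octMul
    (fun x y z => by apply ComplexOctonion.ext8 <;> simp only [octMul_fst_re, octMul_fst_imI,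
      octMul_fst_imJ, octMul_fst_imK, octMul_snd_re, octMul_snd_imI, octMul_snd_imJ,
      octMul_snd_imK, Prod.fst_add, Prod.snd_add, Quaternion.re_add, Quaternion.imI_add,
      Quaternion.imJ_add, Quaternion.imK_add] <;> ring)
    (fun c x y => by apply ComplexOctonion.ext8 <;> simp only [octMul_fst_re, octMul_fst_imI,
      octMul_fst_imJ, octMul_fst_imK, octMul_snd_re, octMul_snd_imI, octMul_snd_imJ,
      octMul_snd_imK, Prod.smul_fst, Prod.smul_snd, Quaternion.re_smul, Quaternion.imI_smul,
      Quaternion.imJ_smul, Quaternion.imK_smul, smul_eq_mul] <;> ring)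
    (fun x y z => by apply ComplexOctonion.ext8 <;> simp only [octMul_fst_re, octMul_fst_imI,
      octMul_fst_imJ, octMul_fst_imK, octMul_snd_re, octMul_snd_imI, octMul_snd_imJ,
      octMul_snd_imK, Prod.fst_add, Prod.snd_add, Quaternion.re_add, Quaternion.imI_add,
      Quaternion.imJ_add, Quaternion.imK_add] <;> ring)
    (fun c x y => by apply ComplexOctonion.ext8 <;> simp only [octMul_fst_re, octMul_fst_imI,
      octMul_fst_imJ, octMul_fst_imK, octMul_snd_re, octMul_snd_imI, octMul_snd_imJ,
      octMul_snd_imK, Prod.smul_fst, Prod.smul_snd, Quaternion.re_smul, Quaternion.imI_smul,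
      Quaternion.imJ_smul, Quaternion.imK_smul, smul_eq_mul] <;> ring)

theorem octMulL_apply (x y : ComplexOctonion) : octMulL x y = x ⊛ y := rfl

variable (x y z : ComplexOctonion) (c : ℂ)

theorem add_octMul : (x + y) ⊛ z = x ⊛ z + y ⊛ z := octMulL.map_add₂ x y z
theorem octMul_add : x ⊛ (y + z) = x ⊛ y + x ⊛ z := (octMulL x).map_add y z
theorem neg_octMul : (-x) ⊛ y = -(x ⊛ y) := octMulL.map_neg₂ x y
theorem octMul_neg : x ⊛ (-y) = -(x ⊛ y) := (octMulL x).map_neg y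
theorem smul_octMul : (c • x) ⊛ y = c • (x ⊛ y) := octMulL.map_smul₂ c x y
theorem octMul_smul : x ⊛ (c • y) = c • (x ⊛ y) := (octMulL x).map_smul c y

/-- The unit of the octonions. -/
def octOne : ComplexOctonion := (1, 0)

theorem octOne_mul : octOne ⊛ x = x := by
  apply ComplexOctonion.ext8 <;> simp [octMul, octOne]

theorem mul_octOne : x ⊛ octOne = x := by
  apply ComplexOctonion.ext8 <;> simp [octMul, octOne]

theorem octOne_ne_zero : octOne ≠ 0 := by
  intro h
  simpa [octOne] using congrArg (fun x : ComplexOctonion => x.1.re) h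

/-- The conjugation of octonions. -/
def octConj : ComplexOctonion →ₗ[ℂ] ComplexOctonion where
  toFun x := (star x.1, -x.2)
  map_add' x y := by apply ComplexOctonion.ext8 <;> simp <;> ring
  map_smul' c x := by apply ComplexOctonion.ext8 <;> simp

theorem octConj_apply : octConj x = (star x.1, -x.2) := rfl

/-- The polar form of the norm of octonions, `B(x, x) = N(x)`. -/
def octB : ComplexOctonion →ₗ[ℂ] ComplexOctonion →ₗ[ℂ] ℂ :=
  LinearMap.mk₂ ℂ (fun x y => x.1.re * y.1.re + x.1.imI * y.1.imI + x.1.imJ * y.1.imJ +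
      x.1.imK * y.1.imK + x.2.re * y.2.re + x.2.imI * y.2.imI + x.2.imJ * y.2.imJ +
      x.2.imK * y.2.imK)
    (fun x y z => by simp; ring) (fun c x y => by simp; ring)
    (fun x y z => by simp; ring) (fun c x y => by simp; ring)

theorem octB_apply : octB x y = x.1.re * y.1.re + x.1.imI * y.1.imI + x.1.imJ * y.1.imJ +
      x.1.imK * y.1.imK + x.2.re * y.2.re + x.2.imI * y.2.imI + x.2.imJ * y.2.imJ +
      x.2.imK * y.2.imK := rfl

theorem octB_comm : octB x y = octB y x := by rw [octB_apply, octB_apply]; ring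

/-- The real part of an octonion. -/
def octRe : ComplexOctonion →ₗ[ℂ] ℂ where
  toFun x := x.1.re
  map_add' _ _ := rfl
  map_smul' _ _ := rfl

theorem octRe_apply : octRe x = x.1.re := rfl

theorem octB_one : octB x octOne = octRe x := by simp [octB_apply, octRe_apply, octOne]

theorem octB_one_one : octB octOne octOne = 1 := by simp [octB_apply, octOne]

theorem octConj_octConj : octConj (octConj x) = x := by
  apply ComplexOctonion.ext8 <;> simp [octConj_apply]

theorem octConj_mul : octConj (x ⊛ y) = octConj y ⊛ octConj x := by
  apply ComplexOctonion.ext8 <;> simp [octMul, octConj_apply] <;> ring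

theorem octConj_eq : octConj x = (2 * octRe x) • octOne - x := by
  apply ComplexOctonion.ext8 <;> simp [octConj_apply, octOne, octRe_apply] <;> ring

theorem octConj_eq_neg (hx : octRe x = 0) : octConj x = -x := by
  rw [octConj_eq, hx, mul_zero, octSMul_zero, zero_sub]

theorem octB_mul_left : octB (x ⊛ y) z = octB y (octConj x ⊛ z) := by
  simp only [octB_apply, octConj_apply, octMul_fst_re, octMul_fst_imI, octMul_fst_imJ,
    octMul_fst_imK, octMul_snd_re, octMul_snd_imI, octMul_snd_imJ, octMul_snd_imK,
    Quaternion.re_star, Quaternion.imI_star, Quaternion.imJ_star, Quaternion.imK_star,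
    Quaternion.re_neg, Quaternion.imI_neg, Quaternion.imJ_neg, Quaternion.imK_neg]
  ring

/-- The polarization of x̄(xz) = N(x)z, checked in coordinates. Together with its mirror image and
`octB_mul_left` it replaces coordinates in the Cayley–Dickson argument. -/
theorem octMul_alt_left : octConj x ⊛ (y ⊛ z) + octConj y ⊛ (x ⊛ z) = (2 * octB x y) • z := by
  apply ComplexOctonion.ext8 <;>
  simp only [octB_apply, octConj_apply, octMul_fst_re, octMul_fst_imI, octMul_fst_imJ,
    octMul_fst_imK, octMul_snd_re, octMul_snd_imI, octMul_snd_imJ, octMul_snd_imK,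
    Prod.fst_add, Prod.snd_add, Prod.smul_fst, Prod.smul_snd, Quaternion.re_add,
    Quaternion.imI_add, Quaternion.imJ_add, Quaternion.imK_add, Quaternion.re_smul,
    Quaternion.imI_smul, Quaternion.imJ_smul, Quaternion.imK_smul, smul_eq_mul,
    Quaternion.re_star, Quaternion.imI_star, Quaternion.imJ_star, Quaternion.imK_star,
    Quaternion.re_neg, Quaternion.imI_neg, Quaternion.imJ_neg, Quaternion.imK_neg] <;>
  ring

theorem octMul_alt_right : (z ⊛ y) ⊛ octConj x + (z ⊛ x) ⊛ octConj y = (2 * octB x y) • z := by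
  apply ComplexOctonion.ext8 <;>
  simp only [octB_apply, octConj_apply, octMul_fst_re, octMul_fst_imI, octMul_fst_imJ,
    octMul_fst_imK, octMul_snd_re, octMul_snd_imI, octMul_snd_imJ, octMul_snd_imK,
    Prod.fst_add, Prod.snd_add, Prod.smul_fst, Prod.smul_snd, Quaternion.re_add,
    Quaternion.imI_add, Quaternion.imJ_add, Quaternion.imK_add, Quaternion.re_smul,
    Quaternion.imI_smul, Quaternion.imJ_smul, Quaternion.imK_smul, smul_eq_mul,
    Quaternion.re_star, Quaternion.imI_star, Quaternion.imJ_star, Quaternion.imK_star,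
    Quaternion.re_neg, Quaternion.imI_neg, Quaternion.imJ_neg, Quaternion.imK_neg] <;>
  ring

theorem octConj_mul_mul : octConj x ⊛ (x ⊛ z) = octB x x • z := by
  have h := octMul_alt_left x x z
  rw [← two_smul ℂ, mul_smul] at h
  exact smul_right_injective _ (two_ne_zero' ℂ) h

theorem mul_mul_octConj : (z ⊛ x) ⊛ octConj x = octB x x • z := by
  have h := octMul_alt_right x x z
  rw [← two_smul ℂ, mul_smul] at h
  exact smul_right_injective _ (two_ne_zero' ℂ) h

theorem octB_mul_mul : octB (x ⊛ y) (x ⊛ y) = octB x x * octB y y := by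
  rw [octB_mul_left, octConj_mul_mul, map_smul, smul_eq_mul]

theorem octConj_mul_self : octConj x ⊛ x = octB x x • octOne := by
  have := octConj_mul_mul x octOne
  rwa [mul_octOne] at this

theorem octConj_mul_add : octConj x ⊛ y + octConj y ⊛ x = (2 * octB x y) • octOne := by
  have := octMul_alt_left x y octOne
  rwa [mul_octOne, mul_octOne] at this

theorem mul_octConj_add : y ⊛ octConj x + x ⊛ octConj y = (2 * octB x y) • octOne := by
  have := octMul_alt_right x y octOne
  rwa [octOne_mul, octOne_mul] at this

theorem octMul_self : x ⊛ x = (2 * octRe x) • x - octB x x • octOne := by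
  have h := octConj_mul_self x
  rw [octConj_eq, sub_eq_add_neg, add_octMul, smul_octMul, octOne_mul, neg_octMul] at h
  rw [← h]
  abel

/-- The quaternion with the given coordinates. -/
def quatMk (a b c d : ℂ) : ℍ[ℂ] := ⟨a, b, c, d⟩

@[simp] theorem quatMk_re (a b c d : ℂ) : (quatMk a b c d).re = a := rfl
@[simp] theorem quatMk_imI (a b c d : ℂ) : (quatMk a b c d).imI = b := rfl
@[simp] theorem quatMk_imJ (a b c d : ℂ) : (quatMk a b c d).imJ = c := rfl
@[simp] theorem quatMk_imK (a b c d : ℂ) : (quatMk a b c d).imK = d := rfl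

/-- The standard orthonormal basis of the octonions. -/
def octBasis : Fin 8 → ComplexOctonion :=
  ![(quatMk 1 0 0 0, 0), (quatMk 0 1 0 0, 0), (quatMk 0 0 1 0, 0), (quatMk 0 0 0 1, 0),
    (0, quatMk 1 0 0 0), (0, quatMk 0 1 0 0), (0, quatMk 0 0 1 0), (0, quatMk 0 0 0 1)]

theorem sum_octB_octBasis : ∑ i, octB (octBasis i) x • octBasis i = x := by
  rw [Fin.sum_univ_eight]
  apply ComplexOctonion.ext8 <;> simp [octBasis, octB_apply]

/-- The adjoint of an endomorphism of the octonions, with respect to `octB`. -/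
def octAdj : (ComplexOctonion →ₗ[ℂ] ComplexOctonion) →ₗ[ℂ]
    (ComplexOctonion →ₗ[ℂ] ComplexOctonion) where
  toFun f := ∑ i, (octB (f (octBasis i))).smulRight (octBasis i)
  map_add' f g := by
    rw [← Finset.sum_add_distrib]
    refine Finset.sum_congr rfl fun i _ => LinearMap.ext fun x => ?_
    simp [add_smul]
  map_smul' c f := by
    rw [Finset.smul_sum]
    refine Finset.sum_congr rfl fun i _ => LinearMap.ext fun x => ?_
    simp [mul_smul]

theorem octAdj_apply_apply (f : ComplexOctonion →ₗ[ℂ] ComplexOctonion)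
    (hf : ∀ x y, octB (f x) (f y) = octB x y) : octAdj f (f x) = x := by
  conv_rhs => rw [← sum_octB_octBasis x]
  simp [octAdj, hf]

/-! ### Automorphisms of the octonions -/

section Aut

variable {g : ComplexOctonion ≃ₗ[ℂ] ComplexOctonion} (hg : g ∈ G2)
include hg

theorem G2.map_mul : g (x ⊛ y) = g x ⊛ g y := hg x y

theorem G2.map_one : g octOne = octOne := by
  have h := G2.map_mul octOne (g.symm octOne) hg
  rw [octOne_mul, g.apply_symm_apply, mul_octOne] at h
  exact h.symm

/-- Apply `g` to x² = 2 Re(x) x − N(x) and compare with the same equation for g x: a multiple of g x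
by the difference of the real parts is scalar. Either the real parts agree, and then so do the
norms, or g x is scalar, hence `x` is, and scalars are fixed. -/
theorem G2.re_map_and_octB : octRe (g x) = octRe x ∧ octB (g x) (g x) = octB x x := by
  have h := G2.map_mul x x hg
  rw [octMul_self, octMul_self, map_sub, map_smul, map_smul, G2.map_one hg] at h
  have h' : (2 * (octRe x - octRe (g x))) • g x = (octB x x - octB (g x) (g x)) • octOne := by
    rw [mul_sub, octSMul_sub, octSMul_sub]
    exact sub_eq_sub_iff_sub_eq_sub.1 h
  have hre : octRe (g x) = octRe x := by
    by_contra hne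
    have h2 : (2 * (octRe x - octRe (g x))) ≠ 0 :=
      mul_ne_zero two_ne_zero (sub_ne_zero.2 (Ne.symm hne))
    have h3 : g x = ((2 * (octRe x - octRe (g x)))⁻¹ * (octB x x - octB (g x) (g x))) • octOne := by
      rw [mul_smul, ← h', smul_smul, inv_mul_cancel₀ h2, one_smul]
    have h4 : x = ((2 * (octRe x - octRe (g x)))⁻¹ * (octB x x - octB (g x) (g x))) • octOne := by
      apply g.injective
      rw [map_smul, G2.map_one hg]
      exact h3
    apply hne
    rw [h4, map_smul, G2.map_one hg]
  refine ⟨hre, ?_⟩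
  rw [hre, sub_self, mul_zero, octSMul_zero] at h'
  exact (sub_eq_zero.1 ((smul_eq_zero.1 h'.symm).resolve_right octOne_ne_zero)).symm

theorem G2.re_map : octRe (g x) = octRe x := (G2.re_map_and_octB x hg).1

theorem G2.octB_map : octB (g x) (g y) = octB x y := by
  have h := (G2.re_map_and_octB (x + y) hg).2
  have h1 := (G2.re_map_and_octB x hg).2
  have h2 := (G2.re_map_and_octB y hg).2
  simp only [map_add, LinearMap.add_apply, h1, h2, octB_comm (g y) (g x), octB_comm y x] at h
  linear_combination h / 2

/-- Automorphisms are orthogonal, so the inverse is the adjoint, a linear function of `g`. This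
handles the second component of the embedding g ↦ (g, g⁻¹). -/
theorem G2.octAdj_eq : octAdj g.toLinearMap = g.symm.toLinearMap := by
  refine LinearMap.ext fun y => ?_
  obtain ⟨x, rfl⟩ := g.surjective y
  exact (octAdj_apply_apply x g.toLinearMap fun x y => G2.octB_map x y hg).trans
    (g.symm_apply_apply x).symm

end Aut

/-! ### Basic triples -/

/-- Orthonormal triples of imaginary octonions, the third of which is orthogonal to the product of
the first two. -/
structure IsBasicTriple (v : Fin 3 → ComplexOctonion) : Prop where
  re : ∀ i, octRe (v i) = 0
  orthonormal : ∀ i j, octB (v i) (v j) = if i = j then 1 else 0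
  mul : octB (v 0 ⊛ v 1) (v 2) = 0

/-- The image of a quaternion under the algebra homomorphism that maps `i`, `j` to `v 0`, `v 1`. -/
def quatMap (v : Fin 3 → ComplexOctonion) : ℍ[ℂ] →ₗ[ℂ] ComplexOctonion where
  toFun p := p.re • octOne + p.imI • v 0 + p.imJ • v 1 + p.imK • (v 0 ⊛ v 1)
  map_add' p q := by simp only [Quaternion.re_add, Quaternion.imI_add, Quaternion.imJ_add,
    Quaternion.imK_add]; module
  map_smul' c p := by simp only [Quaternion.re_smul, Quaternion.imI_smul, Quaternion.imJ_smul,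
    Quaternion.imK_smul, smul_eq_mul, RingHom.id_apply]; module

theorem quatMap_apply (v : Fin 3 → ComplexOctonion) (p : ℍ[ℂ]) : quatMap v p =
    p.re • octOne + p.imI • v 0 + p.imJ • v 1 + p.imK • (v 0 ⊛ v 1) := rfl

/-- The linear map that is the automorphism of the octonions defined by `v` if `v` is a basic
triple. -/
def tripleMap (v : Fin 3 → ComplexOctonion) : ComplexOctonion →ₗ[ℂ] ComplexOctonion :=
  quatMap v ∘ₗ LinearMap.fst ℂ _ _ +
    octMulL.flip (v 2) ∘ₗ quatMap v ∘ₗ LinearMap.snd ℂ _ _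

theorem tripleMap_apply (v : Fin 3 → ComplexOctonion) :
    tripleMap v x = quatMap v x.1 + quatMap v x.2 ⊛ v 2 := rfl

section

variable {x y} {a b : ComplexOctonion}

theorem octMul_self_imag (ha : octRe a = 0) : a ⊛ a = -(octB a a) • octOne := by
  rw [octMul_self, ha, mul_zero, octSMul_zero, zero_sub, octSMul_neg]

theorem octMul_anticomm (ha : octRe a = 0) (hb : octRe b = 0) (hab : octB a b = 0) :
    b ⊛ a = -(a ⊛ b) := by
  have h := octConj_mul_add a b
  rw [octConj_eq_neg a ha, octConj_eq_neg b hb, hab, neg_octMul, neg_octMul] at h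
  rw [mul_zero, octSMul_zero] at h
  exact eq_neg_of_add_eq_zero_right (by rw [← neg_eq_zero, ← h]; abel)

theorem octMul_octMul_imag (ha : octRe a = 0) : a ⊛ (a ⊛ z) = -(octB a a) • z := by
  have h := octConj_mul_mul a z
  rw [octConj_eq_neg a ha, neg_octMul] at h
  rw [octSMul_neg, ← h, neg_neg]

theorem octMul_mul_imag (ha : octRe a = 0) : (z ⊛ a) ⊛ a = -(octB a a) • z := by
  have h := mul_mul_octConj a z
  rw [octConj_eq_neg a ha, octMul_neg] at h
  rw [octSMul_neg, ← h, neg_neg]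

end

end Octonion

end

/-! ### Automorphisms from basic triples by the Cayley–Dickson construction -/

noncomputable section

section BasicTriple

local infixl:70 " ⊛ " => octMul

theorem octRe_mul (x y : ComplexOctonion) : octRe (x ⊛ y) = octB y (octConj x) := by
  rw [← octB_one, octB_mul_left, mul_octOne]

variable {v : Fin 3 → ComplexOctonion}

theorem quatMap_star (h : ∀ i, octRe (v i) = 0) (h01 : octB (v 0) (v 1) = 0) (p : ℍ[ℂ]) :
    quatMap v (star p) = octConj (quatMap v p) := by
  have h1 : octConj octOne = octOne := by
    apply ComplexOctonion.ext8 <;> simp [octConj_apply, octOne]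
  have h2 : octConj (v 0 ⊛ v 1) = -(v 0 ⊛ v 1) := by
    rw [octConj_mul, octConj_eq_neg _ (h 0), octConj_eq_neg _ (h 1), neg_octMul, octMul_neg,
      neg_neg, octMul_anticomm (h 0) (h 1) h01]
  simp only [quatMap_apply, map_add, map_smul, h1, h2, octConj_eq_neg _ (h 0),
    octConj_eq_neg _ (h 1), Quaternion.re_star, Quaternion.imI_star, Quaternion.imJ_star,
    Quaternion.imK_star]
  module

theorem quatMap_mul (h : ∀ i, octRe (v i) = 0) (h01 : octB (v 0) (v 1) = 0)
    (h0 : octB (v 0) (v 0) = 1) (h1 : octB (v 1) (v 1) = 1) (p q : ℍ[ℂ]) :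
    quatMap v (p * q) = quatMap v p ⊛ quatMap v q := by
  simp only [quatMap_apply]
  have ha := h 0
  have hb := h 1
  clear h
  generalize v 0 = a at *
  generalize v 1 = b at *
  have hba : b ⊛ a = -(a ⊛ b) := octMul_anticomm ha hb h01
  have haa : a ⊛ a = -octOne := by
    rw [octMul_self_imag ha, h0, octSMul_neg, one_smul]
  have hbb : b ⊛ b = -octOne := by
    rw [octMul_self_imag hb, h1, octSMul_neg, one_smul]
  have e1 (z) : a ⊛ (a ⊛ z) = -z := by
    rw [octMul_octMul_imag z ha, h0, octSMul_neg, one_smul]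
  have e2 (z) : b ⊛ (b ⊛ z) = -z := by
    rw [octMul_octMul_imag z hb, h1, octSMul_neg, one_smul]
  have e3 (z) : (z ⊛ a) ⊛ a = -z := by
    rw [octMul_mul_imag z ha, h0, octSMul_neg, one_smul]
  have e4 (z) : (z ⊛ b) ⊛ b = -z := by
    rw [octMul_mul_imag z hb, h1, octSMul_neg, one_smul]
  have hbk : b ⊛ (a ⊛ b) = a := by
    rw [← neg_eq_iff_eq_neg.2 hba, octMul_neg, e2, neg_neg]
  have hka : (a ⊛ b) ⊛ a = b := by
    rw [← neg_eq_iff_eq_neg.2 hba, neg_octMul, e3, neg_neg]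
  have hkk : (a ⊛ b) ⊛ (a ⊛ b) = -octOne := by
    have hk : octRe (a ⊛ b) = 0 := by
      rw [octRe_mul, octConj_eq_neg _ ha, map_neg, octB_comm, h01, neg_zero]
    rw [octMul_self_imag hk, octB_mul_mul, h0, h1, one_mul, octSMul_neg, one_smul]
  -- Signs become scalars, so that `smul_octMul` and `octMul_smul` can move them out of products.
  have hneg (z : ComplexOctonion) : -z = (-1 : ℂ) • z := (neg_one_smul ℂ z).symm
  rw [hneg] at hba haa hbb hkk
  have e1' (z) : a ⊛ (a ⊛ z) = (-1 : ℂ) • z := (e1 z).trans (hneg z)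
  have e4' (z) : (z ⊛ b) ⊛ b = (-1 : ℂ) • z := (e4 z).trans (hneg z)
  simp only [add_octMul, octMul_add, smul_octMul, octMul_smul, octOne_mul,
    mul_octOne, haa, hbb, e1', e4', hba, hbk, hka, hkk, Quaternion.re_mul, Quaternion.imI_mul,
    Quaternion.imJ_mul, Quaternion.imK_mul]
  module

section CayleyDickson

variable {x y c : ComplexOctonion} (hc : octRe c = 0)
include hc

theorem octMul_comm_of_orthogonal (hy : octB c y = 0) : y ⊛ c = c ⊛ octConj y := by
  have h := mul_octConj_add c y
  rw [octConj_eq_neg c hc, octMul_neg, hy, mul_zero, octSMul_zero] at h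
  exact neg_add_eq_zero.1 h

theorem octConj_mul_of_orthogonal (hy : octB c y = 0) : octConj (y ⊛ c) = -(y ⊛ c) := by
  rw [octConj_mul, octConj_eq_neg c hc, neg_octMul, octMul_comm_of_orthogonal hc hy]

/-- With the next two lemmas, the multiplication rules for the double of a subalgebra orthogonal to
`c`. Each is polarized alternativity, whose scalar term vanishes by orthogonality. -/
theorem octMul_cayley_one (hx : octB c (octConj x) = 0) (hy : octB c y = 0)
    (hyx : octB c (y ⊛ x) = 0) : x ⊛ (y ⊛ c) = (y ⊛ x) ⊛ c := by
  have h := octMul_alt_left (octConj x) c (octConj y)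
  rw [octConj_octConj, octB_comm, hx, mul_zero, octSMul_zero, octConj_eq_neg c hc, neg_octMul,
    ← octConj_mul] at h
  rw [octMul_comm_of_orthogonal hc hy, octMul_comm_of_orthogonal hc hyx]
  exact add_neg_eq_zero.1 h

theorem octMul_cayley_two (hy : octB c (octConj y) = 0) :
    (x ⊛ c) ⊛ y = (x ⊛ octConj y) ⊛ c := by
  have h := octMul_alt_right c (octConj y) x
  rw [octConj_octConj, hy, mul_zero, octSMul_zero, octConj_eq_neg c hc, octMul_neg] at h
  exact (neg_add_eq_zero.1 h).symm

theorem octMul_cayley_three (hcc : octB c c = 1) (hx : octB c x = 0)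
    (hxy : octB c (octConj x ⊛ y) = 0) : (x ⊛ c) ⊛ (y ⊛ c) = -(octConj y ⊛ x) := by
  have h := octMul_alt_left (octConj (x ⊛ c)) y c
  rw [octConj_octConj, octConj_mul_of_orthogonal hc hx, neg_octMul, octMul_mul_imag _ hc, hcc,
    octSMul_neg, one_smul, neg_neg, map_neg, LinearMap.neg_apply, octB_mul_left, hxy, neg_zero,
    mul_zero, octSMul_zero] at h
  exact eq_neg_of_add_eq_zero_left h

end CayleyDickson

namespace IsBasicTriple

variable (hv : IsBasicTriple v)
include hv

theorem octB_quatMap (p : ℍ[ℂ]) : octB (v 2) (quatMap v p) = 0 := by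
  have h0 := hv.orthonormal 2 0
  have h1 := hv.orthonormal 2 1
  have hk := hv.mul
  rw [octB_comm] at hk
  simp [quatMap_apply, octB_one, hv.re, h0, h1, hk]

/-- `quatMap v` is multiplicative with values orthogonal to v₂, so the three Cayley–Dickson rules
apply with c = v₂. They reproduce the four terms in the definition of `octMul`. -/
theorem tripleMap_mul (x y : ComplexOctonion) :
    tripleMap v (x ⊛ y) = tripleMap v x ⊛ tripleMap v y := by
  have h01 : octB (v 0) (v 1) = 0 := hv.orthonormal 0 1
  have h00 : octB (v 0) (v 0) = 1 := hv.orthonormal 0 0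
  have h11 : octB (v 1) (v 1) = 1 := hv.orthonormal 1 1
  have h22 : octB (v 2) (v 2) = 1 := hv.orthonormal 2 2
  have hm := quatMap_mul hv.re h01 h00 h11
  have hs := quatMap_star hv.re h01
  have ho := hv.octB_quatMap
  have e1 (p q : ℍ[ℂ]) : quatMap v p ⊛ (quatMap v q ⊛ v 2) = quatMap v (q * p) ⊛ v 2 := by
    rw [octMul_cayley_one (hv.re 2) (by rw [← hs]; exact ho _) (ho _) (by rw [← hm]; exact ho _),
      hm]
  have e2 (p q : ℍ[ℂ]) : (quatMap v p ⊛ v 2) ⊛ quatMap v q = quatMap v (p * star q) ⊛ v 2 := by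
    rw [octMul_cayley_two (hv.re 2) (by rw [← hs]; exact ho _), hm, hs]
  have e3 (p q : ℍ[ℂ]) : (quatMap v p ⊛ v 2) ⊛ (quatMap v q ⊛ v 2) =
      -quatMap v (star q * p) := by
    rw [octMul_cayley_three (hv.re 2) h22 (ho _) (by rw [← hs, ← hm]; exact ho _), hm, hs]
  rw [tripleMap_apply, tripleMap_apply, tripleMap_apply, add_octMul, octMul_add, octMul_add, e1,
    e2, e3, ← hm]
  change quatMap v (x.1 * y.1 - star y.2 * x.2) + quatMap v (y.2 * x.1 + x.2 * star y.1) ⊛ v 2 = _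
  rw [map_sub, map_add, add_octMul]
  abel

theorem tripleMap_conj (x : ComplexOctonion) :
    tripleMap v (octConj x) = octConj (tripleMap v x) := by
  rw [tripleMap_apply, tripleMap_apply, map_add,
    octConj_mul_of_orthogonal (hv.re 2) (hv.octB_quatMap _),
    ← quatMap_star hv.re (hv.orthonormal 0 1)]
  change quatMap v (star x.1) + quatMap v (-x.2) ⊛ v 2 = _
  rw [map_neg, neg_octMul]

omit hv in
theorem _root_.tripleMap_one (v : Fin 3 → ComplexOctonion) : tripleMap v octOne = octOne := by
  have h0 : quatMap v 0 = 0 := map_zero _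
  have h1 : octMul 0 (v 2) = 0 := map_zero (octMulL.flip (v 2))
  rw [tripleMap_apply]
  change quatMap v 1 + quatMap v 0 ⊛ v 2 = _
  rw [h0, h1, add_zero, quatMap_apply]
  simp [octSMul_zero]

theorem octB_tripleMap_self (x : ComplexOctonion) :
    octB (tripleMap v x) (tripleMap v x) = octB x x := by
  have h := octConj_mul_self (tripleMap v x)
  rw [← hv.tripleMap_conj, ← hv.tripleMap_mul, octConj_mul_self, map_smul, tripleMap_one] at h
  exact (smul_left_injective ℂ octOne_ne_zero h).symm

theorem octB_tripleMap (x y : ComplexOctonion) :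
    octB (tripleMap v x) (tripleMap v y) = octB x y := by
  have h := hv.octB_tripleMap_self (x + y)
  simp only [map_add, LinearMap.add_apply, hv.octB_tripleMap_self,
    octB_comm (tripleMap v y) (tripleMap v x), octB_comm y x] at h
  linear_combination h / 2

/-- The automorphism of the octonions defined by a basic triple. -/
def equiv : ComplexOctonion ≃ₗ[ℂ] ComplexOctonion :=
  -- An isometry has its adjoint as left inverse, and in finite dimension a left inverse is a right
  -- inverse.
  have h : octAdj (tripleMap v) ∘ₗ tripleMap v = LinearMap.id :=
    LinearMap.ext fun x => by
      rw [LinearMap.comp_apply, octAdj_apply_apply x _ hv.octB_tripleMap, LinearMap.id_apply]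
  LinearEquiv.ofLinearMap (tripleMap v) (octAdj (tripleMap v)) ((LinearMap.comp_eq_id_comm ℂ _).1 h) h

theorem equiv_apply (x : ComplexOctonion) : hv.equiv x = tripleMap v x := rfl

theorem equiv_mem : hv.equiv ∈ G2 := hv.tripleMap_mul

end IsBasicTriple

/-- The standard basic triple. -/
def stdTriple : Fin 3 → ComplexOctonion := ![octBasis 1, octBasis 2, octBasis 4]

theorem isBasicTriple_stdTriple : IsBasicTriple stdTriple where
  re i := by fin_cases i <;> simp [stdTriple, octBasis, octRe_apply]
  orthonormal i j := by
    fin_cases i <;> fin_cases j <;> simp [stdTriple, octBasis, octB_apply]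
  mul := by
    simp [stdTriple, octBasis, octB_apply, octMul_fst_re, octMul_fst_imI, octMul_fst_imJ,
      octMul_fst_imK, octMul_snd_re, octMul_snd_imI, octMul_snd_imJ, octMul_snd_imK]

theorem tripleMap_stdTriple (x : ComplexOctonion) : tripleMap stdTriple x = x := by
  rw [tripleMap_apply]
  apply ComplexOctonion.ext8 <;>
  simp [quatMap_apply, stdTriple, octBasis, octOne, octMul_fst_re, octMul_fst_imI, octMul_fst_imJ,
      octMul_fst_imK, octMul_snd_re, octMul_snd_imI, octMul_snd_imJ, octMul_snd_imK]

theorem tripleMap_apply_triple (v : Fin 3 → ComplexOctonion) (i : Fin 3) :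
    tripleMap v (stdTriple i) = v i := by
  rw [tripleMap_apply]
  have h0 : octMul 0 (v 2) = 0 := map_zero (octMulL.flip (v 2))
  fin_cases i
  · simp [stdTriple, octBasis, quatMap_apply, h0, octSMul_zero]
  · simp [stdTriple, octBasis, quatMap_apply, h0, octSMul_zero]
  · simp [stdTriple, octBasis, quatMap_apply, octOne_mul, octSMul_zero]

section

variable {g : ComplexOctonion ≃ₗ[ℂ] ComplexOctonion} (hg : g ∈ G2)
include hg

theorem G2.map_tripleMap (v : Fin 3 → ComplexOctonion) (x : ComplexOctonion) :
    g (tripleMap v x) = tripleMap (fun i => g (v i)) x := by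
  simp only [tripleMap_apply, quatMap_apply, map_add, map_smul, G2.map_mul _ _ hg, G2.map_one hg]

/-- The standard triple e₁, e₂, e₄ generates the octonions. So `g` is recovered from its frame, by a
formula polynomial in the frame. -/
theorem G2.eq_tripleMap (x : ComplexOctonion) : g x = tripleMap (fun i => g (stdTriple i)) x := by
  rw [← G2.map_tripleMap hg, tripleMap_stdTriple]

theorem G2.isBasicTriple_map (hv : IsBasicTriple v) : IsBasicTriple fun i => g (v i) where
  re i := by rw [G2.re_map _ hg]; exact hv.re i
  orthonormal i j := by rw [G2.octB_map _ _ hg]; exact hv.orthonormal i j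
  mul := by rw [← G2.map_mul _ _ hg, G2.octB_map _ _ hg]; exact hv.mul

end

theorem isPolyMap_of_octBasis {E F : Type*} [AddCommGroup E] [Module ℂ E] [AddCommGroup F]
    [Module ℂ F] {Φ : E → ComplexOctonion →ₗ[ℂ] F}
    (h : ∀ i, IsPolyMap fun x => Φ x (octBasis i)) : IsPolyMap Φ := by
  have : Φ = fun x => ∑ i, LinearMap.smulRightₗ (octB (octBasis i)) (Φ x (octBasis i)) := by
    funext x
    refine LinearMap.ext fun y => ?_
    conv_lhs => rw [← sum_octB_octBasis y]
    simp
  rw [this]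
  exact IsPolyMap.sum _ fun i _ => (h i).linear _

theorem isPolyMap_quatMap (p : ℍ[ℂ]) :
    IsPolyMap fun v : Fin 3 → ComplexOctonion => quatMap v p := by
  have hk : IsPolyMap fun v : Fin 3 → ComplexOctonion => octMulL (v 0) (v 1) :=
    IsPolyMap.bilin octMulL (isPolyMap_apply 0) (isPolyMap_apply 1)
  simp only [quatMap_apply, ← octMulL_apply]
  exact (((isPolyMap_const _).add (IsPolyMap.smul (polyFun_const _) (isPolyMap_apply 0))).add
    (IsPolyMap.smul (polyFun_const _) (isPolyMap_apply 1))).add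
    (IsPolyMap.smul (polyFun_const _) hk)

theorem isPolyMap_tripleMap : IsPolyMap tripleMap := by
  refine isPolyMap_of_octBasis fun i => ?_
  simp only [tripleMap_apply, ← octMulL_apply]
  exact (isPolyMap_quatMap _).add
    (IsPolyMap.bilin octMulL (isPolyMap_quatMap _) (isPolyMap_apply 2))

end BasicTriple

end

/-! ### The octonion three-form and an invariant volume form -/

noncomputable section

local infixl:70 " ⊛ " => octMul

section

variable {V : Type*} [AddCommGroup V] [Module ℂ V] (ι : V ≃ₗ[ℂ] (Fin 7 → ℂ))

/-- The identification of `V` with the imaginary octonions defined by the coordinates `ι`. -/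
def octEmb : V →ₗ[ℂ] ComplexOctonion :=
  ∑ i : Fin 7, LinearMap.smulRight (LinearMap.proj i ∘ₗ ι.toLinearMap) (octBasis i.succ)

/-- The projection of the octonions to the imaginary octonions, identified with `V`. -/
def octProj : ComplexOctonion →ₗ[ℂ] V :=
  ι.symm.toLinearMap ∘ₗ LinearMap.pi fun i => octB (octBasis i.succ)

theorem octB_octBasis (i j : Fin 8) : octB (octBasis i) (octBasis j) = if i = j then 1 else 0 := by
  fin_cases i <;> fin_cases j <;> simp [octBasis, octB_apply]

theorem octBasis_zero : octBasis 0 = octOne := by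
  apply ComplexOctonion.ext8 <;> simp [octBasis, octOne]

theorem octEmb_apply (v : V) : octEmb ι v = ∑ i : Fin 7, ι v i • octBasis i.succ := by
  simp [octEmb]

theorem octB_octBasis_octEmb (i : Fin 7) (v : V) : octB (octBasis i.succ) (octEmb ι v) = ι v i := by
  simp [octEmb_apply, octB_octBasis]

theorem octRe_octEmb (v : V) : octRe (octEmb ι v) = 0 := by
  rw [← octB_one, ← octBasis_zero, octEmb_apply, map_sum, LinearMap.sum_apply]
  refine Finset.sum_eq_zero fun i _ => ?_
  rw [map_smul, LinearMap.smul_apply, octB_octBasis, if_neg (Fin.succ_ne_zero i), smul_zero]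

theorem octProj_octEmb (v : V) : octProj ι (octEmb ι v) = v := by
  apply ι.injective
  ext i
  simp [octProj, octB_octBasis_octEmb]

theorem octEmb_octProj (x : ComplexOctonion) :
    octEmb ι (octProj ι x) = x - octRe x • octOne := by
  have h := sum_octB_octBasis x
  rw [Fin.sum_univ_succ, octBasis_zero, octB_comm, octB_one] at h
  rw [octEmb_apply, eq_sub_iff_add_eq', ← h]
  simp [octProj, h]

theorem octEmb_octProj_of_re {x : ComplexOctonion} (hx : octRe x = 0) :
    octEmb ι (octProj ι x) = x := by
  rw [octEmb_octProj, hx, octSMul_zero, sub_zero]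

theorem octEmb_injective : Function.Injective (octEmb ι) :=
  Function.LeftInverse.injective (octProj_octEmb ι)

/-- The alternating three-form of the coordinates `i`, `j`, `k`. -/
def coordForm (i j k : Fin 7) : V [⋀^Fin 3]→ₗ[ℂ] ℂ :=
  detForm ![LinearMap.proj i ∘ₗ ι.toLinearMap, LinearMap.proj j ∘ₗ ι.toLinearMap,
    LinearMap.proj k ∘ₗ ι.toLinearMap]

/-- The three-form `(x, y, z) ↦ B(x y, z)` on the imaginary octonions. -/
def octForm : V [⋀^Fin 3]→ₗ[ℂ] ℂ :=
  coordForm ι 0 1 2 + coordForm ι 0 3 4 + coordForm ι 1 3 5 + coordForm ι 2 3 6 -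
    coordForm ι 0 5 6 + coordForm ι 1 4 6 - coordForm ι 2 4 5

theorem octForm_apply (v : Fin 3 → V) :
    octForm ι v = octB (octEmb ι (v 0) ⊛ octEmb ι (v 1)) (octEmb ι (v 2)) := by
  have h : ∀ v : V, octEmb ι v = (quatMk 0 (ι v 0) (ι v 1) (ι v 2),
      quatMk (ι v 3) (ι v 4) (ι v 5) (ι v 6)) := fun v => by
    rw [octEmb_apply, Fin.sum_univ_seven]
    apply ComplexOctonion.ext8 <;> simp [octBasis]
  simp only [octForm, coordForm, AlternatingMap.add_apply, AlternatingMap.sub_apply,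
    detForm_apply_three, h, octB_apply, octMul_fst_re, octMul_fst_imI, octMul_fst_imJ,
    octMul_fst_imK, octMul_snd_re, octMul_snd_imI, octMul_snd_imJ, octMul_snd_imK, quatMk_re,
    quatMk_imI, quatMk_imJ, quatMk_imK, LinearMap.comp_apply, LinearMap.proj_apply,
    LinearEquiv.coe_coe, Matrix.cons_val_zero, Matrix.cons_val_one, Matrix.cons_val]
  ring

theorem octForm_tri (x y z : V) :
    (octForm ι).tri x y z = octB (octEmb ι x ⊛ octEmb ι y) (octEmb ι z) := by
  rw [AlternatingMap.tri_apply, octForm_apply]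
  rfl

/-- Adjacent transpositions generate the permutations, and each changes one sign. It is applied to
the left multiplications by e₁, …, e₇, which anticommute. -/
theorem prod_ofFn_perm {A : Type*} [Ring A] (σ : Equiv.Perm (Fin 7)) (f : Fin 7 → A)
    (hf : ∀ i j, i ≠ j → f i * f j = -(f j * f i)) :
    (List.ofFn (f ∘ σ)).prod = (Equiv.Perm.sign σ : ℤ) • (List.ofFn f).prod := by
  have hσ : σ ∈ Submonoid.closure (Set.range fun i : Fin 6 => Equiv.swap i.castSucc i.succ) := by
    rw [Equiv.Perm.mclosure_swap_castSucc_succ]; trivial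
  induction hσ using Submonoid.closure_induction generalizing f with
  | mem σ hσ =>
    obtain ⟨i, rfl⟩ := hσ
    rw [Equiv.Perm.sign_swap (Fin.castSucc_lt_succ).ne]
    have hs : ∀ i j, i ≠ j → ∀ x, f i * (f j * x) = -(f j * (f i * x)) := fun i j hij x => by
      rw [← mul_assoc, hf i j hij, neg_mul, mul_assoc]
    have hp : (List.ofFn f).prod = f 0 * (f 1 * (f 2 * (f 3 * (f 4 * (f 5 * (f 6 * 1)))))) := by
      rfl
    rw [hp, Units.val_neg, Units.val_one]
    fin_cases i
    · change f 1 * (f 0 * (f 2 * (f 3 * (f 4 * (f 5 * (f 6 * 1)))))) = _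
      rw [hs 1 0 (by decide)]
      exact (neg_one_zsmul _).symm
    · change f 0 * (f 2 * (f 1 * (f 3 * (f 4 * (f 5 * (f 6 * 1)))))) = _
      rw [hs 2 1 (by decide)]
      simp only [mul_neg]
      exact (neg_one_zsmul _).symm
    · change f 0 * (f 1 * (f 3 * (f 2 * (f 4 * (f 5 * (f 6 * 1)))))) = _
      rw [hs 3 2 (by decide)]
      simp only [mul_neg]
      exact (neg_one_zsmul _).symm
    · change f 0 * (f 1 * (f 2 * (f 4 * (f 3 * (f 5 * (f 6 * 1)))))) = _
      rw [hs 4 3 (by decide)]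
      simp only [mul_neg]
      exact (neg_one_zsmul _).symm
    · change f 0 * (f 1 * (f 2 * (f 3 * (f 5 * (f 4 * (f 6 * 1)))))) = _
      rw [hs 5 4 (by decide)]
      simp only [mul_neg]
      exact (neg_one_zsmul _).symm
    · change f 0 * (f 1 * (f 2 * (f 3 * (f 4 * (f 6 * (f 5 * 1)))))) = _
      rw [hs 6 5 (by decide)]
      simp only [mul_neg]
      exact (neg_one_zsmul _).symm
  | one => simp
  | mul σ τ _ _ hσ hτ =>
    have := hτ (f ∘ σ) fun i j hij => hf _ _ fun h => hij (σ.injective h)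
    rw [Function.comp_assoc] at this
    rw [Equiv.Perm.coe_mul, this, hσ f hf, smul_smul, map_mul, mul_comm]
    simp

/-- A volume form on `V`, in terms of the product of octonions. -/
def octVol : V [⋀^Fin 7]→ₗ[ℂ] ℂ :=
  MultilinearMap.alternatization
    ((octRe ∘ₗ LinearMap.applyₗ octOne).compMultilinearMap
      ((MultilinearMap.mkPiAlgebraFin ℂ 7 (Module.End ℂ ComplexOctonion)).compLinearMap
        fun _ => octMulL ∘ₗ octEmb ι))

theorem octVol_apply (v : Fin 7 → V) : octVol ι v = ∑ σ : Equiv.Perm (Fin 7),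
    (Equiv.Perm.sign σ : ℤ) •
      octRe ((List.ofFn fun i => octMulL (octEmb ι (v (σ i)))).prod octOne) := by
  rw [octVol, MultilinearMap.alternatization_apply]
  refine Finset.sum_congr rfl fun σ _ => ?_
  rw [Units.smul_def, MultilinearMap.domDomCongr_apply, LinearMap.compMultilinearMap_apply,
    MultilinearMap.compLinearMap_apply, MultilinearMap.mkPiAlgebraFin_apply]
  simp only [LinearMap.comp_apply, LinearMap.applyₗ_apply_apply]

theorem octMulL_anticomm {x y : ComplexOctonion} (hx : octRe x = 0) (hy : octRe y = 0)
    (hxy : octB x y = 0) : octMulL x * octMulL y = -(octMulL y * octMulL x) := by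
  refine LinearMap.ext fun z => ?_
  have h := octMul_alt_left x y z
  rw [octConj_eq_neg x hx, octConj_eq_neg y hy, hxy, mul_zero, octSMul_zero, neg_octMul,
    neg_octMul, ← neg_add, neg_eq_zero] at h
  exact eq_neg_of_add_eq_zero_left h

theorem octEmb_symm_single (i : Fin 7) : octEmb ι (ι.symm (Pi.single i 1)) = octBasis i.succ := by
  rw [octEmb_apply, LinearEquiv.apply_symm_apply, Finset.sum_eq_single i]
  · simp
  · intro j _ hj; rw [Pi.single_eq_of_ne hj, octSMul_zero]
  · simp

/-- By anticommutativity the 7! signed terms are all equal to the real part of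
e₁(e₂(e₃(e₄(e₅(e₆e₇))))) = −1. -/
theorem octVol_basis_ne_zero : octVol ι (fun i => ι.symm (Pi.single i 1)) ≠ 0 := by
  have h : octVol ι (fun i => ι.symm (Pi.single i 1)) = ∑ σ : Equiv.Perm (Fin 7),
      octRe ((List.ofFn fun i : Fin 7 => octMulL (octBasis i.succ)).prod octOne) := by
    rw [octVol_apply]
    refine Finset.sum_congr rfl fun σ _ => ?_
    simp only [octEmb_symm_single]
    have := prod_ofFn_perm σ (fun i : Fin 7 => octMulL (octBasis i.succ)) fun i j hij =>
      octMulL_anticomm (by fin_cases i <;> simp [octBasis, octRe_apply])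
        (by fin_cases j <;> simp [octBasis, octRe_apply]) (by simp [octB_octBasis, hij])
    rw [Function.comp_def] at this
    rw [this, LinearMap.smul_apply, map_zsmul, smul_smul, ← Units.val_mul]
    simp
  have h7 : (List.ofFn fun i : Fin 7 => octMulL (octBasis i.succ)).prod octOne =
      octBasis 1 ⊛ (octBasis 2 ⊛ (octBasis 3 ⊛ (octBasis 4 ⊛ (octBasis 5 ⊛ (octBasis 6 ⊛
        (octBasis 7 ⊛ octOne)))))) := by
    simp [List.ofFn_succ, octMulL_apply]
  have h67 : octBasis 6 ⊛ octBasis 7 = -octBasis 1 := by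
    apply ComplexOctonion.ext8 <;> simp [octMul, octBasis]
  have h51 : octBasis 5 ⊛ octBasis 1 = octBasis 4 := by
    apply ComplexOctonion.ext8 <;> simp [octMul, octBasis]
  have h44 : octBasis 4 ⊛ octBasis 4 = -octOne := by
    apply ComplexOctonion.ext8 <;> simp [octMul, octBasis, octOne]
  have h23 : octBasis 2 ⊛ octBasis 3 = octBasis 1 := by
    apply ComplexOctonion.ext8 <;> simp [octMul, octBasis]
  have h11 : octBasis 1 ⊛ octBasis 1 = -octOne := by
    apply ComplexOctonion.ext8 <;> simp [octMul, octBasis, octOne]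
  rw [h, h7, mul_octOne, h67, octMul_neg, h51, octMul_neg, h44, neg_neg, mul_octOne, h23, h11,
    map_neg, ← octB_one, octB_one_one]
  simp

/-- Left multiplication by g x is the conjugate by `g` of left multiplication by x, and `g` fixes 1
and preserves real parts. An invariant volume form yields determinant 1 with no appeal to the
connectedness of G₂. -/
theorem octVol_map {g : ComplexOctonion ≃ₗ[ℂ] ComplexOctonion} (hg : g ∈ G2) {h : V →ₗ[ℂ] V}
    (hh : ∀ v, octEmb ι (h v) = g (octEmb ι v)) (v : Fin 7 → V) :
    octVol ι (fun i => h (v i)) = octVol ι v := by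
  rw [octVol_apply, octVol_apply]
  refine Finset.sum_congr rfl fun σ _ => ?_
  have hc : ∀ x, octMulL (g x) = LinearEquiv.conjAlgEquiv ℂ g (octMulL x) := fun x => by
    refine LinearMap.ext fun z => ?_
    obtain ⟨z, rfl⟩ := g.surjective z
    simp [LinearEquiv.conjAlgEquiv_apply, octMulL_apply, G2.map_mul _ _ hg]
  simp only [hh, hc]
  rw [show (List.ofFn fun i => LinearEquiv.conjAlgEquiv ℂ g (octMulL (octEmb ι (v (σ i))))) =
    (List.ofFn fun i => (octMulL (octEmb ι (v (σ i))))).map (LinearEquiv.conjAlgEquiv ℂ g) by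
      rw [List.map_ofFn]; rfl, ← map_list_prod]
  have h1 : g.symm octOne = octOne := by rw [LinearEquiv.symm_apply_eq, G2.map_one hg]
  simp [LinearEquiv.conjAlgEquiv_apply, h1, G2.re_map _ hg]

theorem AlternatingMap.map_linearMap_comp {ι : Type*} [Fintype ι] [DecidableEq ι]
    (b : Module.Basis ι ℂ V) (F : V [⋀^ι]→ₗ[ℂ] ℂ) (h : V →ₗ[ℂ] V) (v : ι → V) :
    F (fun i => h (v i)) = LinearMap.det h * F v := by
  rw [F.eq_smul_basis_det b, AlternatingMap.smul_apply, AlternatingMap.smul_apply, smul_eq_mul,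
    smul_eq_mul, mul_left_comm, ← b.det_comp]
  rfl

theorem AlternatingMap.det_eq_one_of_map {ι : Type*} [Fintype ι] [DecidableEq ι]
    (b : Module.Basis ι ℂ V) (F : V [⋀^ι]→ₗ[ℂ] ℂ) (h : V →ₗ[ℂ] V) (v : ι → V) (hv : F v ≠ 0)
    (hF : F (fun i => h (v i)) = F v) : LinearMap.det h = 1 := by
  rw [F.map_linearMap_comp b, ← sub_eq_zero, ← sub_one_mul] at hF
  exact sub_eq_zero.1 ((mul_eq_zero.1 hF).resolve_right hv)

theorem det_eq_one_of_mem_G2 {g : ComplexOctonion ≃ₗ[ℂ] ComplexOctonion} (hg : g ∈ G2)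
    {h : V →ₗ[ℂ] V} (hh : ∀ v, octEmb ι (h v) = g (octEmb ι v)) : LinearMap.det h = 1 :=
  AlternatingMap.det_eq_one_of_map (Module.Basis.ofEquivFun ι) (octVol ι) h _
    (octVol_basis_ne_zero ι) (octVol_map ι hg hh _)

end

end

/-! ### The stabilizer of the octonion form in SL(V) is G₂ -/

noncomputable section

local infixl:70 " ⊛ " => octMul

section

variable {V : Type*} [AddCommGroup V] [Module ℂ V] (ι : V ≃ₗ[ℂ] (Fin 7 → ℂ))

/-- The polar form of the norm on the imaginary octonions. -/
def imB : V →ₗ[ℂ] V →ₗ[ℂ] ℂ := octB.compl₁₂ (octEmb ι) (octEmb ι)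

/-- The cross product of imaginary octonions. -/
def octCross : V →ₗ[ℂ] V →ₗ[ℂ] V :=
  (octMulL.compl₁₂ (octEmb ι) (octEmb ι)).compr₂ (octProj ι)

theorem imB_apply (x y : V) : imB ι x y = octB (octEmb ι x) (octEmb ι y) := rfl

theorem octCross_apply (x y : V) :
    octCross ι x y = octProj ι (octEmb ι x ⊛ octEmb ι y) := rfl

theorem imB_comm (x y : V) : imB ι x y = imB ι y x := octB_comm _ _

theorem imB_eq_sum (x y : V) : imB ι x y = ∑ i, ι x i * ι y i := by
  rw [imB_apply, octEmb_apply ι x, map_sum, LinearMap.sum_apply]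
  exact Finset.sum_congr rfl fun i _ => by
    rw [map_smul, LinearMap.smul_apply, octB_octBasis_octEmb, smul_eq_mul]

theorem imB_nondegenerate {x : V} (h : ∀ y, imB ι x y = 0) : x = 0 := by
  apply ι.injective
  ext i
  have := h (ι.symm (Pi.single i 1))
  rw [imB_eq_sum, Finset.sum_eq_single i (fun j _ hj => by simp [hj]) (by simp)] at this
  simpa using this

theorem octB_octOne_octEmb (x : V) : octB octOne (octEmb ι x) = 0 := by
  rw [octB_comm, octB_one, octRe_octEmb]

theorem octEmb_mul_octEmb (x y : V) :
    octEmb ι x ⊛ octEmb ι y = octEmb ι (octCross ι x y) - imB ι x y • octOne := by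
  have h : octRe (octEmb ι x ⊛ octEmb ι y) = -imB ι x y := by
    rw [octRe_mul, octConj_eq_neg _ (octRe_octEmb ι x), map_neg, octB_comm, imB_apply]
  rw [octCross_apply, octEmb_octProj, h, octSMul_neg]
  abel

theorem imB_octCross (x y z : V) : imB ι (octCross ι x y) z = (octForm ι).tri x y z := by
  have h := octEmb_mul_octEmb ι x y
  rw [octForm_tri, h, map_sub, map_smul, LinearMap.sub_apply, LinearMap.smul_apply,
    octB_octOne_octEmb, smul_zero, sub_zero, imB_apply]

theorem octForm_tri_self_left (x y : V) : (octForm ι).tri x y x = 0 :=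
  (octForm ι).map_eq_zero_of_eq ![x, y, x] (i := 0) (j := 2) rfl (by decide)

theorem octProj_octOne : octProj ι octOne = 0 := by
  apply octEmb_injective ι
  rw [octEmb_octProj, ← octB_one, octB_one_one, one_smul, sub_self, map_zero]

/-- The imaginary part of x(xy) = −N(x)y. -/
theorem octCross_octCross (x y : V) :
    octCross ι x (octCross ι x y) = imB ι x y • x - imB ι x x • y := by
  have h := octMul_octMul_imag (octEmb ι y) (octRe_octEmb ι x)
  rw [octEmb_mul_octEmb, sub_eq_add_neg, octMul_add, octMul_neg, octMul_smul, mul_octOne,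
    octEmb_mul_octEmb, imB_comm ι x (octCross ι x y), imB_octCross, octForm_tri_self_left,
    octSMul_zero, sub_zero] at h
  have h' := congrArg (octProj ι) h
  rw [map_add, map_neg, map_smul, map_smul, octProj_octEmb, octProj_octEmb, octProj_octEmb,
    neg_smul, ← imB_apply] at h'
  rw [← sub_eq_add_neg, sub_eq_iff_eq_add] at h'
  rw [h']
  abel

theorem imB_octCross_octCross (x y : V) :
    imB ι (octCross ι x y) (octCross ι x y) = imB ι x x * imB ι y y - imB ι x y ^ 2 := by
  have h := octB_mul_mul (octEmb ι x) (octEmb ι y)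
  rw [octEmb_mul_octEmb] at h
  simp only [map_sub, map_smul, LinearMap.sub_apply, LinearMap.smul_apply, octB_octOne_octEmb,
    octB_comm _ octOne, octB_one_one, smul_eq_mul, ← imB_apply] at h
  linear_combination h

/-- A dimension count: if ker T lay in a line, T would map ker f, of dimension at least 3, into ker
T with kernel of dimension at most 1, which leaves room for dimension 2 only. -/
theorem exists_ker_notMem_span {V : Type*} [AddCommGroup V] [Module ℂ V] [FiniteDimensional ℂ V]
    (hV : 4 ≤ Module.finrank ℂ V) (T : V →ₗ[ℂ] V) (f : V →ₗ[ℂ] ℂ)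
    (hT : ∀ y, f y = 0 → T (T y) = 0) (x : V) : ∃ y ∉ Submodule.span ℂ {x}, T y = 0 := by
  by_contra! h
  have hker : LinearMap.ker T ≤ Submodule.span ℂ {x} := fun y hy => by
    by_contra hy'
    exact h y hy' hy
  have h1 : Module.finrank ℂ (LinearMap.ker T) ≤ 1 :=
    (Submodule.finrank_mono hker).trans (by
      simpa using finrank_span_le_card (R := ℂ) ({x} : Set V))
  have h2 := f.finrank_range_add_finrank_ker
  have h3 : Module.finrank ℂ (LinearMap.range f) ≤ 1 :=
    (Submodule.finrank_le _).trans (Module.finrank_self ℂ).le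
  have h4 := (T.domRestrict (LinearMap.ker f)).finrank_range_add_finrank_ker
  have h5 : Module.finrank ℂ (LinearMap.range (T.domRestrict (LinearMap.ker f))) ≤ 1 := by
    refine (Submodule.finrank_mono (?_ : _ ≤ LinearMap.ker T)).trans h1
    rintro _ ⟨⟨y, hy⟩, rfl⟩
    exact hT y hy
  have h6 : Module.finrank ℂ (LinearMap.ker (T.domRestrict (LinearMap.ker f))) ≤ 1 := by
    rw [← Submodule.finrank_map_subtype_eq (LinearMap.ker f)]
    refine (Submodule.finrank_mono (?_ : _ ≤ LinearMap.ker T)).trans h1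
    rintro _ ⟨y, hy, rfl⟩
    exact hy
  omega

/-- For isotropic x, the map y ↦ x × y has square zero on the orthogonal of x. With the converse
`imB_self_eq_zero`, this describes the null cone of B by the kernels of the forms ω(x, ·, ·), hence
by ω alone. -/
theorem exists_octCross_eq_zero {x : V} (hx : imB ι x x = 0) :
    ∃ y ∉ Submodule.span ℂ {x}, octCross ι x y = 0 := by
  have : FiniteDimensional ℂ V := Module.Finite.equiv ι.symm
  refine exists_ker_notMem_span (by rw [ι.finrank_eq, Module.finrank_fin_fun]; norm_num)
    (octCross ι x) (imB ι x) (fun y hy => ?_) x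
  rw [octCross_octCross, hx, hy, zero_smul, zero_smul, sub_zero]

theorem imB_self_eq_zero {x y : V} (hy : y ∉ Submodule.span ℂ {x}) (h : octCross ι x y = 0) :
    imB ι x x = 0 := by
  by_contra hx
  apply hy
  have h' := octCross_octCross ι x y
  rw [h, map_zero] at h'
  refine Submodule.mem_span_singleton.2 ⟨(imB ι x x)⁻¹ * imB ι x y, ?_⟩
  rw [mul_smul, sub_eq_zero.1 h'.symm, inv_smul_smul₀ hx]

/-- A monic complex quadratic with only one root has it as a double root, so the set of roots
determines the product of the roots. -/
theorem constant_coeff_eq_of_roots {a b a' b' : ℂ}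
    (h : ∀ t : ℂ, t ^ 2 + a * t + b = 0 ↔ t ^ 2 + a' * t + b' = 0) : b = b' := by
  have key : ∀ a b : ℂ, ∃ r s : ℂ, b = r * s ∧ ∀ t : ℂ, t ^ 2 + a * t + b = 0 ↔ t = r ∨ t = s := by
    intro a b
    obtain ⟨d, hd⟩ := IsAlgClosed.exists_pow_nat_eq (a ^ 2 - 4 * b) (n := 2) (by norm_num)
    refine ⟨(-a + d) / 2, (-a - d) / 2, by linear_combination (1 / 4) * hd, fun t => ?_⟩
    rw [← sub_eq_zero (b := (-a + d) / 2), ← sub_eq_zero (b := (-a - d) / 2), ← mul_eq_zero]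
    refine Eq.congr ?_ rfl
    linear_combination (1 / 4) * hd
  obtain ⟨r, s, hb, hr⟩ := key a b
  obtain ⟨r', s', hb', hr'⟩ := key a' b'
  have h1 := (hr' r).1 ((h r).1 ((hr r).2 (Or.inl rfl)))
  have h2 := (hr' s).1 ((h s).1 ((hr s).2 (Or.inr rfl)))
  have h3 := (hr r').1 ((h r').2 ((hr' r').2 (Or.inl rfl)))
  have h4 := (hr s').1 ((h s').2 ((hr' s').2 (Or.inr rfl)))
  rw [hb, hb']
  grind

variable {ι} {h : V ≃ₗ[ℂ] V}

theorem imB_map_self_eq_zero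
    (hω : ∀ x y z, (octForm ι).tri (h x) (h y) (h z) = (octForm ι).tri x y z)
    {x : V} (hx : imB ι x x = 0) : imB ι (h x) (h x) = 0 := by
  obtain ⟨y, hy, hxy⟩ := exists_octCross_eq_zero ι hx
  refine imB_self_eq_zero ι (y := h y) (fun hy' => hy ?_) ?_
  · obtain ⟨c, hc⟩ := Submodule.mem_span_singleton.1 hy'
    exact Submodule.mem_span_singleton.2 ⟨c, h.injective (by rw [map_smul, hc])⟩
  · refine imB_nondegenerate ι fun z => ?_
    obtain ⟨z, rfl⟩ := h.surjective z
    rw [imB_octCross, hω, ← imB_octCross, hxy, map_zero, LinearMap.zero_apply]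

theorem imB_single (i j : Fin 7) :
    imB ι (ι.symm (Pi.single i 1)) (ι.symm (Pi.single j 1)) = if i = j then 1 else 0 := by
  rw [imB_apply, octEmb_symm_single, octEmb_symm_single, octB_octBasis]
  simp

/-- Quadratic forms with the same null cone are proportional: on a line x + te with `e` anisotropic,
normalize both to monic quadratics in t and compare their constant coefficients. -/
theorem exists_imB_map_self
    (hω : ∀ x y z, (octForm ι).tri (h x) (h y) (h z) = (octForm ι).tri x y z) :
    ∃ c : ℂ, c ≠ 0 ∧ ∀ x, imB ι (h x) (h x) = c * imB ι x x := by
  have hω' : ∀ x y z, (octForm ι).tri (h.symm x) (h.symm y) (h.symm z) =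
      (octForm ι).tri x y z := fun x y z => by
    rw [← hω, h.apply_symm_apply, h.apply_symm_apply, h.apply_symm_apply]
  have hiff : ∀ x, imB ι x x = 0 ↔ imB ι (h x) (h x) = 0 := fun x =>
    ⟨imB_map_self_eq_zero hω, fun hx => by
      simpa using imB_map_self_eq_zero (h := h.symm) hω' hx⟩
  let e : V := ι.symm (Pi.single 0 1)
  have he : imB ι e e = 1 := by simp [e, imB_single]
  have hc : imB ι (h e) (h e) ≠ 0 := fun h0 => by
    rw [← hiff, he] at h0
    exact one_ne_zero h0
  refine ⟨imB ι (h e) (h e), hc, fun x => ?_⟩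
  have := constant_coeff_eq_of_roots (a := 2 * imB ι x e) (b := imB ι x x)
    (a' := 2 * imB ι (h x) (h e) / imB ι (h e) (h e))
    (b' := imB ι (h x) (h x) / imB ι (h e) (h e)) fun t => by
      have h1 := hiff (x + t • e)
      simp only [map_add, map_smul, LinearMap.add_apply, LinearMap.smul_apply, smul_eq_mul, he,
        imB_comm ι e x, imB_comm ι (h e) (h x)] at h1
      rw [show t ^ 2 + 2 * imB ι x e * t + imB ι x x =
        imB ι x x + t * imB ι x e + t * (imB ι x e + t * 1) by ring, h1,
        show t ^ 2 + 2 * imB ι (h x) (h e) / imB ι (h e) (h e) * t +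
          imB ι (h x) (h x) / imB ι (h e) (h e) = (imB ι (h x) (h x) + t * imB ι (h x) (h e) +
          t * (imB ι (h x) (h e) + t * imB ι (h e) (h e))) / imB ι (h e) (h e) by
          field_simp; ring, div_eq_zero_iff]
      simp [hc]
  rw [this, mul_div_cancel₀ _ hc]

theorem imB_map_of_self {c : ℂ} (hc : ∀ x, imB ι (h x) (h x) = c * imB ι x x) (x y : V) :
    imB ι (h x) (h y) = c * imB ι x y := by
  have h1 := hc (x + y)
  simp only [map_add, LinearMap.add_apply, hc, imB_comm ι y x, imB_comm ι (h y) (h x)] at h1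
  linear_combination (1 / 2) * h1

/-- As ω is fixed and B is multiplied by c, the cross product is multiplied by c⁻¹. The norm of the
cross product of two orthonormal vectors then gives c⁻²·c = c². -/
theorem imB_map_self_cube
    (hω : ∀ x y z, (octForm ι).tri (h x) (h y) (h z) = (octForm ι).tri x y z)
    {c : ℂ} (h0 : c ≠ 0) (hc : ∀ x, imB ι (h x) (h x) = c * imB ι x x) : c ^ 3 = 1 := by
  have hcross : ∀ x y, octCross ι (h x) (h y) = c⁻¹ • h (octCross ι x y) := fun x y => by
    rw [← sub_eq_zero]
    refine imB_nondegenerate ι fun z => ?_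
    obtain ⟨z, rfl⟩ := h.surjective z
    rw [map_sub, map_smul, LinearMap.sub_apply, LinearMap.smul_apply, imB_octCross, hω,
      imB_map_of_self hc, imB_octCross, smul_eq_mul, inv_mul_cancel_left₀ h0, sub_self]
  have h1 := imB_octCross_octCross ι (h (ι.symm (Pi.single 0 1))) (h (ι.symm (Pi.single 1 1)))
  rw [hcross, map_smul, map_smul, LinearMap.smul_apply, imB_map_of_self hc, imB_octCross_octCross,
    imB_map_of_self hc, imB_map_of_self hc, imB_map_of_self hc, imB_single, imB_single,
    imB_single] at h1
  simp only [if_true, zero_ne_one, if_false, smul_eq_mul] at h1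
  field_simp at h1
  exact h1.symm

theorem det_sq_of_imB_map {c : ℂ} (hc : ∀ x, imB ι (h x) (h x) = c * imB ι x x) :
    LinearMap.det h.toLinearMap ^ 2 = c ^ 7 := by
  let b := Module.Basis.ofEquivFun ι
  have h1 : (LinearMap.toMatrix b b h.toLinearMap).transpose * LinearMap.toMatrix b b h.toLinearMap =
      c • (1 : Matrix (Fin 7) (Fin 7) ℂ) := by
    ext i j
    have h2 := imB_map_of_self hc (ι.symm (Pi.single i 1)) (ι.symm (Pi.single j 1))
    rw [imB_single, imB_eq_sum] at h2
    simpa [Matrix.mul_apply, LinearMap.toMatrix_apply, b, Matrix.one_apply] using h2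
  have h2 := congrArg Matrix.det h1
  rw [Matrix.det_mul, Matrix.det_transpose, LinearMap.det_toMatrix, Matrix.det_smul,
    Matrix.det_one, mul_one, Fintype.card_fin] at h2
  rw [sq, h2]

theorem imB_map (hdet : LinearEquiv.det h = 1)
    (hω : ∀ x y z, (octForm ι).tri (h x) (h y) (h z) = (octForm ι).tri x y z) (x y : V) :
    imB ι (h x) (h y) = imB ι x y := by
  obtain ⟨c, h0, hc⟩ := exists_imB_map_self hω
  have h3 := imB_map_self_cube hω h0 hc
  have h7 := det_sq_of_imB_map hc
  rw [← LinearEquiv.coe_det, hdet, Units.val_one] at h7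
  -- From c³ = 1 and c⁷ = (det h)² = 1. Here the determinant excludes cube roots of unity, which as
  -- scalars also fix ω.
  rw [imB_map_of_self hc, show c = 1 by linear_combination -h7 - (c ^ 4 + c) * h3, one_mul]

theorem octCross_map (hdet : LinearEquiv.det h = 1)
    (hω : ∀ x y z, (octForm ι).tri (h x) (h y) (h z) = (octForm ι).tri x y z) (x y : V) :
    octCross ι (h x) (h y) = h (octCross ι x y) := by
  rw [← sub_eq_zero]
  refine imB_nondegenerate ι fun z => ?_
  obtain ⟨z, rfl⟩ := h.surjective z
  rw [map_sub, LinearMap.sub_apply, imB_octCross, hω, imB_map hdet hω, imB_octCross, sub_self]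

variable (ι)

/-- The endomorphism of `V` defined by an endomorphism of the octonions. -/
def octRestrict : (ComplexOctonion →ₗ[ℂ] ComplexOctonion) →ₗ[ℂ] (V →ₗ[ℂ] V) where
  toFun f := octProj ι ∘ₗ f ∘ₗ octEmb ι
  map_add' f g := by ext; simp
  map_smul' c f := by ext; simp

/-- The endomorphism of the octonions, trivial on the scalars, defined by an endomorphism
of `V`. -/
def octExtend (f : V →ₗ[ℂ] V) : ComplexOctonion →ₗ[ℂ] ComplexOctonion :=
  octRe.smulRight octOne + octEmb ι ∘ₗ f ∘ₗ octProj ι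

theorem octRestrict_apply (f : ComplexOctonion →ₗ[ℂ] ComplexOctonion) (v : V) :
    octRestrict ι f v = octProj ι (f (octEmb ι v)) := rfl

theorem octExtend_apply (f : V →ₗ[ℂ] V) (x : ComplexOctonion) :
    octExtend ι f x = octRe x • octOne + octEmb ι (f (octProj ι x)) := rfl

theorem isPolyMap_octExtend : IsPolyMap (octExtend ι) := by
  refine isPolyMap_of_octBasis fun i => ?_
  simp only [octExtend_apply]
  exact (isPolyMap_const _).add
    (isPolyMap_linear (octEmb ι ∘ₗ LinearMap.applyₗ (octProj ι (octBasis i))))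

theorem octExtend_octEmb (f : V →ₗ[ℂ] V) (v : V) :
    octExtend ι f (octEmb ι v) = octEmb ι (f v) := by
  rw [octExtend_apply, octRe_octEmb, octSMul_zero, zero_add, octProj_octEmb]

theorem octExtend_octOne (f : V →ₗ[ℂ] V) : octExtend ι f octOne = octOne := by
  rw [octExtend_apply, octProj_octOne, map_zero, map_zero, add_zero, ← octB_one, octB_one_one,
    one_smul]

theorem eq_octRe_add_octEmb (x : ComplexOctonion) :
    x = octRe x • octOne + octEmb ι (octProj ι x) := by
  rw [octEmb_octProj, add_sub_cancel]

/-- The product of imaginary octonions is x × y − B(x, y), and both terms are preserved. -/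
theorem octExtend_mul (hdet : LinearEquiv.det h = 1)
    (hω : ∀ x y z, (octForm ι).tri (h x) (h y) (h z) = (octForm ι).tri x y z)
    (x y : ComplexOctonion) :
    octExtend ι h.toLinearMap (x ⊛ y) = octExtend ι h.toLinearMap x ⊛ octExtend ι h.toLinearMap y := by
  rw [eq_octRe_add_octEmb ι x, eq_octRe_add_octEmb ι y]
  generalize octRe x = a, octProj ι x = u, octRe y = b, octProj ι y = v
  simp only [add_octMul, octMul_add, smul_octMul, octMul_smul, octOne_mul, mul_octOne, map_add,
    map_smul, octExtend_octOne, octExtend_octEmb, octEmb_mul_octEmb, map_sub, LinearEquiv.coe_coe,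
    octCross_map hdet hω, imB_map hdet hω]

theorem octEmb_octRestrict {g : ComplexOctonion ≃ₗ[ℂ] ComplexOctonion} (hg : g ∈ G2) (v : V) :
    octEmb ι (octRestrict ι g.toLinearMap v) = g (octEmb ι v) := by
  rw [octRestrict_apply, octEmb_octProj_of_re]
  · rfl
  · exact (G2.re_map _ hg).trans (octRe_octEmb ι v)

/-- The action of `G₂` on `V`. -/
def G2.act (g : G2) : V ≃ₗ[ℂ] V :=
  LinearEquiv.ofLinearMap (octRestrict ι g.1.toLinearMap) (octRestrict ι g.1.symm.toLinearMap)
    (by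
      refine LinearMap.ext fun v => octEmb_injective ι ?_
      rw [LinearMap.comp_apply, octEmb_octRestrict ι g.2]
      have := octEmb_octRestrict ι (G2.inv_mem g.2) v
      exact (congrArg g.1 this).trans (g.1.apply_symm_apply _))
    (by
      refine LinearMap.ext fun v => octEmb_injective ι ?_
      have := octEmb_octRestrict ι (G2.inv_mem g.2) (octRestrict ι g.1.toLinearMap v)
      refine this.trans ?_
      rw [octEmb_octRestrict ι g.2]
      exact g.1.symm_apply_apply _)

theorem octEmb_act (g : G2) (v : V) : octEmb ι (G2.act ι g v) = g.1 (octEmb ι v) :=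
  octEmb_octRestrict ι g.2 v

theorem G2.act_mem (g : G2) : G2.act ι g ∈ slStabilizer (octForm ι) := by
  constructor
  · refine Units.ext ?_
    rw [LinearEquiv.coe_det]
    exact det_eq_one_of_mem_G2 ι g.2 fun v => octEmb_act ι g v
  · ext v
    rw [AlternatingMap.compLinearMap_apply, octForm_apply, octForm_apply]
    simp only [LinearEquiv.coe_coe, octEmb_act]
    rw [← G2.map_mul _ _ g.2, G2.octB_map _ _ g.2]

theorem slStabilizer.tri_map {ω : V [⋀^Fin 3]→ₗ[ℂ] ℂ} (h : slStabilizer ω) (x y z : V) :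
    ω.tri (h.1 x) (h.1 y) (h.1 z) = ω.tri x y z := by
  have := congrArg (fun η => η ![x, y, z]) h.2.2
  rw [AlternatingMap.tri_apply, AlternatingMap.tri_apply, ← this]
  change _ = ω fun i => h.1 (![x, y, z] i)
  congr 1
  funext i
  fin_cases i <;> rfl

theorem octExtend_octExtend {f g : V →ₗ[ℂ] V} (hfg : ∀ v, f (g v) = v) :
    octExtend ι f ∘ₗ octExtend ι g = LinearMap.id := by
  refine LinearMap.ext fun x => ?_
  rw [LinearMap.comp_apply, octExtend_apply ι g, map_add, map_smul, octExtend_octOne,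
    octExtend_octEmb, hfg, ← eq_octRe_add_octEmb, LinearMap.id_apply]

/-- The automorphism of the octonions defined by an element of the stabilizer of the form. -/
def slStabilizer.extend (h : slStabilizer (octForm ι)) : G2 :=
  ⟨LinearEquiv.ofLinearMap (octExtend ι h.1.toLinearMap) (octExtend ι h.1.symm.toLinearMap)
    (octExtend_octExtend ι h.1.apply_symm_apply) (octExtend_octExtend ι h.1.symm_apply_apply),
    octExtend_mul ι h.2.1 (slStabilizer.tri_map h)⟩

/-- `G₂` is the stabilizer of the form `octForm ι` in `SL(V)`. -/
def G2.equivStabilizer : G2 ≃* slStabilizer (octForm ι) where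
  toFun g := ⟨G2.act ι g, G2.act_mem ι g⟩
  invFun := slStabilizer.extend ι
  left_inv g := by
    refine Subtype.ext (LinearEquiv.ext fun x => ?_)
    change octExtend ι _ x = _
    rw [octExtend_apply]
    conv_rhs => rw [eq_octRe_add_octEmb ι x, map_add, map_smul, G2.map_one g.2]
    exact congrArg _ (octEmb_act ι g _)
  right_inv h := by
    refine Subtype.ext (LinearEquiv.ext fun v => octEmb_injective ι ?_)
    rw [octEmb_act]
    exact octExtend_octEmb ι h.1.toLinearMap v
  map_mul' g g' := by
    refine Subtype.ext (LinearEquiv.ext fun v => octEmb_injective ι ?_)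
    change octEmb ι (G2.act ι (g * g') v) = octEmb ι (G2.act ι g (G2.act ι g' v))
    rw [octEmb_act, octEmb_act, octEmb_act]
    rfl

theorem G2.isIsomorphism_equivStabilizer :
    (linGroupVar G2).IsIsomorphism (linGroupVar (slStabilizer (octForm ι)))
      (G2.equivStabilizer ι).toEquiv := by
  constructor
  · refine SpaceWithFunctions.IsMorphism.induced
      (Φ := (octRestrict ι).prodMap (octRestrict ι)) (isPolyMap_linear _).isMorphism fun g => ?_
    refine Prod.ext ?_ ?_ <;> exact LinearMap.ext fun v => rfl
  · refine SpaceWithFunctions.IsMorphism.induced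
      (Φ := fun p => (octExtend ι p.1, octExtend ι p.2)) (IsPolyMap.isMorphism ?_) fun g => ?_
    · exact IsPolyMap.prodMk
        ((isPolyMap_octExtend ι).comp (isPolyMap_linear (LinearMap.fst ℂ (V →ₗ[ℂ] V) (V →ₗ[ℂ] V))))
        ((isPolyMap_octExtend ι).comp (isPolyMap_linear (LinearMap.snd ℂ (V →ₗ[ℂ] V) (V →ₗ[ℂ] V))))
    · refine Prod.ext ?_ ?_ <;> exact LinearMap.ext fun v => rfl

end

end

/-! ### Dominant polynomial maps -/

noncomputable section

section

theorem eval_mem_polyFun {σ : Type*} (P : MvPolynomial σ ℂ) :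
    (fun x => MvPolynomial.eval x P) ∈ polyFun (σ → ℂ) := by
  induction P using MvPolynomial.induction_on with
  | C a => simpa using polyFun_const a
  | add p q hp hq => simp only [map_add]; exact (polyFun _).add_mem hp hq
  | mul_X p i hp =>
    simp only [map_mul, MvPolynomial.eval_X]
    exact (polyFun _).mul_mem hp
      (isPolyMap_apply (F := ℂ) i).mem_polyFun

variable {σ τ : Type*} [Finite σ] [Finite τ]

/-- A dominant polynomial map maps a nonempty basic open set onto a set that contains a nonempty
basic open set. -/
theorem MvPolynomial.exists_forall_exists_eval_eq {F : τ → MvPolynomial σ ℂ}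
    (hF : Function.Injective (MvPolynomial.aeval (R := ℂ) F)) {d : MvPolynomial σ ℂ} (hd : d ≠ 0) :
    ∃ a : MvPolynomial τ ℂ, a ≠ 0 ∧ ∀ y : τ → ℂ, MvPolynomial.eval y a ≠ 0 →
      ∃ x : σ → ℂ, MvPolynomial.eval x d ≠ 0 ∧ ∀ i, MvPolynomial.eval x (F i) = y i := by
  let f : MvPolynomial τ ℂ →+* MvPolynomial σ ℂ := (MvPolynomial.aeval (R := ℂ) F).toRingHom
  have hf : f.FinitePresentation := by
    refine RingHom.FinitePresentation.of_finiteType.1 ?_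
    refine RingHom.FiniteType.of_comp_finiteType (f := MvPolynomial.C) ?_
    have : f.comp MvPolynomial.C = algebraMap ℂ (MvPolynomial σ ℂ) := by
      ext; simp [f]
    rw [this, RingHom.finiteType_algebraMap]
    infer_instance
  -- Chevalley's theorem: the image of the locus d ≠ 0 is constructible. By injectivity on
  -- polynomials it contains the generic point.
  have hS := PrimeSpectrum.isConstructible_comap_image hf
    (PrimeSpectrum.isConstructible_basicOpen (f := d))
  obtain ⟨S, hS⟩ := PrimeSpectrum.exists_constructibleSetData_iff.2 hS
  have hbot : (⊥ : PrimeSpectrum (MvPolynomial τ ℂ)) ∈ S.toSet := by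
    rw [hS]
    refine ⟨⊥, ?_, ?_⟩
    · simpa [PrimeSpectrum.mem_basicOpen] using hd
    · refine PrimeSpectrum.ext ?_
      change Ideal.comap f ⊥ = ⊥
      exact (RingHom.injective_iff_ker_eq_bot f).1 hF
  obtain ⟨C, hC, hbot⟩ := Set.mem_iUnion₂.1 hbot
  -- A piece of a constructible set that contains the generic point satisfies no nontrivial closed
  -- condition, so it is the basic open set of `C.f`.
  have hg : ∀ i, C.g i = 0 := fun i => hbot.1 ⟨i, rfl⟩
  refine ⟨C.f, fun h => hbot.2 (by simp [h]), fun y hy => ?_⟩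
  let P : PrimeSpectrum (MvPolynomial τ ℂ) :=
    ⟨RingHom.ker (MvPolynomial.eval y), RingHom.ker_isPrime _⟩
  have hP : P ∈ S.toSet := Set.mem_iUnion₂.2 ⟨C, hC, by
    rintro _ ⟨i, rfl⟩
    rw [hg]
    exact P.asIdeal.zero_mem, fun h => hy (h rfl)⟩
  rw [hS] at hP
  obtain ⟨p, hp, hpP⟩ := hP
  have := p.isPrime
  -- The prime `p` over `y` need not be maximal; the Nullstellensatz supplies a closed point of its
  -- zero locus with d ≠ 0. It still lies over `y`, because the polynomials Xᵢ − yᵢ map into `p`.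
  have hd' : d ∉ MvPolynomial.vanishingIdeal ℂ (MvPolynomial.zeroLocus ℂ p.asIdeal) := by
    rwa [MvPolynomial.IsPrime.vanishingIdeal_zeroLocus]
  rw [MvPolynomial.mem_vanishingIdeal_iff] at hd'
  push Not at hd'
  obtain ⟨x, hx, hdx⟩ := hd'
  refine ⟨x, hdx, fun i => ?_⟩
  have h1 : MvPolynomial.X i - MvPolynomial.C (y i) ∈ P.asIdeal := by
    change MvPolynomial.eval y _ = 0
    simp
  rw [← hpP] at h1
  have h2 := hx _ h1
  simpa [f, sub_eq_zero] using h2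

theorem exists_mvPolynomial_of_mem_polyFun {p : (σ → ℂ) → ℂ} (hp : p ∈ polyFun (σ → ℂ)) :
    ∃ P : MvPolynomial σ ℂ, ∀ x, p x = MvPolynomial.eval x P := by
  cases nonempty_fintype σ
  classical
  induction hp using polyFun_induction with
  | dual ℓ =>
    refine ⟨∑ i, MvPolynomial.C (ℓ fun j => if i = j then 1 else 0) * MvPolynomial.X i,
      fun x => ?_⟩
    simp [LinearMap.pi_apply_eq_sum_univ ℓ x, mul_comm]
  | const c => exact ⟨MvPolynomial.C c, fun x => by simp⟩
  | add f g _ _ hf hg =>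
    obtain ⟨P, hP⟩ := hf
    obtain ⟨Q, hQ⟩ := hg
    exact ⟨P + Q, fun x => by simp [hP, hQ]⟩
  | mul f g _ _ hf hg =>
    obtain ⟨P, hP⟩ := hf
    obtain ⟨Q, hQ⟩ := hg
    exact ⟨P * Q, fun x => by simp [hP, hQ]⟩

/-- A polynomial map that is submersive at one point is open there in the classical topology. A
relation between its components would vanish on a neighbourhood, hence identically, as seen on lines
through the image point. -/
theorem aeval_injective_of_surjective_deriv {F : τ → MvPolynomial σ ℂ} (x : σ → ℂ)
    (h : ∀ y : τ → ℂ, ∃ v : σ → ℂ, ∀ i,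
      HasDerivAt (fun t : ℂ => MvPolynomial.eval (x + t • v) (F i)) (y i) 0) :
    Function.Injective (MvPolynomial.aeval (R := ℂ) F) := by
  cases nonempty_fintype σ
  cases nonempty_fintype τ
  let Φ : (σ → ℂ) → (τ → ℂ) := fun x i => MvPolynomial.eval x (F i)
  have hΦ : ContDiff ℂ 1 Φ := contDiff_pi.2 fun i => by
    have : ∀ P : MvPolynomial σ ℂ, ContDiff ℂ 1 fun x : σ → ℂ => MvPolynomial.eval x P := by
      intro P
      induction P using MvPolynomial.induction_on with
      | C a => simpa using contDiff_const
      | add p q hp hq => simpa using hp.add hq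
      | mul_X p i hp => simpa using hp.mul (contDiff_apply ℂ ℂ i)
    exact this (F i)
  have hs := hΦ.contDiffAt.hasStrictFDerivAt (x := x) (by norm_num)
  have hsurj : (fderiv ℂ Φ x).range = ⊤ := by
    refine LinearMap.range_eq_top.2 fun y => ?_
    obtain ⟨v, hv⟩ := h y
    refine ⟨v, ?_⟩
    have h1 : HasDerivAt (fun t : ℂ => Φ (x + t • v)) (fderiv ℂ Φ x v) 0 := by
      have h2 : HasDerivAt (fun t : ℂ => x + t • v) v 0 := by
        simpa using ((hasDerivAt_id (0 : ℂ)).smul_const v).const_add x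
      refine HasFDerivAt.comp_hasDerivAt (0 : ℂ) (l := Φ) (l' := fderiv ℂ Φ x) ?_ h2
      rw [zero_smul, add_zero]
      exact hs.hasFDerivAt
    exact h1.unique (hasDerivAt_pi.2 hv)
  have hn := hs.map_nhds_eq_of_surj hsurj
  rw [injective_iff_map_eq_zero]
  intro P hP
  have hP' : ∀ x, MvPolynomial.eval (Φ x) P = 0 := fun x => by
    have h1 : (MvPolynomial.aeval (Φ x) : MvPolynomial τ ℂ →ₐ[ℂ] ℂ) =
        (MvPolynomial.aeval x).comp (MvPolynomial.aeval F) := by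
      ext i
      simp [Φ, MvPolynomial.aeval_eq_eval]
    have h2 := congrArg (fun f => f P) h1
    rw [AlgHom.comp_apply, hP, map_zero] at h2
    exact h2
  have hev : ∀ᶠ y in 𝓝 (Φ x), MvPolynomial.eval y P = 0 := by
    rw [← hn]
    exact Filter.eventually_map.2 (Filter.Eventually.of_forall hP')
  refine MvPolynomial.funext fun y => ?_
  have hc : Filter.Tendsto (fun t : ℂ => Φ x + t • (y - Φ x)) (𝓝 0) (𝓝 (Φ x)) := by
    have : Continuous fun t : ℂ => Φ x + t • (y - Φ x) := by fun_prop
    simpa using this.tendsto 0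
  have hinf : {t : ℂ | MvPolynomial.eval (Φ x + t • (y - Φ x)) P = 0}.Infinite :=
    infinite_of_mem_nhds (0 : ℂ) (hc hev)
  simpa using polyFun_eq_zero_of_line (eval_mem_polyFun P) (Φ x) (y - Φ x) hinf 1

end

end

/-! ### Genericity of the octonion form -/

noncomputable section

/-- `L` stands for a functional on three-forms, given by its values on coordinate forms. The
condition for (a, b) says that it kills the form obtained by letting `a` replace `b` in the seven
terms of the octonion form: 49 linear equations for 35 unknowns. -/
theorem eq_zero_of_fano {L : Fin 7 → Fin 7 → Fin 7 → ℂ} (h1 : ∀ i j k, L i j k = -L j i k)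
    (h2 : ∀ i j k, L i j k = -L i k j)
    (h : ∀ a b : Fin 7,
      let D := fun i j k => (if i = b then L a j k else 0) + (if j = b then L i a k else 0) +
        (if k = b then L i j a else 0)
      D 0 1 2 + D 0 3 4 + D 1 3 5 + D 2 3 6 - D 0 5 6 + D 1 4 6 - D 2 4 5 = 0)
    {i j k : Fin 7} (hij : i < j) (hjk : j < k) : L i j k = 0 := by
  have h0 : ∀ i k, L i i k = 0 := fun i k => by linear_combination (1 / 2) * h1 i i k
  have h0' : ∀ i k, L i k k = 0 := fun i k => by linear_combination (1 / 2) * h2 i k k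
  -- Swaps are only allowed at descents, so that `simp` sorts the indices and terminates.
  have h1' : ∀ i j k, j < i → L i j k = -L j i k := fun i j k _ => h1 i j k
  have h2' : ∀ i j k, k < j → L i j k = -L i k j := fun i j k _ => h2 i j k
  clear h1 h2
  simp [Fin.forall_fin_succ, h0, h0', h1', h2'] at h
  clear h0 h0' h1' h2'
  fin_cases i <;> fin_cases j <;> first
    | exact absurd hij (by decide)
    | (fin_cases k <;> first
        | exact absurd hjk (by decide)
        | (clear hij hjk; simp; grind))

section

variable {V : Type*} [AddCommGroup V] [Module ℂ V]

/-- The derivative at the identity of `f ↦ ω.compLinearMap f`. -/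
def formDeriv (ω : V [⋀^Fin 3]→ₗ[ℂ] ℂ) (f : V →ₗ[ℂ] V) : V [⋀^Fin 3]→ₗ[ℂ] ℂ :=
  (2⁻¹ : ℂ) • (ω.compLinearMap (LinearMap.id + f) - ω.compLinearMap (LinearMap.id - f)) -
    ω.compLinearMap f

/-- The second order term of `f ↦ ω.compLinearMap f` at the identity. -/
def formDeriv₂ (ω : V [⋀^Fin 3]→ₗ[ℂ] ℂ) (f : V →ₗ[ℂ] V) : V [⋀^Fin 3]→ₗ[ℂ] ℂ :=
  (2⁻¹ : ℂ) • (ω.compLinearMap (LinearMap.id + f) + ω.compLinearMap (LinearMap.id - f)) - ω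

theorem AlternatingMap.compLinearMap_apply_tri (ω : V [⋀^Fin 3]→ₗ[ℂ] ℂ) (f : V →ₗ[ℂ] V)
    (v : Fin 3 → V) : ω.compLinearMap f v = ω.tri (f (v 0)) (f (v 1)) (f (v 2)) := ω.tri_eq _

/-- Half the difference of ω ∘ (1 + f) and ω ∘ (1 − f) is the sum of the linear and cubic terms in
f, and the definition subtracts the cubic one. In this form the derivative is visibly alternating.
-/
theorem formDeriv_apply (ω : V [⋀^Fin 3]→ₗ[ℂ] ℂ) (f : V →ₗ[ℂ] V) (v : Fin 3 → V) :
    formDeriv ω f v = ω.tri (f (v 0)) (v 1) (v 2) + ω.tri (v 0) (f (v 1)) (v 2) +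
      ω.tri (v 0) (v 1) (f (v 2)) := by
  simp only [formDeriv, AlternatingMap.sub_apply, AlternatingMap.smul_apply,
    AlternatingMap.compLinearMap_apply_tri, LinearMap.add_apply, LinearMap.sub_apply,
    LinearMap.id_apply, map_add, map_sub, smul_eq_mul]
  ring

theorem compLinearMap_id_add_smul (ω : V [⋀^Fin 3]→ₗ[ℂ] ℂ) (f : V →ₗ[ℂ] V) (t : ℂ) :
    ω.compLinearMap (LinearMap.id + t • f) =
      ω + t • formDeriv ω f + t ^ 2 • formDeriv₂ ω f + t ^ 3 • ω.compLinearMap f := by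
  ext v
  simp only [formDeriv₂, AlternatingMap.sub_apply, AlternatingMap.add_apply,
    AlternatingMap.smul_apply, AlternatingMap.compLinearMap_apply_tri, LinearMap.add_apply,
    LinearMap.sub_apply, LinearMap.smul_apply, LinearMap.id_apply, map_add, map_sub, map_smul,
    smul_eq_mul, formDeriv_apply, ω.tri_eq v]
  ring

/-- `formDeriv` as a linear map. -/
def formDerivₗ (ω : V [⋀^Fin 3]→ₗ[ℂ] ℂ) : (V →ₗ[ℂ] V) →ₗ[ℂ] V [⋀^Fin 3]→ₗ[ℂ] ℂ where
  toFun := formDeriv ω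
  map_add' f g := by
    ext v
    simp only [AlternatingMap.add_apply, formDeriv_apply, LinearMap.add_apply, map_add]
    ring
  map_smul' c f := by
    ext v
    simp only [AlternatingMap.smul_apply, formDeriv_apply, LinearMap.smul_apply, map_smul,
      smul_eq_mul, RingHom.id_apply]
    ring

theorem formDeriv_add (ω η : V [⋀^Fin 3]→ₗ[ℂ] ℂ) (f : V →ₗ[ℂ] V) :
    formDeriv (ω + η) f = formDeriv ω f + formDeriv η f := by
  ext v
  simp only [AlternatingMap.add_apply, formDeriv_apply, AlternatingMap.tri_apply]
  ring

theorem formDeriv_sub (ω η : V [⋀^Fin 3]→ₗ[ℂ] ℂ) (f : V →ₗ[ℂ] V) :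
    formDeriv (ω - η) f = formDeriv ω f - formDeriv η f := by
  ext v
  simp only [AlternatingMap.sub_apply, formDeriv_apply, AlternatingMap.tri_apply]
  ring

variable (ι : V ≃ₗ[ℂ] (Fin 7 → ℂ))

theorem coordForm_apply (i j k : Fin 7) (v : Fin 3 → V) :
    coordForm ι i j k v = ι (v 0) i * ι (v 1) j * ι (v 2) k - ι (v 0) i * ι (v 1) k * ι (v 2) j
      - ι (v 0) j * ι (v 1) i * ι (v 2) k + ι (v 0) j * ι (v 1) k * ι (v 2) i
      + ι (v 0) k * ι (v 1) i * ι (v 2) j - ι (v 0) k * ι (v 1) j * ι (v 2) i := by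
  rw [coordForm, detForm_apply_three]
  simp

theorem formDeriv_coordForm (i j k a b : Fin 7) :
    formDeriv (coordForm ι i j k) (LinearMap.smulRight (LinearMap.proj a ∘ₗ ι.toLinearMap)
      (ι.symm (Pi.single b 1))) = (if i = b then coordForm ι a j k else 0) +
      (if j = b then coordForm ι i a k else 0) + (if k = b then coordForm ι i j a else 0) := by
  have h : ∀ (c : Fin 7) (η : V [⋀^Fin 3]→ₗ[ℂ] ℂ) (v : Fin 3 → V), (if c = b then η else 0) v =
    (if c = b then 1 else 0) * η v := fun c η v => by split_ifs <;> simp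
  have h' : ∀ (c : Fin 7) (v : V), ι (LinearMap.smulRight (LinearMap.proj a ∘ₗ ι.toLinearMap)
      (ι.symm (Pi.single b 1)) v) c = (if c = b then 1 else 0) * ι v a := fun c v => by
    simp [Pi.single_apply]
  ext v
  simp only [AlternatingMap.add_apply, h, formDeriv_apply, AlternatingMap.tri_apply,
    coordForm_apply, Matrix.cons_val_zero, Matrix.cons_val_one, Matrix.cons_val, h']
  ring

theorem AlternatingMap.tri_swap_left (ω : V [⋀^Fin 3]→ₗ[ℂ] ℂ) (x y z : V) :
    ω.tri x y z = -ω.tri y x z := by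
  have h0 : ∀ x z, ω.tri x x z = 0 := fun x z =>
    ω.map_eq_zero_of_eq ![x, x, z] (i := 0) (j := 1) rfl (by decide)
  have h := h0 (x + y) z
  simp only [map_add, LinearMap.add_apply, h0] at h
  linear_combination h

theorem AlternatingMap.tri_eq_sum (η : V [⋀^Fin 3]→ₗ[ℂ] ℂ) (x y z : V) :
    η.tri x y z = ∑ i, ∑ j, ∑ k, η.tri (ι.symm (Pi.single i 1)) (ι.symm (Pi.single j 1))
      (ι.symm (Pi.single k 1)) * (ι x i * ι y j * ι z k) := by
  have hx : ∀ x : V, x = ∑ i, ι x i • ι.symm (Pi.single i 1) := fun x => by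
    apply ι.injective
    ext i
    simp [Pi.single_apply]
  have h1 : ∀ f : V →ₗ[ℂ] ℂ, ∀ x : V, f x = ∑ i, ι x i * f (ι.symm (Pi.single i 1)) := by
    intro f x
    conv_lhs => rw [hx x]
    simp
  have h2 : ∀ y z, η.tri x y z = ∑ i, ι x i * η.tri (ι.symm (Pi.single i 1)) y z := fun y z =>
    h1 ((η.tri.flip y).flip z) x
  have h3 : ∀ x y z, η.tri x y z = ∑ i, ι y i * η.tri x (ι.symm (Pi.single i 1)) z :=
    fun x y z => h1 ((η.tri x).flip z) y
  rw [h2]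
  refine Finset.sum_congr rfl fun i _ => ?_
  rw [h3, Finset.mul_sum]
  refine Finset.sum_congr rfl fun j _ => ?_
  rw [h1 (η.tri _ _) z, Finset.mul_sum, Finset.mul_sum]
  exact Finset.sum_congr rfl fun k _ => by ring

/-- Evaluation of three-forms. -/
def evalForm (v : Fin 3 → V) : (V [⋀^Fin 3]→ₗ[ℂ] ℂ) →ₗ[ℂ] ℂ where
  toFun η := η v
  map_add' _ _ := rfl
  map_smul' _ _ := rfl

theorem evalForm_apply (v : Fin 3 → V) (η : V [⋀^Fin 3]→ₗ[ℂ] ℂ) : evalForm v η = η v := rfl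

/-- The sum runs over all triples of indices rather than increasing ones; every set of three indices
contributes six equal terms, whence the factor 6⁻¹. -/
theorem AlternatingMap.eq_sum_coordForm (η : V [⋀^Fin 3]→ₗ[ℂ] ℂ) :
    η = (6⁻¹ : ℂ) • ∑ i, ∑ j, ∑ k, η.tri (ι.symm (Pi.single i 1)) (ι.symm (Pi.single j 1))
      (ι.symm (Pi.single k 1)) • coordForm ι i j k := by
  ext v
  rw [← evalForm_apply v, ← evalForm_apply v, map_smul]
  simp only [map_sum, map_smul, evalForm_apply, coordForm_apply, smul_eq_mul, mul_add, mul_sub,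
    Finset.sum_add_distrib, Finset.sum_sub_distrib]
  have h0 := η.tri_eq_sum ι (v 0) (v 1) (v 2)
  have h1 := η.tri_eq_sum ι (v 0) (v 2) (v 1)
  have h2 := η.tri_eq_sum ι (v 1) (v 0) (v 2)
  have h3 := η.tri_eq_sum ι (v 1) (v 2) (v 0)
  have h4 := η.tri_eq_sum ι (v 2) (v 0) (v 1)
  have h5 := η.tri_eq_sum ι (v 2) (v 1) (v 0)
  have hc : ∀ F G : Fin 7 → Fin 7 → Fin 7 → ℂ, (∀ i j k, F i j k = G i j k) →
      ∑ i, ∑ j, ∑ k, F i j k = ∑ i, ∑ j, ∑ k, G i j k := fun F G h => by simp only [h]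
  have s0 : ∑ i, ∑ j, ∑ k, η.tri (ι.symm (Pi.single i 1)) (ι.symm (Pi.single j 1))
      (ι.symm (Pi.single k 1)) * (ι (v 0) i * ι (v 1) k * ι (v 2) j) = η.tri (v 0) (v 2) (v 1) :=
    (hc _ _ fun i j k => by ring).trans h1.symm
  have s1 : ∑ i, ∑ j, ∑ k, η.tri (ι.symm (Pi.single i 1)) (ι.symm (Pi.single j 1))
      (ι.symm (Pi.single k 1)) * (ι (v 0) j * ι (v 1) i * ι (v 2) k) = η.tri (v 1) (v 0) (v 2) :=
    (hc _ _ fun i j k => by ring).trans h2.symm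
  have s2 : ∑ i, ∑ j, ∑ k, η.tri (ι.symm (Pi.single i 1)) (ι.symm (Pi.single j 1))
      (ι.symm (Pi.single k 1)) * (ι (v 0) j * ι (v 1) k * ι (v 2) i) = η.tri (v 2) (v 0) (v 1) :=
    (hc _ _ fun i j k => by ring).trans h4.symm
  have s3 : ∑ i, ∑ j, ∑ k, η.tri (ι.symm (Pi.single i 1)) (ι.symm (Pi.single j 1))
      (ι.symm (Pi.single k 1)) * (ι (v 0) k * ι (v 1) i * ι (v 2) j) = η.tri (v 1) (v 2) (v 0) :=
    (hc _ _ fun i j k => by ring).trans h3.symm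
  have s4 : ∑ i, ∑ j, ∑ k, η.tri (ι.symm (Pi.single i 1)) (ι.symm (Pi.single j 1))
      (ι.symm (Pi.single k 1)) * (ι (v 0) k * ι (v 1) j * ι (v 2) i) = η.tri (v 2) (v 1) (v 0) :=
    (hc _ _ fun i j k => by ring).trans h5.symm
  rw [← h0, s0, s1, s2, s3, s4, η.tri_eq]
  have a1 := η.tri_swap (v 0) (v 1) (v 2)
  have a2 := η.tri_swap_left (v 0) (v 1) (v 2)
  have a3 := η.tri_swap_left (v 0) (v 2) (v 1)
  have a4 := η.tri_swap (v 1) (v 0) (v 2)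
  have a5 := η.tri_swap (v 2) (v 1) (v 0)
  linear_combination (1 / 6) * a5 - (1 / 3) * a3 + (1 / 2) * a1 - (1 / 6) * a4 + (1 / 3) * a2

/-- The tangent space to the orbit is everything: a functional that kills the range satisfies the
equations of `eq_zero_of_fano`, tested on the endomorphisms v ↦ vₐ e_b. -/
theorem formDerivₗ_range : LinearMap.range (formDerivₗ (octForm ι)) = ⊤ := by
  by_contra hR
  obtain ⟨f, hf, hR⟩ := Submodule.exists_le_ker_of_lt_top _ (lt_top_iff_ne_top.2 hR)
  have hX : ∀ X, f (formDeriv (octForm ι) X) = 0 := fun X => hR ⟨X, rfl⟩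
  have hs1 : ∀ i j k, coordForm ι i j k = -coordForm ι j i k := fun i j k => by
    ext v
    rw [AlternatingMap.neg_apply, coordForm_apply, coordForm_apply]
    ring
  have hs2 : ∀ i j k, coordForm ι i j k = -coordForm ι i k j := fun i j k => by
    ext v
    rw [AlternatingMap.neg_apply, coordForm_apply, coordForm_apply]
    ring
  have h1 : ∀ i j k, f (coordForm ι i j k) = -f (coordForm ι j i k) := fun i j k => by
    rw [hs1, map_neg]
  have h2 : ∀ i j k, f (coordForm ι i j k) = -f (coordForm ι i k j) := fun i j k => by
    rw [hs2, map_neg]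
  have h0 : ∀ i k, f (coordForm ι i i k) = 0 := fun i k => by
    linear_combination (1 / 2) * h1 i i k
  have h0' : ∀ i k, f (coordForm ι i k k) = 0 := fun i k => by
    linear_combination (1 / 2) * h2 i k k
  have hlt : ∀ {i j k}, i < j → j < k → f (coordForm ι i j k) = 0 := by
    intro i j k hij hjk
    refine eq_zero_of_fano (L := fun i j k => f (coordForm ι i j k)) h1 h2 (fun a b => ?_) hij hjk
    have hab := hX (LinearMap.smulRight (LinearMap.proj a ∘ₗ ι.toLinearMap)
      (ι.symm (Pi.single b 1)))
    have hite : ∀ (c : Fin 7) (η : V [⋀^Fin 3]→ₗ[ℂ] ℂ), f (if c = b then η else 0) =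
      if c = b then f η else 0 := fun c η => by split_ifs <;> simp
    simp only [octForm, formDeriv_add, formDeriv_sub, formDeriv_coordForm, map_add, map_sub,
      hite] at hab
    exact hab
  have hall : ∀ i j k, f (coordForm ι i j k) = 0 := by
    intro i j k
    rcases eq_or_ne i j with rfl | hij
    · exact h0 _ _
    rcases eq_or_ne j k with rfl | hjk
    · exact h0' _ _
    rcases eq_or_ne i k with rfl | hik
    · rw [h1, h0', neg_zero]
    rcases lt_or_gt_of_ne hij with hij | hij <;> rcases lt_or_gt_of_ne hjk with hjk | hjk <;>
      rcases lt_or_gt_of_ne hik with hik | hik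
    · exact hlt hij hjk
    · exact absurd (hij.trans hjk) hik.asymm
    · rw [h2, hlt hik hjk, neg_zero]
    · rw [h2, h1, hlt hik hij, neg_zero, neg_zero]
    · rw [h1, hlt hij hik, neg_zero]
    · rw [h1, h2, hlt hjk hik, neg_zero, neg_zero]
    · exact absurd (hjk.trans hij) hik.asymm
    · rw [h1, h2, h1, hlt hjk hij, neg_zero, neg_zero, neg_zero]
  refine hf (LinearMap.ext fun η => ?_)
  rw [η.eq_sum_coordForm ι]
  simp [hall]

instance [FiniteDimensional ℂ V] : FiniteDimensional ℂ (V [⋀^Fin 3]→ₗ[ℂ] ℂ) :=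
  Module.Finite.of_injective (AlternatingMap.toMultilinearMapLM (S := ℂ))
    AlternatingMap.coe_multilinearMap_injective

theorem isPolyMap_compLinearMap (ι : V ≃ₗ[ℂ] (Fin 7 → ℂ)) (ω : V [⋀^Fin 3]→ₗ[ℂ] ℂ) :
    IsPolyMap fun f : V →ₗ[ℂ] V => ω.compLinearMap f := by
  have : FiniteDimensional ℂ V := Module.Finite.equiv ι.symm
  have h : (fun f : V →ₗ[ℂ] V => ω.compLinearMap f) = fun f => ∑ i, ∑ j, ∑ k,
      (6⁻¹ * (ω.compLinearMap f).tri (ι.symm (Pi.single i 1)) (ι.symm (Pi.single j 1))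
      (ι.symm (Pi.single k 1))) • coordForm ι i j k := by
    funext f
    conv_lhs => rw [(ω.compLinearMap f).eq_sum_coordForm ι]
    simp only [Finset.smul_sum, smul_smul]
  rw [h]
  refine IsPolyMap.sum _ fun i _ => IsPolyMap.sum _ fun j _ => IsPolyMap.sum _ fun k _ =>
    IsPolyMap.smul ((polyFun _).mul_mem (polyFun_const _) ?_) (isPolyMap_const _)
  exact (IsPolyMap.alternating ω fun l => isPolyMap_linear (LinearMap.applyₗ
    (![ι.symm (Pi.single i 1), ι.symm (Pi.single j 1), ι.symm (Pi.single k 1)] l))).mem_polyFun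

theorem det_mem_polyFun (ι : V ≃ₗ[ℂ] (Fin 7 → ℂ)) : (fun f : V →ₗ[ℂ] V => LinearMap.det f) ∈ polyFun (V →ₗ[ℂ] V) := by
  let b := Module.Basis.ofEquivFun ι
  have h : (fun f : V →ₗ[ℂ] V => LinearMap.det f) = ∑ σ : Equiv.Perm (Fin 7),
      ((Equiv.Perm.sign σ : ℤ) : ℂ) • ∏ i, fun f : V →ₗ[ℂ] V => LinearMap.toMatrix b b f (σ i) i := by
    funext f
    rw [← LinearMap.det_toMatrix b, Matrix.det_apply']
    simp
  rw [h]
  refine (polyFun _).sum_mem fun σ _ => (polyFun _).smul_mem ((polyFun _).prod_mem fun i _ => ?_) _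
  exact polyFun_dual (LinearMap.proj i ∘ₗ LinearMap.proj (φ := fun _ : Fin 7 => Fin 7 → ℂ) (σ i) ∘ₗ
    (LinearMap.toMatrix b b).toLinearMap)

/-- In coordinates f ↦ ω ∘ f is polynomial on End(V) with surjective derivative at the identity,
hence dominant. The polynomial `d` is the determinant, which keeps the preimages invertible. -/
theorem exists_polyFun_orbit : ∃ a ∈ polyFun (V [⋀^Fin 3]→ₗ[ℂ] ℂ), (∃ η, a η ≠ 0) ∧
    ∀ η, a η ≠ 0 → ∃ g : V ≃ₗ[ℂ] V, η = (octForm ι).compLinearMap g.toLinearMap := by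
  have : FiniteDimensional ℂ V := Module.Finite.equiv ι.symm
  let bE := (Module.finBasis ℂ (V [⋀^Fin 3]→ₗ[ℂ] ℂ)).equivFun
  let bD := (Module.finBasis ℂ (V →ₗ[ℂ] V)).equivFun
  have hF : ∀ i, ∃ P : MvPolynomial _ ℂ, ∀ x, bE ((octForm ι).compLinearMap (bD.symm x)) i =
      MvPolynomial.eval x P := fun i => exists_mvPolynomial_of_mem_polyFun
    (((isPolyMap_compLinearMap ι (octForm ι)).comp
      (isPolyMap_linear bD.symm.toLinearMap)).dual (LinearMap.proj i ∘ₗ bE.toLinearMap))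
  choose F hF using hF
  obtain ⟨d, hd⟩ := exists_mvPolynomial_of_mem_polyFun
    (isPolyMap_linear bD.symm.toLinearMap _ (det_mem_polyFun ι))
  have hd0 : d ≠ 0 := by
    rintro rfl
    have := hd (bD LinearMap.id)
    simp at this
  have hinj : Function.Injective (MvPolynomial.aeval (R := ℂ) F) := by
    refine aeval_injective_of_surjective_deriv (bD LinearMap.id) fun y => ?_
    obtain ⟨X, hX⟩ := LinearMap.range_eq_top.1 (formDerivₗ_range ι) (bE.symm y)
    replace hX : formDeriv (octForm ι) X = bE.symm y := hX
    refine ⟨bD X, fun i => ?_⟩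
    have h1 : (fun t : ℂ => MvPolynomial.eval (bD LinearMap.id + t • bD X) (F i)) = fun t =>
        bE (octForm ι) i + t * y i + t ^ 2 * bE (formDeriv₂ (octForm ι) X) i +
          t ^ 3 * bE ((octForm ι).compLinearMap X) i := by
      funext t
      rw [← hF, ← map_smul, ← map_add, LinearEquiv.symm_apply_apply, compLinearMap_id_add_smul, hX]
      simp
    rw [h1]
    have h2 := (((hasDerivAt_const (0 : ℂ) (bE (octForm ι) i)).add
      ((hasDerivAt_id (0 : ℂ)).mul_const (y i))).add
      (((hasDerivAt_id (0 : ℂ)).pow 2).mul_const (bE (formDeriv₂ (octForm ι) X) i))).add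
      (((hasDerivAt_id (0 : ℂ)).pow 3).mul_const (bE ((octForm ι).compLinearMap X) i))
    exact h2.congr_deriv (by simp)
  obtain ⟨a, ha, hsurj⟩ := MvPolynomial.exists_forall_exists_eval_eq hinj hd0
  refine ⟨fun η => MvPolynomial.eval (bE η) a, isPolyMap_linear bE.toLinearMap _
    (eval_mem_polyFun a), ?_, fun η hη => ?_⟩
  · by_contra! h
    refine ha (MvPolynomial.funext fun y => ?_)
    simpa using h (bE.symm y)
  · obtain ⟨x, hdx, hx⟩ := hsurj (bE η) hη
    rw [← hd] at hdx
    have hu : IsUnit (LinearMap.det (bD.symm x)) := isUnit_iff_ne_zero.2 hdx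
    refine ⟨LinearEquiv.ofIsUnitDet (f := bD.symm x) (v := Module.Basis.ofEquivFun ι)
      (v' := Module.Basis.ofEquivFun ι) (by rwa [LinearMap.det_toMatrix]), bE.injective ?_⟩
    funext i
    rw [← hx, ← hF]
    rfl

theorem isGenericForm_octForm : IsGenericForm (octForm ι) := by
  obtain ⟨a, ha, ⟨η, hη⟩, h⟩ := exists_polyFun_orbit ι
  obtain ⟨g₀, rfl⟩ := h η hη
  refine isOpen_affineVar_iff.2 ?_
  rintro _ ⟨g, rfl⟩
  -- Composition with `k` takes the given point ω ∘ g of the orbit to ω ∘ g₀, near which the orbit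
  -- is known to be open.
  let k : V ≃ₗ[ℂ] V := g₀.trans g.symm
  let A : (V [⋀^Fin 3]→ₗ[ℂ] ℂ) →ₗ[ℂ] (V [⋀^Fin 3]→ₗ[ℂ] ℂ) :=
    { toFun := fun η => η.compLinearMap k.toLinearMap
      map_add' := fun _ _ => rfl
      map_smul' := fun _ _ => rfl }
  have hA : ∀ η v, A η v = η fun i => k (v i) := fun _ _ => rfl
  refine ⟨fun η => a (A η), isPolyMap_linear A a ha, ?_, fun η hη' => ?_⟩
  · change a (A _) ≠ 0
    rwa [show A ((octForm ι).compLinearMap g.toLinearMap) =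
      (octForm ι).compLinearMap g₀.toLinearMap by
        ext v
        rw [hA]
        simp [AlternatingMap.compLinearMap_apply, k]]
  · obtain ⟨g', hg'⟩ := h (A η) hη'
    refine ⟨k.symm.trans g', ?_⟩
    ext v
    have := congrArg (fun η => η fun i => k.symm (v i)) hg'
    simp only [hA, LinearEquiv.apply_symm_apply] at this
    exact this

/-- Two open orbits meet, hence coincide; the change of variables is absorbed into the coordinates.
-/
theorem exists_eq_octForm (ι₀ : V ≃ₗ[ℂ] (Fin 7 → ℂ)) {ω : V [⋀^Fin 3]→ₗ[ℂ] ℂ}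
    (hω : IsGenericForm ω) : ∃ ι : V ≃ₗ[ℂ] (Fin 7 → ℂ), ω = octForm ι := by
  obtain ⟨_, ⟨g, rfl⟩, g', hg'⟩ := affineVar_inter_nonempty (isGenericForm_octForm ι₀) hω
    ⟨_, LinearEquiv.refl ℂ V, rfl⟩ ⟨_, LinearEquiv.refl ℂ V, rfl⟩
  refine ⟨g'.symm.trans (g.trans ι₀), ?_⟩
  ext v
  have := congrArg (fun η => η fun i => g'.symm (v i)) hg'
  simp only [AlternatingMap.compLinearMap_apply, LinearEquiv.coe_coe,
    LinearEquiv.apply_symm_apply] at this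
  rw [← this, octForm_apply, octForm_apply]
  simp [octEmb_apply]

end

end

noncomputable section

local infixl:70 " ⊛ " => octMul

/-! ### Square roots of regular functions -/

section

variable {M : Type*}

/-- The functions `a + ρ b` with `a` and `b` in `K`, where `ρ² ∈ K`. -/
def rootExtension (K : Subalgebra ℂ (M → ℂ)) (ρ : M → ℂ) (h : ρ * ρ ∈ K) :
    Subalgebra ℂ (M → ℂ) where
  carrier := {f | ∃ a ∈ K, ∃ b ∈ K, f = a + ρ * b}
  mul_mem' := by
    rintro _ _ ⟨a, ha, b, hb, rfl⟩ ⟨a', ha', b', hb', rfl⟩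
    exact ⟨a * a' + ρ * ρ * (b * b'), K.add_mem (K.mul_mem ha ha') (K.mul_mem h (K.mul_mem hb hb')),
      a * b' + b * a', K.add_mem (K.mul_mem ha hb') (K.mul_mem hb ha'), by ring⟩
  add_mem' := by
    rintro _ _ ⟨a, ha, b, hb, rfl⟩ ⟨a', ha', b', hb', rfl⟩
    exact ⟨a + a', K.add_mem ha ha', b + b', K.add_mem hb hb', by ring⟩
  algebraMap_mem' c := ⟨_, K.algebraMap_mem c, 0, K.zero_mem, by ring⟩

variable {K : Subalgebra ℂ (M → ℂ)} {ρ : M → ℂ} {h : ρ * ρ ∈ K} {τ : M → M}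

theorem le_rootExtension : K ≤ rootExtension K ρ h := fun a ha =>
  ⟨a, ha, 0, K.zero_mem, by ring⟩

theorem root_mem_rootExtension : ρ ∈ rootExtension K ρ h :=
  ⟨0, K.zero_mem, 1, K.one_mem, by ring⟩

theorem comp_rootExtension (hτ : ∀ a ∈ K, a ∘ τ = a) (hρ : ρ ∘ τ = ρ) :
    ∀ a ∈ rootExtension K ρ h, a ∘ τ = a := by
  rintro _ ⟨a, ha, b, hb, rfl⟩
  funext m
  have h1 := congrFun (hτ a ha) m
  have h2 := congrFun (hτ b hb) m
  have h3 := congrFun hρ m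
  simp only [Function.comp_apply, Pi.add_apply, Pi.mul_apply] at *
  simp [*]

/-- Descent along the involution τ. It turns f(a′ + ρb′) = a + ρb into f(a′ − ρb′) = a − ρb, so f a′
= a and f b′ = b, as ρ has no zeros. One of a′, b′ does not vanish at `m₀`. -/
theorem exists_mul_eq_of_rootExtension (hτ : ∀ a ∈ K, a ∘ τ = a) (hρ : ∀ m, ρ (τ m) = -ρ m)
    (hne : ∀ m, ρ m ≠ 0) {f : M → ℂ} (hf : f ∘ τ = f)
    (H : ∃ p ∈ rootExtension K ρ h, ∃ q ∈ rootExtension K ρ h, q m₀ ≠ 0 ∧ f * q = p) :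
    ∃ p ∈ K, ∃ q ∈ K, q m₀ ≠ 0 ∧ f * q = p := by
  obtain ⟨_, ⟨a, ha, b, hb, rfl⟩, _, ⟨a', ha', b', hb', rfl⟩, hq, hfq⟩ := H
  have h1 : ∀ m, f m * (a' m + ρ m * b' m) = a m + ρ m * b m := congrFun hfq
  have h2 : ∀ m, f m * (a' m - ρ m * b' m) = a m - ρ m * b m := fun m => by
    have := h1 (τ m)
    rw [hρ, show f (τ m) = f m from congrFun hf m, show a (τ m) = a m from congrFun (hτ a ha) m,
      show b (τ m) = b m from congrFun (hτ b hb) m, show a' (τ m) = a' m from congrFun (hτ a' ha') m,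
      show b' (τ m) = b' m from congrFun (hτ b' hb') m] at this
    linear_combination this
  by_cases h0 : a' m₀ = 0
  · refine ⟨b, hb, b', hb', fun hb0 => hq ?_, funext fun m => mul_left_cancel₀ (hne m) ?_⟩
    · simp [h0, hb0]
    · rw [Pi.mul_apply]
      linear_combination (1 / 2) * (h1 m - h2 m)
  · refine ⟨a, ha, a', ha', h0, funext fun m => ?_⟩
    rw [Pi.mul_apply]
    linear_combination (1 / 2) * (h1 m + h2 m)

end

/-! ### Regular maps to a vector space -/

section

variable {X V : Type*} [AddCommGroup V] [Module ℂ V] {S : SpaceWithFunctions X}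
  (hS : S.IsLocallyRinged) {W : Set X}

/-- The maps to a vector space that are regular near each point of `W`. -/
def SpaceWithFunctions.RegMapOn (S : SpaceWithFunctions X) (W : Set X) (b : X → V) : Prop :=
  ∀ ℓ : Module.Dual ℂ V, ∀ x ∈ W, S.RegAt (fun y => ℓ (b y)) x

theorem mem_subalgebra_iff {a : X → ℂ} : a ∈ hS.subalgebra W ↔ ∀ x ∈ W, S.RegAt a x := Iff.rfl

theorem regMapOn_smul {a : X → ℂ} {b : X → V} (ha : a ∈ hS.subalgebra W) (hb : S.RegMapOn W b) :
    S.RegMapOn W fun y => a y • b y := fun ℓ => by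
  have := (hS.subalgebra W).mul_mem ha (hb ℓ)
  simp only [map_smul, smul_eq_mul]
  exact this

theorem regMapOn_sub (hS : S.IsLocallyRinged) {b c : X → V} (hb : S.RegMapOn W b) (hc : S.RegMapOn W c) :
    S.RegMapOn W fun y => b y - c y := fun ℓ => by
  have := (hS.subalgebra W).sub_mem (hb ℓ) (hc ℓ)
  simp only [map_sub]
  exact this

theorem regMapOn_imB (ι : V ≃ₗ[ℂ] (Fin 7 → ℂ)) {b c : X → V} (hb : S.RegMapOn W b)
    (hc : S.RegMapOn W c) : (fun y => imB ι (b y) (c y)) ∈ hS.subalgebra W := by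
  have h : (fun y => imB ι (b y) (c y)) =
      ∑ i, (fun y => ι (b y) i) * fun y => ι (c y) i := by
    funext y
    simp [imB_eq_sum]
  rw [h]
  exact (hS.subalgebra W).sum_mem fun i _ => (hS.subalgebra W).mul_mem
    (hb (LinearMap.proj (R := ℂ) (φ := fun _ : Fin 7 => ℂ) i ∘ₗ ι.toLinearMap))
    (hc (LinearMap.proj (R := ℂ) (φ := fun _ : Fin 7 => ℂ) i ∘ₗ ι.toLinearMap))

end

/-! ### The orbit of an isotropic plane -/

section

variable {V : Type*} [AddCommGroup V] [Module ℂ V] (ι : V ≃ₗ[ℂ] (Fin 7 → ℂ))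

/-- The frame `g e₁, g e₂, g e₄` of imaginary octonions. -/
def orbitFrame (g : G2) (i : Fin 3) : V := octProj ι (g.1 (stdTriple i))

theorem octEmb_orbitFrame (g : G2) (i : Fin 3) : octEmb ι (orbitFrame ι g i) = g.1 (stdTriple i) :=
  octEmb_octProj_of_re ι ((G2.re_map _ g.2).trans (isBasicTriple_stdTriple.re i))

theorem imB_orbitFrame (g : G2) (i j : Fin 3) :
    imB ι (orbitFrame ι g i) (orbitFrame ι g j) = if i = j then 1 else 0 := by
  rw [imB_apply, octEmb_orbitFrame, octEmb_orbitFrame]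
  exact (G2.isBasicTriple_map g.2 isBasicTriple_stdTriple).orthonormal i j

theorem linearIndependent_of_imB {v : Fin 3 → V}
    (hv : ∀ i j, imB ι (v i) (v j) = if i = j then 1 else 0) : LinearIndependent ℂ v := by
  rw [Fintype.linearIndependent_iff]
  intro c hc i
  have := congrArg (imB ι (v i)) hc
  simpa [hv] using this

/-- The orbit map `g ↦ g ⟨e₁, e₂, e₄⟩`. -/
def orbitMap (g : G2) : hyperplaneSection (octForm ι) :=
  ⟨Gr3.ofFrame (orbitFrame ι g) (linearIndependent_of_imB ι (imB_orbitFrame ι g)), by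
    refine (mem_hyperplaneSection_iff (v := orbitFrame ι g) rfl).2 ?_
    rw [octForm_apply]
    simp only [octEmb_orbitFrame]
    exact (G2.isBasicTriple_map g.2 isBasicTriple_stdTriple).mul⟩

theorem orbitMap_val (g : G2) : (orbitMap ι g).1.1 = Submodule.span ℂ (Set.range (orbitFrame ι g)) :=
  rfl

/-- The vanishing of ω on the plane is exactly the condition that makes an orthonormal basis of it a
basic triple. -/
theorem exists_orbitMap_eq {L : hyperplaneSection (octForm ι)} {v : Fin 3 → V}
    (hL : ∀ i, v i ∈ L.1.1) (hv : ∀ i j, imB ι (v i) (v j) = if i = j then 1 else 0) :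
    ∃ g : G2, orbitMap ι g = L ∧ ∀ i, g.1 (stdTriple i) = octEmb ι (v i) := by
  have hb : IsBasicTriple fun i => octEmb ι (v i) :=
    { re := fun i => octRe_octEmb ι _
      orthonormal := hv
      mul := by rw [← octForm_apply]; exact L.2 v hL }
  have hg : ∀ i, hb.equiv (stdTriple i) = octEmb ι (v i) := fun i => by
    rw [hb.equiv_apply, tripleMap_apply_triple]
  refine ⟨⟨hb.equiv, hb.equiv_mem⟩, Subtype.ext (Subtype.ext ?_), hg⟩
  have hf : orbitFrame ι ⟨hb.equiv, hb.equiv_mem⟩ = v := funext fun i => by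
    rw [orbitFrame, hg, octProj_octEmb]
  rw [orbitMap_val, hf]
  have : Module.Finite ℂ L.1.1 := Module.finite_of_finrank_pos (by rw [L.1.2]; norm_num)
  refine Submodule.eq_of_le_of_finrank_eq (Submodule.span_le.2 (Set.range_subset_iff.2 hL)) ?_
  rw [finrank_span_eq_card (linearIndependent_of_imB ι hv), L.1.2, Fintype.card_fin]

theorem sectionVar_isLocallyRinged (ω : V [⋀^Fin 3]→ₗ[ℂ] ℂ) : (sectionVar ω).IsLocallyRinged :=
  SpaceWithFunctions.isLocallyRinged_induced projVar_isLocallyRinged _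

/-- Contractions of the Plücker vector of a plane lie in the plane. Divided by the Plücker
coordinate `D`, they are homogeneous of degree zero, so they are regular where D ≠ 0, and at `L`
they give back `v`. -/
theorem exists_local_frame {ω : V [⋀^Fin 3]→ₗ[ℂ] ℂ} (L : hyperplaneSection ω) {v : Fin 3 → V}
    (hv : LinearIndependent ℂ v) (hL : Submodule.span ℂ (Set.range v) = L.1.1)
    (α : Fin 3 → Module.Dual ℂ V) (hα : ∀ i j, α i (v j) = if i = j then 1 else 0) :
    ∃ W : Set (hyperplaneSection ω), IsOpen[(sectionVar ω).top] W ∧ L ∈ W ∧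
      ∃ b : Fin 3 → hyperplaneSection ω → V, (∀ i, (sectionVar ω).RegMapOn W (b i)) ∧
        (∀ i x, b i x ∈ x.1.1) ∧ ∀ i, b i L = v i := by
  let D : ⋀[ℂ]^3 V →ₗ[ℂ] ℂ := trivectorMap (detForm α)
  let r : hyperplaneSection ω → ⋀[ℂ]^3 V := fun x => (plucker x.1).rep
  have hdet : detForm α v = 1 := by
    rw [detForm_apply_three]
    simp [hα]
  have hcon : ∀ i, contraction (α (i + 1)) (α (i + 2)) v = v i := fun i => by
    rw [contraction_apply]
    fin_cases i <;> simp [hα]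
  obtain ⟨a, ha, hrep⟩ := exists_rep_mk (iotaMulti_ne_zero hv)
  rw [← plucker_eq_mk hv hL] at hrep
  have hD : D (plucker L.1).rep = a := by
    rw [hrep, map_smul]
    simp [D, hdet]
  have hhom : IsHomFun 1 fun ξ => D ξ := isHomFun_dual D
  refine ⟨{x | D (r x) ≠ 0}, ?_, ?_, fun i x => (D (r x))⁻¹ • contractions α i (r x), ?_, ?_, ?_⟩
  · exact ⟨_, hhom.isOpen, rfl⟩
  · change D (plucker L.1).rep ≠ 0
    rwa [hD]
  · intro i ℓ x hx
    refine ⟨_, (isHomFun_dual (ℓ ∘ₗ contractions α i)).regAt_div hhom hx, Set.univ,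
      @isOpen_univ _ (projVar _).top, trivial, fun y _ => ?_⟩
    change ℓ ((D (r y))⁻¹ • contractions α i (r y)) = ℓ (contractions α i (r y)) / D (r y)
    rw [map_smul, smul_eq_mul, inv_mul_eq_div]
  · intro i x
    refine x.1.1.smul_mem _ ?_
    obtain ⟨a', -, hrep'⟩ := exists_rep_mk (iotaMulti_ne_zero x.1.linearIndependent_frame)
    change contractions α i (plucker x.1).rep ∈ _
    rw [plucker, hrep', map_smul, contractions_iotaMulti, contraction_apply]
    have hf : ∀ i, x.1.frame i ∈ x.1.1 := fun i => by
      rw [← SetLike.mem_coe, ← x.1.span_frame]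
      exact Submodule.subset_span ⟨i, rfl⟩
    exact x.1.1.smul_mem _ (x.1.1.add_mem (x.1.1.add_mem (x.1.1.smul_mem _ (hf 0))
      (x.1.1.smul_mem _ (hf 1))) (x.1.1.smul_mem _ (hf 2)))
  · intro i
    change (D (plucker L.1).rep)⁻¹ • contractions α i (plucker L.1).rep = v i
    rw [hD, hrep, map_smul, contractions_iotaMulti, hcon, inv_smul_smul₀ ha]

/-- Gram–Schmidt with denominators cleared and without normalization, so that the frame stays
regular. At `L` all norms are 1, so they are nonzero nearby. -/
theorem exists_orthogonal_frame {ω : V [⋀^Fin 3]→ₗ[ℂ] ℂ} (L : hyperplaneSection ω) {v : Fin 3 → V}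
    (hv : ∀ i j, imB ι (v i) (v j) = if i = j then 1 else 0)
    (hL : Submodule.span ℂ (Set.range v) = L.1.1) :
    ∃ W : Set (hyperplaneSection ω), IsOpen[(sectionVar ω).top] W ∧ L ∈ W ∧
      ∃ c : Fin 3 → hyperplaneSection ω → V, (∀ i, (sectionVar ω).RegMapOn W (c i)) ∧
        (∀ i x, c i x ∈ x.1.1) ∧ (∀ i, c i L = v i) ∧
        (∀ i, ∀ x ∈ W, imB ι (c i x) (c i x) ≠ 0) ∧
        ∀ i j, i ≠ j → ∀ x, imB ι (c i x) (c j x) = 0 := by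
  have hS := sectionVar_isLocallyRinged ω
  obtain ⟨W, hW, hLW, b, hb, hbL, hbv⟩ := exists_local_frame L (linearIndependent_of_imB ι hv) hL
    (fun i => imB ι (v i)) hv
  have hR := fun {a : hyperplaneSection ω → ℂ} => mem_subalgebra_iff hS (W := W) (a := a)
  let R := hS.subalgebra W
  have hB := fun {b c : hyperplaneSection ω → V} (hb : (sectionVar ω).RegMapOn W b)
    (hc : (sectionVar ω).RegMapOn W c) => regMapOn_imB hS ι hb hc
  let d₀ := fun x => imB ι (b 0 x) (b 0 x)
  let c₁ := fun x => d₀ x • b 1 x - imB ι (b 0 x) (b 1 x) • b 0 x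
  have hd₀ : d₀ ∈ R := hB (hb 0) (hb 0)
  have hc₁ : (sectionVar ω).RegMapOn W c₁ :=
    regMapOn_sub hS (regMapOn_smul hS hd₀ (hb 1)) (regMapOn_smul hS (hB (hb 0) (hb 1)) (hb 0))
  let d₁ := fun x => imB ι (c₁ x) (c₁ x)
  have hd₁ : d₁ ∈ R := hB hc₁ hc₁
  let c₂ := fun x => (d₀ x * d₁ x) • b 2 x - (d₁ x * imB ι (b 0 x) (b 2 x)) • b 0 x -
    (d₀ x * imB ι (c₁ x) (b 2 x)) • c₁ x
  have hc₂ : (sectionVar ω).RegMapOn W c₂ :=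
    regMapOn_sub hS (regMapOn_sub hS (regMapOn_smul hS (R.mul_mem hd₀ hd₁) (hb 2))
      (regMapOn_smul hS (R.mul_mem hd₁ (hB (hb 0) (hb 2))) (hb 0)))
      (regMapOn_smul hS (R.mul_mem hd₀ (hB hc₁ (hb 2))) hc₁)
  let d₂ := fun x => imB ι (c₂ x) (c₂ x)
  have hd₂ : d₂ ∈ R := hB hc₂ hc₂
  have h01 : ∀ x, imB ι (b 0 x) (c₁ x) = 0 := fun x => by
    simp only [c₁, d₀, map_sub, map_smul, smul_eq_mul]
    ring
  have h02 : ∀ x, imB ι (b 0 x) (c₂ x) = 0 := fun x => by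
    simp only [c₂, map_sub, map_smul, smul_eq_mul, h01]
    simp only [d₀]
    ring
  have h12 : ∀ x, imB ι (c₁ x) (c₂ x) = 0 := fun x => by
    simp only [c₂, map_sub, map_smul, smul_eq_mul, imB_comm ι (c₁ x) (b 0 x), h01]
    simp only [d₁]
    ring
  have e₀ : d₀ L = 1 := by simp [d₀, hbv, hv]
  have e₁ : c₁ L = v 1 := by simp [c₁, e₀, hbv, hv]
  have e₁' : d₁ L = 1 := by simp [d₁, e₁, hv]
  have e₂ : c₂ L = v 2 := by simp [c₂, e₀, e₁, e₁', hbv, hv]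
  have e₂' : d₂ L = 1 := by simp [d₂, e₂, hv]
  have hd : d₀ * d₁ * d₂ ∈ R := R.mul_mem (R.mul_mem hd₀ hd₁) hd₂
  have hc₁L : ∀ x, c₁ x ∈ x.1.1 := fun x =>
    x.1.1.sub_mem (x.1.1.smul_mem _ (hbL 1 x)) (x.1.1.smul_mem _ (hbL 0 x))
  have hsub : {x | x ∈ W ∧ (d₀ * d₁ * d₂) x ≠ 0} ⊆ W := fun x hx => hx.1
  refine ⟨{x | x ∈ W ∧ (d₀ * d₁ * d₂) x ≠ 0}, hS.isOpen_setOf hW hd,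
    ⟨hLW, by simp [e₀, e₁', e₂']⟩, ![b 0, c₁, c₂], ?_, ?_, ?_, ?_, ?_⟩
  · rw [Fin.forall_fin_succ, Fin.forall_fin_two]
    exact ⟨fun ℓ x hx => hb 0 ℓ x hx.1, fun ℓ x hx => hc₁ ℓ x hx.1, fun ℓ x hx => hc₂ ℓ x hx.1⟩
  · rw [Fin.forall_fin_succ, Fin.forall_fin_two]
    exact ⟨hbL 0, hc₁L, fun x => x.1.1.sub_mem (x.1.1.sub_mem (x.1.1.smul_mem _ (hbL 2 x))
      (x.1.1.smul_mem _ (hbL 0 x))) (x.1.1.smul_mem _ (hc₁L x))⟩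
  · rw [Fin.forall_fin_succ, Fin.forall_fin_two]
    exact ⟨hbv 0, e₁, e₂⟩
  · rw [Fin.forall_fin_succ, Fin.forall_fin_two]
    refine ⟨fun x hx h0 => hx.2 ?_, fun x hx h0 => hx.2 ?_, fun x hx h0 => hx.2 ?_⟩
    · rw [Pi.mul_apply, Pi.mul_apply, show d₀ x = 0 from h0, zero_mul, zero_mul]
    · rw [Pi.mul_apply, Pi.mul_apply, show d₁ x = 0 from h0, mul_zero, zero_mul]
    · rw [Pi.mul_apply, show d₂ x = 0 from h0, mul_zero]
  · intro i j hij x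
    fin_cases i <;> fin_cases j <;> first
      | exact absurd rfl hij
      | exact h01 x
      | exact h02 x
      | exact h12 x
      | exact (imB_comm ι _ _).trans (h01 x)
      | exact (imB_comm ι _ _).trans (h02 x)
      | exact (imB_comm ι _ _).trans (h12 x)

end

end

/-! ### Descent of functions along the orbit map -/

noncomputable section

section

variable {V : Type*} [AddCommGroup V] [Module ℂ V] (ι : V ≃ₗ[ℂ] (Fin 7 → ℂ))

/-- A function on `X_ω` whose pull-back to `G₂` is locally a quotient of polynomials in the frame
`g e₁, g e₂, g e₄` is locally a quotient of regular functions. -/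
theorem exists_local_quotient (f : hyperplaneSection (octForm ι) → ℂ)
    {p q : (Fin 3 → ComplexOctonion) → ℂ} (hp : p ∈ polyFun (Fin 3 → ComplexOctonion))
    (hq : q ∈ polyFun (Fin 3 → ComplexOctonion))
    (H : ∀ g : G2, f (orbitMap ι g) * q (fun i => g.1 (stdTriple i)) =
      p (fun i => g.1 (stdTriple i)))
    (g₁ : G2) (hg₁ : q (fun i => g₁.1 (stdTriple i)) ≠ 0) :
    ∃ W, IsOpen[(sectionVar (octForm ι)).top] W ∧ orbitMap ι g₁ ∈ W ∧
      ∃ a ∈ (sectionVar_isLocallyRinged (octForm ι)).subalgebra W,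
      ∃ b ∈ (sectionVar_isLocallyRinged (octForm ι)).subalgebra W,
        b (orbitMap ι g₁) ≠ 0 ∧ ∀ x ∈ W, f x * b x = a x := by
  have hS := sectionVar_isLocallyRinged (octForm ι)
  obtain ⟨W, hW, hLW, c, hc, hcL, hcv, hne, horth⟩ :=
    exists_orthogonal_frame ι (orbitMap ι g₁) (imB_orbitFrame ι g₁) rfl
  refine ⟨W, hW, hLW, ?_⟩
  let d := fun i x => imB ι (c i x) (c i x)
  have hd : ∀ i, d i ∈ hS.subalgebra W := fun i => regMapOn_imB hS ι (hc i) (hc i)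
  -- The covering of `W` whose points are choices of square roots of the three norms; `τ i` changes
  -- the sign of the i-th root.
  let M := {m : hyperplaneSection (octForm ι) × (Fin 3 → ℂ) //
    m.1 ∈ W ∧ ∀ i, m.2 i * m.2 i = d i m.1}
  let pr : M → hyperplaneSection (octForm ι) := fun m => m.1.1
  let ρ : Fin 3 → M → ℂ := fun i m => m.1.2 i
  let τ : Fin 3 → M → M := fun i m => ⟨(m.1.1, Function.update m.1.2 i (-m.1.2 i)), m.2.1, fun j => by
    rcases eq_or_ne j i with rfl | hj
    · simpa using m.2.2 j
    · simpa [Function.update_of_ne hj] using m.2.2 j⟩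
  have hτ : ∀ i m, ρ i (τ i m) = -ρ i m := fun i m => Function.update_self ..
  have hτ' : ∀ i j, j ≠ i → ρ j ∘ τ i = ρ j := fun i j hj =>
    funext fun m => Function.update_of_ne hj ..
  have hρ : ∀ i m, ρ i m ≠ 0 := fun i m h0 => hne i _ m.2.1 (by
    have := m.2.2 i
    rw [show m.1.2 i = 0 from h0, mul_zero] at this
    exact this.symm)
  let P : (hyperplaneSection (octForm ι) → ℂ) →ₐ[ℂ] (M → ℂ) :=
    AlgHom.pi fun m => Pi.evalAlgHom ℂ _ (pr m)
  have hP : ∀ a m, P a m = a (pr m) := fun a m => rfl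
  let K₀ := (hS.subalgebra W).map P
  have hsq : ∀ i, ρ i * ρ i ∈ K₀ := fun i => ⟨d i, hd i, funext fun m => (m.2.2 i).symm⟩
  let K₁ := rootExtension K₀ (ρ 0) (hsq 0)
  have h01 : K₀ ≤ K₁ := le_rootExtension
  let K₂ := rootExtension K₁ (ρ 1) (h01 (hsq 1))
  have h12 : K₁ ≤ K₂ := le_rootExtension
  let K₃ := rootExtension K₂ (ρ 2) (h12 (h01 (hsq 2)))
  have h23 : K₂ ≤ K₃ := le_rootExtension
  have t₀ : ∀ i, ∀ a ∈ K₀, a ∘ τ i = a := by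
    rintro i _ ⟨a, -, rfl⟩
    rfl
  have t₁ : ∀ i, 0 ≠ i → ∀ a ∈ K₁, a ∘ τ i = a := fun i hi =>
    comp_rootExtension (t₀ i) (hτ' i 0 hi)
  have t₂ : ∀ a ∈ K₂, a ∘ τ 2 = a := comp_rootExtension (t₁ 2 (by decide)) (hτ' 2 1 (by decide))
  have hρK : ∀ i, ρ i ∈ K₃ := by
    rw [Fin.forall_fin_succ, Fin.forall_fin_two]
    exact ⟨h23 (h12 root_mem_rootExtension), h23 root_mem_rootExtension, root_mem_rootExtension⟩
  -- As ρᵢ² = dᵢ, this is cᵢ / ρᵢ, an orthonormal frame on the covering.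
  let v : Fin 3 → M → V := fun i m => ρ i m • (d i (pr m))⁻¹ • c i (pr m)
  have hv : ∀ m i j, imB ι (v i m) (v j m) = if i = j then 1 else 0 := fun m i j => by
    simp only [v, map_smul, LinearMap.smul_apply, smul_eq_mul]
    split_ifs with hij
    · subst hij
      have h1 : d i (pr m) ≠ 0 := hne i _ m.2.1
      have h2 : ρ i m * ρ i m = d i (pr m) := m.2.2 i
      rw [show imB ι (c i (pr m)) (c i (pr m)) = d i (pr m) from rfl]
      field_simp
      linear_combination h2
    · rw [horth i j hij]
      ring
  have hE : ∀ p ∈ polyFun (Fin 3 → ComplexOctonion), (fun m => p fun i => octEmb ι (v i m)) ∈ K₃ := by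
    intro p hp
    induction hp using polyFun_induction with
    | dual ℓ =>
      have h1 : (fun m => ℓ fun i => octEmb ι (v i m)) = ∑ i, ρ i * P (fun x =>
          (d i x)⁻¹ * (ℓ ∘ₗ LinearMap.single ℂ (fun _ => ComplexOctonion) i ∘ₗ octEmb ι) (c i x)) := by
        funext m
        rw [← Finset.univ_sum_single fun i => octEmb ι (v i m), map_sum, Finset.sum_apply]
        refine Finset.sum_congr rfl fun i _ => ?_
        rw [Pi.mul_apply, hP]
        simp only [v]
        rw [← smul_eq_mul, ← smul_eq_mul, ← map_smul, ← map_smul]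
        rfl
      rw [h1]
      refine K₃.sum_mem fun i _ => K₃.mul_mem (hρK i) (h23 (h12 (h01 ⟨_, ?_, rfl⟩)))
      exact fun x hx => hS.mul _ _ x (hS.inv _ x (hd i x hx) (hne i x hx)) (hc i _ x hx)
    | const a => exact K₃.algebraMap_mem a
    | add f g _ _ hf hg => exact K₃.add_mem hf hg
    | mul f g _ _ hf hg => exact K₃.mul_mem hf hg
  -- Over the base plane the norms are 1; with all roots equal to 1 the frame is that of `g₁`.
  let m₀ : M := ⟨(orbitMap ι g₁, fun _ => 1), hLW, fun i => by
    simp only [d, hcv, imB_orbitFrame]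
    norm_num⟩
  have hm₀ : ∀ i, octEmb ι (v i m₀) = g₁.1 (stdTriple i) := fun i => by
    have h1 : d i (pr m₀) = 1 := (m₀.2.2 i).symm.trans (one_mul 1)
    simp only [v, h1]
    rw [show ρ i m₀ = 1 from rfl, one_smul, inv_one, one_smul, show c i (pr m₀) = _ from hcv i,
      octEmb_orbitFrame]
  have H₃ : ∃ p ∈ K₃, ∃ q ∈ K₃, q m₀ ≠ 0 ∧ (f ∘ pr) * q = p := by
    refine ⟨_, hE p hp, _, hE q hq, ?_, funext fun m => ?_⟩
    · simpa only [hm₀] using hg₁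
    · obtain ⟨g, hg, hgv⟩ := exists_orbitMap_eq ι (L := pr m) (v := fun i => v i m)
        (fun i => Submodule.smul_mem _ _ (Submodule.smul_mem _ _ (hcL i _))) (hv m)
      have := H g
      simp only [hgv, hg] at this
      exact this
  have H₂ := exists_mul_eq_of_rootExtension t₂ (hτ 2) (hρ 2) (f := f ∘ pr) rfl H₃
  have H₁ := exists_mul_eq_of_rootExtension (t₁ 1 (by decide)) (hτ 1) (hρ 1) (f := f ∘ pr) rfl H₂
  obtain ⟨_, ⟨a, ha, rfl⟩, _, ⟨b, hb, rfl⟩, hb0, hab⟩ :=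
    exists_mul_eq_of_rootExtension (t₀ 0) (hτ 0) (hρ 0) (f := f ∘ pr) rfl H₁
  refine ⟨a, ha, b, hb, hb0, fun x hx => ?_⟩
  -- The covering is surjective, so the identity obtained on it holds on all of `W`.
  choose r hr using fun i => IsAlgClosed.exists_pow_nat_eq (d i x) (n := 2) (by norm_num)
  exact congrFun hab ⟨(x, r), hx, fun i => by rw [← sq]; exact hr i⟩

/-- Both `g` (by `tripleMap`) and g⁻¹ (its adjoint) are polynomial in the frame of `g`. -/
theorem G2.exists_polyFun_frame {p : (ComplexOctonion →ₗ[ℂ] ComplexOctonion) ×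
    (ComplexOctonion →ₗ[ℂ] ComplexOctonion) → ℂ} (hp : p ∈ polyFun _) :
    ∃ q ∈ polyFun (Fin 3 → ComplexOctonion),
      ∀ g : G2, q (fun i => g.1 (stdTriple i)) = p (g.1.toLinearMap, g.1.symm.toLinearMap) := by
  refine ⟨fun v => p (tripleMap v, octAdj (tripleMap v)),
    (isPolyMap_tripleMap.prodMk (isPolyMap_tripleMap.linear octAdj)) p hp, fun g => ?_⟩
  have h : tripleMap (fun i => g.1 (stdTriple i)) = g.1.toLinearMap :=
    LinearMap.ext fun x => (G2.eq_tripleMap g.2 x).symm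
  change p (tripleMap _, octAdj (tripleMap _)) = _
  rw [h, G2.octAdj_eq g.2]

theorem isPolyMap_iotaMulti {W : Type*} [AddCommGroup W] [Module ℂ W] [FiniteDimensional ℂ V]
    (T : W →ₗ[ℂ] V) (x : Fin 3 → W) : IsPolyMap fun a : (W →ₗ[ℂ] W) × (W →ₗ[ℂ] W) =>
      exteriorPower.ιMulti ℂ 3 fun i => T (a.1 (x i)) :=
  IsPolyMap.alternating (exteriorPower.ιMulti ℂ 3) fun i =>
    isPolyMap_linear (T ∘ₗ LinearMap.applyₗ (x i) ∘ₗ LinearMap.fst ℂ (W →ₗ[ℂ] W) (W →ₗ[ℂ] W))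

theorem orbitMap_isMorphism :
    (linGroupVar G2).IsMorphism (sectionVar (octForm ι)) (orbitMap ι) := by
  have : FiniteDimensional ℂ V := Module.Finite.equiv ι.symm
  refine SpaceWithFunctions.IsMorphism.codRestrict ?_ ?_
  · exact fun f g x U => SpaceWithFunctions.regAt_induced_congr f g x U
  · have h := (isPolyMap_iotaMulti (octProj ι) stdTriple).isMorphism_mk
      (i := fun g : G2 => (g.1.toLinearMap, g.1.symm.toLinearMap))
      (ξ := fun g => exteriorPower.ιMulti ℂ 3 (orbitFrame ι g))
      (fun g => iotaMulti_ne_zero (linearIndependent_of_imB ι (imB_orbitFrame ι g))) fun g => rfl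
    have he : (fun g => plucker (orbitMap ι g).1) = fun g => Projectivization.mk ℂ
        (exteriorPower.ιMulti ℂ 3 (orbitFrame ι g))
        (iotaMulti_ne_zero (linearIndependent_of_imB ι (imB_orbitFrame ι g))) := funext fun g =>
      plucker_eq_mk (linearIndependent_of_imB ι (imB_orbitFrame ι g)) rfl
    change SpaceWithFunctions.IsMorphism _ _ fun g => plucker (orbitMap ι g).1
    rw [he]
    exact h

theorem isOpen_orbitMap_image {U : Set G2} (hU : IsOpen[(linGroupVar G2).top] U) :
    IsOpen[(sectionVar (octForm ι)).top] (orbitMap ι '' U) := by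
  classical
  have hS := sectionVar_isLocallyRinged (octForm ι)
  let := (sectionVar (octForm ι)).top
  rw [isOpen_iff_forall_mem_open]
  rintro _ ⟨g₁, hg₁, rfl⟩
  obtain ⟨U', hU', rfl⟩ := hU
  obtain ⟨q, hq, hq1, hqU⟩ := isOpen_affineVar_iff.1 hU' _ hg₁
  obtain ⟨q', hq', hqq'⟩ := G2.exists_polyFun_frame hq
  -- The indicator function of the image of a basic open set: it satisfies f · q′ = q′ on all
  -- frames. Descent gives f b = a with b ≠ 0 at the point, and a ≠ 0 is an open condition that
  -- forces f ≠ 0.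
  let f : hyperplaneSection (octForm ι) → ℂ := fun x =>
    if ∃ g : G2, q' (fun i => g.1 (stdTriple i)) ≠ 0 ∧ orbitMap ι g = x then 1 else 0
  obtain ⟨W, hW, hgW, a, ha, b, hb, hb0, hab⟩ := exists_local_quotient ι f hq' hq' (fun g => by
    by_cases h0 : q' (fun i => g.1 (stdTriple i)) = 0
    · rw [h0, mul_zero]
    · rw [show f (orbitMap ι g) = 1 from if_pos ⟨g, h0, rfl⟩, one_mul]) g₁ (by rwa [hqq'])
  refine ⟨{x | x ∈ W ∧ a x ≠ 0}, ?_, hS.isOpen_setOf hW ha, hgW, ?_⟩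
  · rintro x ⟨hxW, hax⟩
    have hfx : f x ≠ 0 := fun h0 => hax (by rw [← hab x hxW, h0, zero_mul])
    obtain ⟨g, hg, rfl⟩ : ∃ g : G2, q' (fun i => g.1 (stdTriple i)) ≠ 0 ∧ orbitMap ι g = x := by
      by_contra h
      exact hfx (if_neg h)
    exact ⟨g, hqU _ (by rwa [hqq'] at hg), rfl⟩
  · rw [← hab _ hgW, show f (orbitMap ι g₁) = 1 from if_pos ⟨g₁, by rwa [hqq'], rfl⟩, one_mul]
    exact hb0

theorem regAt_of_regAt_comp_orbitMap {f : hyperplaneSection (octForm ι) → ℂ} {g₁ : G2}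
    (hf : (linGroupVar G2).RegAt (f ∘ orbitMap ι) g₁) :
    (sectionVar (octForm ι)).RegAt f (orbitMap ι g₁) := by
  have hS := sectionVar_isLocallyRinged (octForm ι)
  obtain ⟨F, ⟨p, hp, q, hq, hq1, hF⟩, U, hU, hgU, hfF⟩ := hf
  obtain ⟨u, hu, hu1, huU⟩ := isOpen_affineVar_iff.1 hU _ hgU
  obtain ⟨p', hp', hpp⟩ := G2.exists_polyFun_frame hp
  obtain ⟨q', hq', hqq⟩ := G2.exists_polyFun_frame hq
  obtain ⟨u', hu', huu⟩ := G2.exists_polyFun_frame hu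
  obtain ⟨W, hW, hgW, a, ha, b, hb, hb0, hab⟩ := exists_local_quotient ι f
    -- The identity must hold for every `g`; the factor q′u′ makes both sides vanish wherever p′/q′
    -- is not known to represent `f`.
    (p := p' * u' * (q' * u')) (q := q' * u' * (q' * u'))
    ((polyFun _).mul_mem ((polyFun _).mul_mem hp' hu') ((polyFun _).mul_mem hq' hu'))
    ((polyFun _).mul_mem ((polyFun _).mul_mem hq' hu') ((polyFun _).mul_mem hq' hu'))
    (fun g => by
      simp only [Pi.mul_apply]
      by_cases h0 : q' (fun i => g.1 (stdTriple i)) * u' (fun i => g.1 (stdTriple i)) = 0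
      · rw [h0, mul_zero, mul_zero, mul_zero]
      · have hq0 := left_ne_zero_of_mul h0
        have hu0 := right_ne_zero_of_mul h0
        have h1 : f (orbitMap ι g) = _ := (hfF g (huU _ (by rwa [huu] at hu0))).trans
          (hF _ (by rwa [hqq] at hq0))
        rw [h1, ← hpp, ← hqq]
        field_simp) g₁
    (by simpa [hqq, huu] using ⟨hq1, hu1⟩)
  refine SpaceWithFunctions.regAt_induced_congr (a * b⁻¹) f _ {x | x ∈ W ∧ b x ≠ 0}
    (hS.mul _ _ _ (ha _ hgW) (hS.inv _ _ (hb _ hgW) hb0)) (hS.isOpen_setOf hW hb) ⟨hgW, hb0⟩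
    fun x hx => ?_
  rw [Pi.mul_apply, Pi.inv_apply, ← hab x hx.1, mul_inv_cancel_right₀ hx.2]

end

end

noncomputable section

/-! ### The stabilizer of the plane `⟨e₁, e₂, e₄⟩` -/

section

/-- The triple `∑ⱼ Aⱼᵢ eⱼ` of combinations of `e₁`, `e₂`, `e₄`. -/
def matrixTriple (A : Matrix (Fin 3) (Fin 3) ℂ) (i : Fin 3) : ComplexOctonion :=
  ∑ j, A j i • stdTriple j

theorem octB_stdTriple_matrixTriple (A : Matrix (Fin 3) (Fin 3) ℂ) (i j : Fin 3) :
    octB (stdTriple j) (matrixTriple A i) = A j i := by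
  simp [matrixTriple, isBasicTriple_stdTriple.orthonormal]

theorem octB_mul_stdTriple (i j k : Fin 3) :
    octB (octMul (stdTriple i) (stdTriple j)) (stdTriple k) = 0 := by
  fin_cases i <;> fin_cases j <;> fin_cases k <;>
    simp [stdTriple, octBasis, octB_apply, octMul]

theorem isBasicTriple_matrixTriple {A : Matrix (Fin 3) (Fin 3) ℂ}
    (hA : A ∈ Matrix.orthogonalGroup (Fin 3) ℂ) : IsBasicTriple (matrixTriple A) where
  re i := by simp [matrixTriple, isBasicTriple_stdTriple.re]
  orthonormal i j := by
    have h := congrFun (congrFun ((Matrix.mem_orthogonalGroup_iff' (Fin 3) ℂ).1 hA) i) j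
    rw [Matrix.mul_apply, Matrix.one_apply] at h
    rw [← h]
    conv_lhs => rw [matrixTriple, map_sum, LinearMap.sum_apply]
    refine Finset.sum_congr rfl fun k _ => ?_
    rw [map_smul, LinearMap.smul_apply, octB_stdTriple_matrixTriple, smul_eq_mul,
      Matrix.transpose_apply]
  mul := by
    simp only [← octMulL_apply, matrixTriple, map_sum, LinearMap.sum_apply, map_smul,
      LinearMap.smul_apply, smul_eq_mul]
    simp only [octMulL_apply, octB_mul_stdTriple, mul_zero, Finset.sum_const_zero]

theorem G2.ext_stdTriple {g h : G2} (H : ∀ i, g.1 (stdTriple i) = h.1 (stdTriple i)) : g = h :=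
  Subtype.ext (LinearEquiv.ext fun x => by
    rw [G2.eq_tripleMap g.2, G2.eq_tripleMap h.2, funext H])

theorem isPolyMap_matrixTriple : IsPolyMap matrixTriple :=
  IsPolyMap.pi fun i => IsPolyMap.sum _ fun j _ => IsPolyMap.smul
    (polyFun_dual (LinearMap.proj (R := ℂ) (φ := fun _ : Fin 3 => ℂ) i ∘ₗ
      LinearMap.proj (R := ℂ) (φ := fun _ : Fin 3 => Fin 3 → ℂ) j)) (isPolyMap_const _)

theorem isPolyMap_matrixCoeff {W : Type*} [AddCommGroup W] [Module ℂ W]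
    (ℓ : Fin 3 → Module.Dual ℂ W) (x : Fin 3 → W) :
    IsPolyMap (F := Matrix (Fin 3) (Fin 3) ℂ) fun a : (W →ₗ[ℂ] W) × (W →ₗ[ℂ] W) =>
      Matrix.of fun j i => ℓ j (a.1 (x i)) :=
  IsPolyMap.pi fun j => IsPolyMap.pi fun i => isPolyMap_linear
    (ℓ j ∘ₗ LinearMap.applyₗ (x i) ∘ₗ LinearMap.fst ℂ (W →ₗ[ℂ] W) (W →ₗ[ℂ] W))

theorem isMorphism_matrixCoeff {W : Type*} [AddCommGroup W] [Module ℂ W]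
    {G : Subgroup (W ≃ₗ[ℂ] W)} (H : Subgroup G) (ℓ : Fin 3 → Module.Dual ℂ W) (x : Fin 3 → W) :
    ((linGroupVar G).induced (Subtype.val : H → G)).IsMorphism
      (affineVar (Matrix (Fin 3) (Fin 3) ℂ))
      fun g => Matrix.of fun j i => ℓ j (g.1.1 (x i)) :=
  (isPolyMap_matrixCoeff ℓ x).isMorphism.comp
    ((SpaceWithFunctions.induced_isMorphism _ _).comp
      (SpaceWithFunctions.induced_isMorphism (linGroupVar G) Subtype.val))

theorem isPolyMap_endo_prodMk {E W : Type*} [AddCommGroup E] [Module ℂ E] [AddCommGroup W]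
    [Module ℂ W] {Φ : E → W →ₗ[ℂ] W} (hΦ : IsPolyMap Φ)
    (A : (W →ₗ[ℂ] W) →ₗ[ℂ] (W →ₗ[ℂ] W)) : IsPolyMap fun x => (Φ x, A (Φ x)) :=
  hΦ.prodMk (hΦ.linear A)

theorem isPolyMap_tripleMap_octAdj :
    IsPolyMap fun v : Fin 3 → ComplexOctonion => (tripleMap v, octAdj (tripleMap v)) :=
  isPolyMap_endo_prodMk isPolyMap_tripleMap octAdj

variable {V : Type*} [AddCommGroup V] [Module ℂ V] (ι : V ≃ₗ[ℂ] (Fin 7 → ℂ))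

theorem act_orbitFrame (g h : G2) (i : Fin 3) :
    G2.act ι g (orbitFrame ι h i) = orbitFrame ι (g * h) i := by
  apply octEmb_injective ι
  rw [octEmb_act, octEmb_orbitFrame, octEmb_orbitFrame]
  rfl

theorem orbitMap_val_eq_smul (g : G2) :
    (orbitMap ι g).1.1 = G2.act ι g • (orbitMap ι 1).1.1 := by
  rw [orbitMap_val, orbitMap_val, Submodule.pointwise_smul_def, Submodule.map_span,
    ← Set.range_comp]
  congr 2
  funext i
  exact (congrArg (fun k => orbitFrame ι k i) (mul_one g).symm).trans
    (act_orbitFrame ι g 1 i).symm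

/-- The stabilizer of the plane `⟨e₁, e₂, e₄⟩` in `G₂`. -/
def planeStabilizer : Subgroup G2 :=
  (MulAction.stabilizer (V ≃ₗ[ℂ] V) (orbitMap ι 1).1.1).comap
    ((slStabilizer (octForm ι)).subtype.comp (G2.equivStabilizer ι).toMonoidHom)

theorem mem_planeStabilizer {g : G2} :
    g ∈ planeStabilizer ι ↔ G2.act ι g • (orbitMap ι 1).1.1 = (orbitMap ι 1).1.1 := Iff.rfl

theorem mem_planeStabilizer_iff {g : G2} :
    g ∈ planeStabilizer ι ↔ orbitMap ι g = orbitMap ι 1 := by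
  rw [mem_planeStabilizer, ← orbitMap_val_eq_smul]
  exact ⟨fun h => Subtype.ext (Subtype.ext h), fun h => by rw [h]⟩

theorem orbitMap_eq_iff {g h : G2} : orbitMap ι g = orbitMap ι h ↔ g⁻¹ * h ∈ planeStabilizer ι := by
  have hact : G2.act ι (g⁻¹ * h) = (G2.act ι g)⁻¹ * G2.act ι h :=
    congrArg Subtype.val (map_mul (G2.equivStabilizer ι) g⁻¹ h)
  rw [mem_planeStabilizer, hact, mul_smul, inv_smul_eq_iff, ← orbitMap_val_eq_smul,
    ← orbitMap_val_eq_smul]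
  exact ⟨fun H => by rw [H], fun H => Subtype.ext (Subtype.ext H.symm)⟩

theorem mem_planeStabilizer_of_mem_span {g : G2}
    (hg : ∀ i, g.1 (stdTriple i) ∈ Submodule.span ℂ (Set.range stdTriple)) :
    g ∈ planeStabilizer ι := by
  obtain ⟨h, h1, h2⟩ := exists_orbitMap_eq ι (L := orbitMap ι 1) (v := orbitFrame ι g)
    (fun i => by
      rw [orbitMap_val]
      have := Submodule.mem_map_of_mem (f := octProj ι) (hg i)
      rw [Submodule.map_span, ← Set.range_comp] at this
      exact this) (imB_orbitFrame ι g)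
  rw [mem_planeStabilizer_iff, ← h1]
  congr 1
  exact G2.ext_stdTriple fun i => by rw [h2, octEmb_orbitFrame]

theorem eq_matrixTriple_of_mem {g : G2} (hg : g ∈ planeStabilizer ι) (i : Fin 3) :
    g.1 (stdTriple i) =
      matrixTriple (Matrix.of fun j i => octB (stdTriple j) (g.1 (stdTriple i))) i := by
  have h1 : orbitFrame ι g i ∈ (orbitMap ι 1).1.1 := by
    rw [← (mem_planeStabilizer_iff ι).1 hg, orbitMap_val]
    exact Submodule.subset_span ⟨i, rfl⟩
  rw [orbitMap_val] at h1
  obtain ⟨c, hc⟩ := (Submodule.mem_span_range_iff_exists_fun ℂ).1 h1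
  have h2 := congrArg (octEmb ι) hc
  simp only [map_sum, map_smul, octEmb_orbitFrame] at h2
  have h3 : g.1 (stdTriple i) = ∑ j, c j • stdTriple j := h2.symm
  have h4 : ∀ j, octB (stdTriple j) (g.1 (stdTriple i)) = c j := fun j => by
    rw [h3]
    simp [isBasicTriple_stdTriple.orthonormal]
  simp only [matrixTriple, Matrix.of_apply, h4]
  exact h3

/-- The automorphism of the octonions with matrix `A` on `⟨e₁, e₂, e₄⟩`. -/
def orthogonalToG2 (A : Matrix.orthogonalGroup (Fin 3) ℂ) : G2 :=
  ⟨(isBasicTriple_matrixTriple A.2).equiv, (isBasicTriple_matrixTriple A.2).equiv_mem⟩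

theorem orthogonalToG2_stdTriple (A : Matrix.orthogonalGroup (Fin 3) ℂ) (i : Fin 3) :
    (orthogonalToG2 A).1 (stdTriple i) = matrixTriple A.1 i := by
  have h := (isBasicTriple_matrixTriple A.2).equiv_apply (stdTriple i)
  exact h.trans (tripleMap_apply_triple _ i)

theorem linearEquiv_matrix_mul {W : Type*} [AddCommGroup W] [Module ℂ W] (g : W ≃ₗ[ℂ] W)
    {x : Fin 3 → W} {A B : Matrix (Fin 3) (Fin 3) ℂ} (hA : ∀ i, g (x i) = ∑ j, A j i • x j)
    (i : Fin 3) : ∑ j, (A * B) j i • x j = g (∑ j, B j i • x j) := by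
  simp only [map_sum, map_smul, hA, Finset.smul_sum, smul_smul]
  rw [Finset.sum_comm]
  refine Finset.sum_congr rfl fun k _ => ?_
  rw [← Finset.sum_smul, Matrix.mul_apply]
  congr 1
  exact Finset.sum_congr rfl fun j _ => mul_comm _ _

theorem orthogonalToG2_mul (A B : Matrix.orthogonalGroup (Fin 3) ℂ) :
    orthogonalToG2 (A * B) = orthogonalToG2 A * orthogonalToG2 B := by
  refine G2.ext_stdTriple fun i => ?_
  change _ = (orthogonalToG2 A).1 ((orthogonalToG2 B).1 (stdTriple i))
  rw [orthogonalToG2_stdTriple, orthogonalToG2_stdTriple]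
  exact linearEquiv_matrix_mul (orthogonalToG2 A).1 (orthogonalToG2_stdTriple A) i

theorem orthogonalToG2_mem (A : Matrix.orthogonalGroup (Fin 3) ℂ) :
    orthogonalToG2 A ∈ planeStabilizer ι :=
  mem_planeStabilizer_of_mem_span ι fun i => by
    rw [orthogonalToG2_stdTriple]
    exact Submodule.sum_mem _ fun j _ =>
      Submodule.smul_mem _ _ (Submodule.subset_span ⟨j, rfl⟩)

theorem coeffMatrix_mem_orthogonalGroup {g : G2} (hg : g ∈ planeStabilizer ι) :
    (Matrix.of fun j i => octB (stdTriple j) (g.1 (stdTriple i))) ∈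
      Matrix.orthogonalGroup (Fin 3) ℂ := by
  refine (Matrix.mem_orthogonalGroup_iff' (Fin 3) ℂ).2 (Matrix.ext fun i j => ?_)
  have h := (G2.isBasicTriple_map g.2 isBasicTriple_stdTriple).orthonormal i j
  have h' := LinearMap.congr_fun (congrArg octB (eq_matrixTriple_of_mem ι hg i))
    (g.1 (stdTriple j))
  rw [Matrix.one_apply, Matrix.mul_apply, ← h]
  refine Eq.trans ?_ h'.symm
  rw [matrixTriple, map_sum, LinearMap.sum_apply]
  refine Finset.sum_congr rfl fun k _ => ?_
  rw [map_smul, LinearMap.smul_apply]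
  rfl

theorem coeffMatrix_orthogonalToG2 (A : Matrix.orthogonalGroup (Fin 3) ℂ) :
    (Matrix.of fun j i => octB (stdTriple j) ((orthogonalToG2 A).1 (stdTriple i))) = A.1 :=
  Matrix.ext fun j i => by
    rw [Matrix.of_apply, orthogonalToG2_stdTriple, octB_stdTriple_matrixTriple]

/-- The stabilizer of the plane `⟨e₁, e₂, e₄⟩` is the orthogonal group. -/
def orthogonalEquiv : Matrix.orthogonalGroup (Fin 3) ℂ ≃* planeStabilizer ι where
  toFun A := ⟨orthogonalToG2 A, orthogonalToG2_mem ι A⟩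
  invFun g := ⟨_, coeffMatrix_mem_orthogonalGroup ι g.2⟩
  left_inv A := Subtype.ext (coeffMatrix_orthogonalToG2 A)
  right_inv g := Subtype.ext (G2.ext_stdTriple fun i => by
    rw [orthogonalToG2_stdTriple]
    exact (eq_matrixTriple_of_mem ι g.2 i).symm)
  map_mul' A B := Subtype.ext (orthogonalToG2_mul A B)

/-- In one direction `tripleMap` and the adjoint are polynomial in the matrix; in the other, the
entries of the matrix are the inner products B(eⱼ, g eᵢ). -/
theorem orthogonalEquiv_isIsomorphism :
    orthogonalVar.IsIsomorphism ((linGroupVar G2).induced Subtype.val)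
      (orthogonalEquiv ι).toEquiv := by
  constructor
  · refine SpaceWithFunctions.IsMorphism.codRestrict
      (fun f g x U => SpaceWithFunctions.regAt_induced_congr f g x U) ?_
    refine SpaceWithFunctions.IsMorphism.induced
      (Φ := fun A => (tripleMap (matrixTriple A), octAdj (tripleMap (matrixTriple A))))
      (IsPolyMap.isMorphism ?_) fun A => ?_
    · exact isPolyMap_tripleMap_octAdj.comp isPolyMap_matrixTriple
    · exact Prod.ext rfl (G2.octAdj_eq (orthogonalEquiv ι A).1.2).symm
  · refine SpaceWithFunctions.IsMorphism.codRestrict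
      (fun f g x U => SpaceWithFunctions.regAt_induced_congr f g x U) ?_
    exact isMorphism_matrixCoeff (planeStabilizer ι) (fun j => octB (stdTriple j)) stdTriple

end

/-! ### The orbit map -/

section

variable {V : Type*} [AddCommGroup V] [Module ℂ V] (ι : V ≃ₗ[ℂ] (Fin 7 → ℂ))

/-- If x × y = 0 for all y, the formula for x × (x × y) gives B(x, y) x = B(x, x) y for all y; in
coordinates, the matrix (xᵢxⱼ) is scalar, which forces x = 0. -/
theorem octForm_tri_eq_zero {x : V} (hx : (octForm ι).tri x = 0) : x = 0 := by
  have h : ∀ y, octCross ι x y = 0 := fun y => imB_nondegenerate ι fun z => by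
    rw [imB_octCross, hx]
    rfl
  have h1 : ∀ i j, ι x i * ι x j = imB ι x x * if i = j then 1 else 0 := fun i j => by
    have h2 := octCross_octCross ι x (ι.symm (Pi.single i 1))
    rw [h, eq_comm, sub_eq_zero] at h2
    have h3 := congrFun (congrArg ι h2) j
    simpa [imB_eq_sum ι x (ι.symm _), Pi.single_apply, eq_comm] using h3
  have h2 : imB ι x x = 0 := by
    have e0 := h1 0 0
    have e1 := h1 1 1
    have e2 := h1 0 1
    simp only [if_true, mul_one, zero_ne_one, if_false, mul_zero] at e0 e1 e2
    have : imB ι x x * imB ι x x = 0 := by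
      linear_combination (-imB ι x x) * e0 + (-ι x 0 * ι x 0) * e1 + ι x 0 * ι x 1 * e2
    exact mul_self_eq_zero.1 this
  apply ι.injective
  funext i
  have := h1 i i
  rw [h2, zero_mul] at this
  simpa using this

theorem irreducibleSpace_octForm :
    @IrreducibleSpace (hyperplaneSection (octForm ι)) (sectionVar (octForm ι)).top := by
  have : FiniteDimensional ℂ V := Module.Finite.equiv ι.symm
  exact irreducibleSpace_section (fun x => octForm_tri_eq_zero ι) ⟨orbitMap ι 1⟩

/-- The orbit map on the quotient `G₂ / H`. -/
def quotientOrbitMap (y : G2 ⧸ planeStabilizer ι) : hyperplaneSection (octForm ι) :=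
  Quotient.lift (s := QuotientGroup.leftRel (planeStabilizer ι)) (orbitMap ι)
    (fun _ _ h => (orbitMap_eq_iff ι).2 (QuotientGroup.leftRel_apply.1 h)) y

theorem quotientOrbitMap_isOpenImmersion :
    ((linGroupVar G2).quotient (planeStabilizer ι)).IsOpenImmersion (sectionVar (octForm ι))
      (quotientOrbitMap ι) := by
  constructor
  · let := (linGroupVar G2).top
    let := ((linGroupVar G2).quotient (planeStabilizer ι)).top
    let := (sectionVar (octForm ι)).top
    refine Topology.IsOpenEmbedding.of_continuous_injective_isOpenMap ?_ ?_ ?_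
    · exact continuous_coinduced_dom.2 (orbitMap_isMorphism ι).1
    · intro x y hxy
      obtain ⟨g, rfl⟩ := QuotientGroup.mk_surjective x
      obtain ⟨h, rfl⟩ := QuotientGroup.mk_surjective y
      exact QuotientGroup.eq.2 ((orbitMap_eq_iff ι).1 hxy)
    · intro U hU
      have h1 := isOpen_orbitMap_image ι (isOpen_coinduced.1 hU)
      convert h1 using 1
      ext L
      constructor
      · rintro ⟨y, hy, rfl⟩
        obtain ⟨g, rfl⟩ := QuotientGroup.mk_surjective y
        exact ⟨g, hy, rfl⟩
      · rintro ⟨g, hg, rfl⟩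
        exact ⟨_, hg, rfl⟩
  · intro f x
    constructor
    · rintro hf g rfl
      exact (orbitMap_isMorphism ι).2 f g hf
    · intro hf
      obtain ⟨g, rfl⟩ := QuotientGroup.mk_surjective x
      exact regAt_of_regAt_comp_orbitMap ι (hf g rfl)

theorem quotientOrbitMap_denseRange :
    @DenseRange _ (sectionVar (octForm ι)).top _ (quotientOrbitMap ι) := by
  let := (sectionVar (octForm ι)).top
  let := ((linGroupVar G2).quotient (planeStabilizer ι)).top
  have := irreducibleSpace_octForm ι
  exact (quotientOrbitMap_isOpenImmersion ι).1.isOpen_range.dense ⟨_, ⟨((1 : G2) : G2 ⧸ _), rfl⟩⟩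

end

end

theorem mainTheorem9 {V : Type*} [AddCommGroup V] [Module ℂ V] (hV : Module.finrank ℂ V = 7) :
    (∃ ω : V [⋀^Fin 3]→ₗ[ℂ] ℂ, IsGenericForm ω) ∧
    ∀ ω : V [⋀^Fin 3]→ₗ[ℂ] ℂ, IsGenericForm ω →
      -- `X_ω` is an irreducible projective variety
      IsClosed[(projVar (⋀[ℂ]^3 V)).top] (plucker '' hyperplaneSection ω) ∧
      @IrreducibleSpace (hyperplaneSection ω) (sectionVar ω).top ∧
      -- `G₂` is the stabilizer of `ω` in `SL(V)`, and so acts on `X_ω`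
      ∃ θ : G2 ≃* slStabilizer ω,
        (linGroupVar G2).IsIsomorphism (linGroupVar (slStabilizer ω)) θ.toEquiv ∧
        -- there is a point `L` of `X_ω` with stabilizer `H` in `G₂`
        ∃ (L : hyperplaneSection ω) (H : Subgroup G2),
          (∀ g : G2, g ∈ H ↔ (θ g : V ≃ₗ[ℂ] V) • L.1.1 = L.1.1) ∧
          -- `H` is isomorphic to `O₃` as an algebraic group
          (∃ e : Matrix.orthogonalGroup (Fin 3) ℂ ≃* H,
            orthogonalVar.IsIsomorphism ((linGroupVar G2).induced Subtype.val) e.toEquiv) ∧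
          -- the orbit map identifies `G₂ / H` with a dense open subset of `X_ω`
          ∃ j : G2 ⧸ H → hyperplaneSection ω,
            (∀ g : G2, (j (g : G2 ⧸ H)).1.1 = (θ g : V ≃ₗ[ℂ] V) • L.1.1) ∧
            ((linGroupVar G2).quotient H).IsOpenImmersion (sectionVar ω) j ∧
            @DenseRange _ (sectionVar ω).top _ j := by
  have : FiniteDimensional ℂ V := Module.finite_of_finrank_pos (by rw [hV]; norm_num)
  let ι₀ : V ≃ₗ[ℂ] (Fin 7 → ℂ) := (Module.finBasisOfFinrankEq ℂ V hV).equivFun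
  refine ⟨⟨_, isGenericForm_octForm ι₀⟩, fun ω hω => ?_⟩
  obtain ⟨ι, rfl⟩ := exists_eq_octForm ι₀ hω
  exact ⟨isClosed_plucker_image _, irreducibleSpace_octForm ι, G2.equivStabilizer ι,
    G2.isIsomorphism_equivStabilizer ι, orbitMap ι 1, planeStabilizer ι,
    fun g => mem_planeStabilizer ι, ⟨orthogonalEquiv ι, orthogonalEquiv_isIsomorphism ι⟩,
    quotientOrbitMap ι, orbitMap_val_eq_smul ι, quotientOrbitMap_isOpenImmersion ι,
    quotientOrbitMap_denseRange ι⟩
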